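/- Notation. Let $d,b\ge 1$, $\|n\|=\max_i|n_i|$ on $\mathbb Z^d$, $\mathbb T=\mathbb R/\mathbb Z$. Let $A:\mathbb Z^d\times\mathbb Z^d\to\mathbb C$ satisfy, with $C_1,c_1>0$ and for all $n,n',k\in\mathbb Z^d$, $|A(n,n')|\le C_1e^{-c_1\|n-n'\|}$, $A(n,n')=\overline{A(n',n)}$, $A(n+k,n'+k)=A(n,n')$. Let $v:\mathbb T^b\to\mathbb R$ be real analytic, and let $f:\mathbb Z^d\times\mathbb T^b\to\mathbb T^b$, $f^nx=f(n,x)$, satisfy $f(m+n,x)=f(m,f(n,x))$. Assume that the functions $v\circ f^n$ are real analytic with a radius of analyticity decaying at most polynomially in $n$: there are $M,R>0$ and $\kappa\in\mathbb R$ such that for all $n\in\mathbb Z^d$, $k\ge 0$ the $k$-th derivative of $v\circ f^n$ (lifted to $\mathbb R^b$ with the maximum norm) is bounded in norm by $M\,k!\,\big(R(1+\|n\|)^{\kappa}\big)^k$. (This holds for shifts and skew-shifts.) On $\ell^2(\mathbb Z^d)$ let $$(H_xu)_n=\sum_{n'\in\mathbb Z^d}A(n,n')u_{n'}+v(f^nx)\,u_n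 ,\qquad x\in\mathbb T^b .$$ For $p>0$ and $\phi\in\ell^2(\mathbb Z^d)$ put $$\langle|X_H|^p_\phi\rangle(T)=\sum_{n}\|n\|^p|(e^{-iTH}\phi,\delta_n)|^2,\qquad \langle|\tilde X_H|^p_\phi\rangle(T)=\frac2T\int_0^\infty e^{-2t/T}\langle|X_H|^p_\phi\rangle(t)\,dt .$$ Elementary regions of size $N$ centered at $0$ are the cube $[-N,N]^d$ and the sets $[-N,N]^d\setminus\{n: n_i\,\varsigma_i\,0,\ 1\le i\le d\}$ with each $\varsigma_i\in\{<,>,\emptyset\}$ (where $\emptyset$ means no condition), at least two of them different from $\emptyset$. For finite $\Lambda\subset\mathbb Z^d$ let $G_\Lambda(z)=(R_\Lambda(H_x-z)R_\Lambda)^{-1}$ be the Green's function on $\ell^2(\Lambda)$, where $R_\Lambda$ is the restriction to $\Lambda$. LDT. Let $0<\sigma_1<1$, $\sigma_2,c_2,\epsilon_0>0$, $K\in\mathbb R$, $N_0\in\mathbb N$. The family $(H_x)$ satisfies the LDT if for every $N\ge N_0$ and every $z=E+i\epsilon$ with $E\in[-K,K]$, $0<\epsilon\le\epsilon_0$, there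 is $X_N\subset\mathbb T^b$ with $\mathrm{Leb}(X_N)\le e^{-N^{\sigma_2}}$ such that for all $x\notin X_N$ and all elementary regions $Q_N$ of size $N$ centered at $0$, $$\|G_{Q_N}(z)\|\le e^{N^{\sigma_1}},\qquad |G_{Q_N}(z)(n,n')|\le e^{-c_2\|n-n'\|}\ \text{ for } \|n-n'\|\ge N/10 .$$ Semi-algebraic sets. $\mathcal S\subset\mathbb R^b$ is (closed) semi-algebraic of degree at most $sD$ if it is a finite union of finite intersections of sets $\{P_\ell\ \varsigma\ 0\}$, $\varsigma\in\{\ge,\le,=\}$, formed with $s$ real polynomials $P_1,\dots,P_s$ of degree at most $D$. Sublinear bound. Let $\delta,C_2,C_3>0$. The orbit of $x$ satisfies the sublinear bound if for every integer $B\ge1$, every $\eta>0$, every semi-algebraic $\mathcal S\subset[0,1]^b$ of degree at most $B$ with $\mathrm{Leb}(\mathcal S)<\eta$, and every integer $N\ge1$ with $\log B\le C_3\log N$ and $\log N<\log\frac1\eta$, $$\#\{n\in[-N,N]^d:\ f^nx\in\mathcal S \bmod \mathbb Z^b\}\le C_2N^{1-\delta}.$$ Theorem. Let $p>0$, let $\phi\in\ell^2(\mathbb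 Z^d)$ have compact (finite) support and let $\varepsilon>0$. There is $T_0>0$, depending only on $d,b,p,\phi,K,\sigma_1,\sigma_2,\delta,\epsilon_0,c_1,c_2,C_1,C_2,N_0,\varepsilon$ and on $C_3,M,R,\kappa$, such that for all $A,v,f$ as above for which the LDT holds, for every $x\in\mathbb T^b$ such that $\sigma(H_x)\subset[-K+1,K-1]$ and the orbit of $x$ satisfies the sublinear bound, and for every $T\ge T_0$, $$\langle|\tilde X_{H_x}|^p_\phi\rangle(T)\le(\log T)^{\frac p\delta+\varepsilon},\qquad \langle|X_{H_x}|^p_\phi\rangle(T)\le(\log T)^{\frac p\delta+\varepsilon}.$$ -/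

import Mathlib

open scoped ENNReal

namespace LongRange

/-- The Hilbert space `ℓ²(ℤᵈ)`. -/
abbrev Hil (d : ℕ) : Type := lp (fun _ : Fin d → ℤ => ℂ) 2

/-- The torus `𝕋ᵇ = (ℝ/ℤ)ᵇ`; its `volume` is the normalized Haar (Lebesgue) measure. -/
abbrev Torus (b : ℕ) : Type := Fin b → UnitAddCircle

/-- The projection `ℝᵇ → 𝕋ᵇ`, `y ↦ y mod ℤᵇ`. -/
noncomputable def toTorus {b : ℕ} (y : Fin b → ℝ) : Torus b := fun i => (y i : UnitAddCircle)

/-- The three conditions on the long-range kernel `A`: exponential decay, hermiticity and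
translation invariance. Here `‖·‖` is the maximum norm on `ℤᵈ`. -/
structure IsKernel {d : ℕ} (A : (Fin d → ℤ) → (Fin d → ℤ) → ℂ) (C₁ c₁ : ℝ) : Prop where
  decay : ∀ m n, ‖A m n‖ ≤ C₁ * Real.exp (-c₁ * ‖m - n‖)
  hermitian : ∀ m n, A m n = (starRingEnd ℂ) (A n m)
  translation : ∀ m n k, A (m + k) (n + k) = A m n

/-- `H` acts on `ℓ²(ℤᵈ)` by `(H u)ₘ = ∑ₙ A(m,n) uₙ + V(m) uₘ`. -/
def ActsBy {d : ℕ} (A : (Fin d → ℤ) → (Fin d → ℤ) → ℂ) (V : (Fin d → ℤ) → ℝ)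
    (H : Hil d →L[ℂ] Hil d) : Prop :=
  ∀ (u : Hil d) (m : Fin d → ℤ),
    Summable (fun n => A m n * u n) ∧ (H u) m = ∑' n, A m n * u n + (V m : ℂ) * u m

open Classical in
/-- The bounded operator `(H u)ₘ = ∑ₙ A(m,n) uₙ + V(m) uₘ` on `ℓ²(ℤᵈ)`. It is the unique operator
acting in this way, and it exists for all kernels and bounded potentials
(`actsBy_longRangeOp`); the default value `0` is never used for those. -/
noncomputable def longRangeOp {d : ℕ} (A : (Fin d → ℤ) → (Fin d → ℤ) → ℂ)
    (V : (Fin d → ℤ) → ℝ) : Hil d →L[ℂ] Hil d :=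
  if h : ∃ H : Hil d →L[ℂ] Hil d, ActsBy A V H then h.choose else 0

theorem summable_exp_norm {d : ℕ} {c : ℝ} (hc : 0 < c) :
    Summable fun k : Fin d → ℤ => Real.exp (-c * ‖k‖) := by
  rcases Nat.eq_zero_or_pos d with rfl | hd
  · exact Summable.of_finite
  have hd' : (0 : ℝ) < d := by exact_mod_cast hd
  set g : ℤ → ℝ := fun j => Real.exp (-(c / d) * |(j : ℝ)|) with hg
  have hgs : Summable g := by
    have h1 : Summable fun n : ℕ => Real.exp (-(c / d) * n) := by
      have := Real.summable_exp_nat_mul_iff (a := -(c / d)) |>.2 (by simp; positivity)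
      simpa [mul_comm] using this
    refine Summable.of_nat_of_neg ?_ ?_ <;> simpa [hg] using h1
  have hle : ∀ k : Fin d → ℤ, Real.exp (-c * ‖k‖) ≤ ∏ i, g (k i) := by
    intro k
    rw [hg, ← Real.exp_sum]
    apply Real.exp_le_exp.2
    rw [← Finset.mul_sum]
    have h2 : ∑ i, |((k i : ℤ) : ℝ)| ≤ d * ‖k‖ := by
      calc ∑ i, |((k i : ℤ) : ℝ)| ≤ ∑ _i : Fin d, ‖k‖ := by
            apply Finset.sum_le_sum
            intro i _
            have := norm_le_pi_norm k i
            rwa [Int.norm_eq_abs] at this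
        _ = d * ‖k‖ := by simp
    have h3 : c / d * ∑ i, |((k i : ℤ) : ℝ)| ≤ c / d * (d * ‖k‖) := by gcongr
    have h4 : c / d * (d * ‖k‖) = c * ‖k‖ := by field_simp
    linarith
  refine Summable.of_nonneg_of_le (fun _ => (Real.exp_pos _).le) hle ?_
  refine summable_of_sum_le (c := (∑' j, g j) ^ d)
    (fun k => Finset.prod_nonneg fun i _ => (Real.exp_pos _).le) ?_
  intro u
  calc ∑ k ∈ u, ∏ i, g (k i)
      ≤ ∑ k ∈ Fintype.piFinset fun i => u.image fun k => k i, ∏ i, g (k i) := by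
        apply Finset.sum_le_sum_of_subset_of_nonneg
        · intro k hk
          rw [Fintype.mem_piFinset]
          intro i
          exact Finset.mem_image_of_mem _ hk
        · intro k _ _
          exact Finset.prod_nonneg fun i _ => (Real.exp_pos _).le
    _ = ∏ i, ∑ j ∈ u.image fun k => k i, g j := (Finset.prod_univ_sum _ _).symm
    _ ≤ ∏ _i : Fin d, ∑' j, g j := by
        apply Finset.prod_le_prod
        · intro i _
          exact Finset.sum_nonneg fun _ _ => (Real.exp_pos _).le
        · intro i _
          exact hgs.sum_le_tsum _ fun _ _ => (Real.exp_pos _).le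
    _ = (∑' j, g j) ^ d := by simp

theorem hil_norm_sq {d : ℕ} (u : Hil d) : HasSum (fun n => ‖u n‖ ^ 2) (‖u‖ ^ 2) := by
  have h := lp.hasSum_norm (p := 2) (by simp) u
  simpa using h

theorem exists_shift {d : ℕ} (k : Fin d → ℤ) :
    ∃ S : Hil d →L[ℂ] Hil d, ‖S‖ ≤ 1 ∧ ∀ u m, (S u) m = u (m + k) := by
  have hmem : ∀ u : Hil d, Memℓp (fun m => u (m + k)) 2 := by
    intro u
    apply memℓp_gen
    have := (hil_norm_sq u).summable
    rw [← (Equiv.addRight k).summable_iff] at this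
    simpa [Function.comp_def] using this
  let S₀ : Hil d →ₗ[ℂ] Hil d :=
    { toFun := fun u => ⟨fun m => u (m + k), hmem u⟩
      map_add' := fun u w => by ext m; rfl
      map_smul' := fun a u => by ext m; rfl }
  have hS : ∀ u, ‖S₀ u‖ ≤ 1 * ‖u‖ := by
    intro u
    have h1 := hil_norm_sq (S₀ u)
    have h2 := hil_norm_sq u
    rw [← (Equiv.addRight k).hasSum_iff] at h2
    have h3 : ‖S₀ u‖ ^ 2 = ‖u‖ ^ 2 := h1.unique h2
    rw [one_mul]
    exact (pow_le_pow_iff_left₀ (norm_nonneg _) (norm_nonneg _) two_ne_zero).1 h3.le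
  exact ⟨S₀.mkContinuous 1 hS, S₀.mkContinuous_norm_le zero_le_one hS, fun u m => rfl⟩

theorem exists_mul {d : ℕ} (V : (Fin d → ℤ) → ℝ) (W : ℝ) (hV : ∀ n, |V n| ≤ W) :
    ∃ S : Hil d →L[ℂ] Hil d, ∀ u m, (S u) m = (V m : ℂ) * u m := by
  have hW : 0 ≤ W := (abs_nonneg _).trans (hV 0)
  have hb : ∀ (u : Hil d) m, ‖(V m : ℂ) * u m‖ ^ 2 ≤ W ^ 2 * ‖u m‖ ^ 2 := by
    intro u m
    rw [norm_mul, mul_pow]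
    have : ‖(V m : ℂ)‖ ≤ W := by simpa using hV m
    gcongr
  have hs : ∀ u : Hil d, Summable fun m => ‖(V m : ℂ) * u m‖ ^ 2 := fun u =>
    Summable.of_nonneg_of_le (fun _ => by positivity) (hb u)
      ((hil_norm_sq u).summable.mul_left _)
  have hmem : ∀ u : Hil d, Memℓp (fun m => (V m : ℂ) * u m) 2 := by
    intro u
    apply memℓp_gen
    simpa using hs u
  let S₀ : Hil d →ₗ[ℂ] Hil d :=
    { toFun := fun u => ⟨fun m => (V m : ℂ) * u m, hmem u⟩
      map_add' := fun u w => by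
        ext m
        exact mul_add _ _ _
      map_smul' := fun a u => by
        ext m
        exact mul_left_comm _ _ _ }
  have hS : ∀ u, ‖S₀ u‖ ≤ W * ‖u‖ := by
    intro u
    have h1 := hil_norm_sq (S₀ u)
    have h2 := (hil_norm_sq u).mul_left (W ^ 2)
    have h3 : ‖S₀ u‖ ^ 2 ≤ W ^ 2 * ‖u‖ ^ 2 := hasSum_le (hb u) h1 h2
    rw [← mul_pow] at h3
    exact (pow_le_pow_iff_left₀ (norm_nonneg _) (by positivity) two_ne_zero).1 h3
  exact ⟨S₀.mkContinuous W hS, fun u m => rfl⟩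

/-- The operator exists: for a kernel satisfying the standing conditions and a bounded potential,
`longRangeOp A V` does act by the formula. -/
theorem actsBy_longRangeOp {d : ℕ} {A : (Fin d → ℤ) → (Fin d → ℤ) → ℂ} {C₁ c₁ : ℝ}
    (hc₁ : 0 < c₁) (hA : IsKernel A C₁ c₁) (V : (Fin d → ℤ) → ℝ) (W : ℝ)
    (hV : ∀ n, |V n| ≤ W) : ActsBy A V (longRangeOp A V) := by
  have hex : ∃ H : Hil d →L[ℂ] Hil d, ActsBy A V H := by
    choose S hS1 hS using fun k : Fin d → ℤ => exists_shift k
    obtain ⟨D, hD⟩ := exists_mul V W hV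
    have hsum : Summable fun k => A 0 k • S k := by
      refine Summable.of_norm_bounded (g := fun k => C₁ * Real.exp (-c₁ * ‖k‖))
        ((summable_exp_norm hc₁).mul_left _) ?_
      intro k
      have h0 := hA.decay 0 k
      rw [zero_sub, norm_neg] at h0
      calc ‖A 0 k • S k‖ = ‖A 0 k‖ * ‖S k‖ := norm_smul _ _
        _ ≤ ‖A 0 k‖ * 1 := by
            gcongr
            exact hS1 k
        _ ≤ _ := by simpa using h0
    refine ⟨(∑' k, A 0 k • S k) + D, fun u m => ?_⟩
    let ev : (Hil d →L[ℂ] Hil d) →L[ℂ] ℂ :=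
      (lp.evalCLM ℂ (fun _ : Fin d → ℤ => ℂ) 2 m).comp (ContinuousLinearMap.apply ℂ (Hil d) u)
    have h1 := hsum.hasSum.mapL ev
    have h2 : HasSum (fun k => A 0 k * u (m + k)) (((∑' k, A 0 k • S k) u) m) := by
      have he : (fun k => ev (A 0 k • S k)) = fun k => A 0 k * u (m + k) := by
        funext k
        change A 0 k * (S k u) m = _
        rw [hS]
      exact he ▸ h1
    have h3 : HasSum (fun n => A m n * u n) (((∑' k, A 0 k • S k) u) m) := by
      rw [← (Equiv.addLeft m).hasSum_iff]
      have he : ((fun n => A m n * u n) ∘ Equiv.addLeft m) = fun k => A 0 k * u (m + k) := by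
        funext k
        have := hA.translation 0 k m
        rw [zero_add, add_comm k m] at this
        simp [this]
      exact he.symm ▸ h2
    refine ⟨h3.summable, ?_⟩
    rw [h3.tsum_eq]
    change ((∑' k, A 0 k • S k) u) m + (D u) m = _
    rw [hD]
  rw [longRangeOp, dif_pos hex]
  exact hex.choose_spec

/-- The dynamically defined potential `n ↦ v(f(n,x))`. -/
def potential {d b : ℕ} (v : Torus b → ℝ) (f : (Fin d → ℤ) → Torus b → Torus b) (x : Torus b) :
    (Fin d → ℤ) → ℝ := fun n => v (f n x)

/-- The cube `[-N,N]ᵈ` in `ℤᵈ`. -/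
noncomputable def cube (d N : ℕ) : Finset (Fin d → ℤ) :=
  Fintype.piFinset fun _ => Finset.Icc (-(N : ℤ)) (N : ℤ)

/-- `Q` is an elementary region of size `N` centered at `0`: the cube `[-N,N]ᵈ`, or the cube minus
`{n : nᵢ ςᵢ 0 for all i}` where each `ςᵢ` is `<`, `>` or no condition (encoded by the signs
`-1`, `1`, `0`), at least two of them being actual conditions. -/
def IsElementaryRegion {d : ℕ} (N : ℕ) (Q : Finset (Fin d → ℤ)) : Prop :=
  Q = cube d N ∨
    ∃ ς : Fin d → SignType, (∃ i j, i ≠ j ∧ ς i ≠ 0 ∧ ς j ≠ 0) ∧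
      ∀ n, n ∈ Q ↔ n ∈ cube d N ∧ ¬ ∀ i, ς i ≠ 0 → SignType.sign (n i) = ς i

open Classical in
/-- The Green's function `G_Λ(z) = (R_Λ (H - z) R_Λ)⁻¹` of a finite region `Λ`, as a matrix indexed
by `Λ`, for `H` with kernel `A` and potential `V`. (For real `V`, hermitian `A` and `Im z > 0` the
inverted matrix is invertible.) -/
noncomputable def green {d : ℕ} (A : (Fin d → ℤ) → (Fin d → ℤ) → ℂ) (V : (Fin d → ℤ) → ℝ)
    (Λ : Finset (Fin d → ℤ)) (z : ℂ) : Matrix Λ Λ ℂ :=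
  (Matrix.of fun m n : Λ =>
    A (m : Fin d → ℤ) (n : Fin d → ℤ) + if m = n then (V (m : Fin d → ℤ) : ℂ) - z else 0)⁻¹

open Classical in
/-- The two bounds on the Green's function of the region `Q` of size `N`: the operator norm on
`ℓ²(Q)` is at most `exp(N^σ₁)`, and the matrix elements decay off the diagonal. -/
def IsStronglyGood {d : ℕ} (A : (Fin d → ℤ) → (Fin d → ℤ) → ℂ) (V : (Fin d → ℤ) → ℝ)
    (σ₁ c₂ : ℝ) (N : ℕ) (Q : Finset (Fin d → ℤ)) (z : ℂ) : Prop :=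
  ‖Matrix.toEuclideanCLM (n := Q) (𝕜 := ℂ) (green A V Q z)‖ ≤ Real.exp ((N : ℝ) ^ σ₁) ∧
  ∀ m n : Q, (N : ℝ) / 10 ≤ ‖(m : Fin d → ℤ) - (n : Fin d → ℤ)‖ →
    ‖green A V Q z m n‖ ≤ Real.exp (-c₂ * ‖(m : Fin d → ℤ) - (n : Fin d → ℤ)‖)

/-- The large deviation theorem (LDT) in complexified energies for the family `(H_x)`. As usual,
the exceptional set `X` of scale `N` is allowed to depend on the energy `z = E + iε`. -/
def LDT {d b : ℕ} (A : (Fin d → ℤ) → (Fin d → ℤ) → ℂ) (v : Torus b → ℝ)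
    (f : (Fin d → ℤ) → Torus b → Torus b) (K σ₁ σ₂ c₂ ε₀ : ℝ) (N₀ : ℕ) : Prop :=
  ∀ N : ℕ, N₀ ≤ N → ∀ E ε : ℝ, |E| ≤ K → 0 < ε → ε ≤ ε₀ →
    ∃ X : Set (Torus b),
      MeasureTheory.volume X ≤ ENNReal.ofReal (Real.exp (-((N : ℝ) ^ σ₂))) ∧
      ∀ x, x ∉ X → ∀ Q : Finset (Fin d → ℤ), IsElementaryRegion N Q →
        IsStronglyGood A (potential v f x) σ₁ c₂ N Q ((E : ℂ) + (ε : ℂ) * Complex.I)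

/-- `S ⊆ ℝᵇ` is a (closed) semi-algebraic set of degree at most `B`: with `s` polynomials of degree
at most `D`, `s * D ≤ B`, it is a finite union of finite intersections of sets `{P ς 0}`, where
`ς` is `≥`, `≤` or `=` (encoded by the signs `1`, `-1`, `0`). -/
def IsSemialgebraicOfDegreeLE {b : ℕ} (S : Set (Fin b → ℝ)) (B : ℕ) : Prop :=
  ∃ (s D : ℕ) (P : Fin s → MvPolynomial (Fin b) ℝ) (J : ℕ) (L : Fin J → Finset (Fin s))
    (ς : Fin J → Fin s → SignType),
    s * D ≤ B ∧ (∀ ℓ, (P ℓ).totalDegree ≤ D) ∧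
    S = ⋃ j, ⋂ ℓ ∈ L j, {y | match ς j ℓ with
      | .pos => 0 ≤ MvPolynomial.eval y (P ℓ)
      | .neg => MvPolynomial.eval y (P ℓ) ≤ 0
      | .zero => MvPolynomial.eval y (P ℓ) = 0}

/-- The sublinear bound for the orbit of `x`: for every semi-algebraic `S ⊆ [0,1]ᵇ` of degree `B`
with `Leb(S) < η`, and every `N` with `log B ≤ C₃ log N` and `log N < log (1/η)`,
`#{n ∈ [-N,N]ᵈ : fⁿ x ∈ S mod ℤᵇ} ≤ C₂ N^(1-δ)`. -/
def SublinearBound {d b : ℕ} (f : (Fin d → ℤ) → Torus b → Torus b) (x : Torus b)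
    (δ C₂ C₃ : ℝ) : Prop :=
  ∀ (B : ℕ) (η : ℝ) (S : Set (Fin b → ℝ)), 1 ≤ B → 0 < η →
    IsSemialgebraicOfDegreeLE S B → S ⊆ Set.Icc 0 1 →
    MeasureTheory.volume S < ENNReal.ofReal η →
    ∀ N : ℕ, 1 ≤ N → Real.log B ≤ C₃ * Real.log N → Real.log N < Real.log (1 / η) →
      (Set.ncard {n : Fin d → ℤ | n ∈ cube d N ∧ f n x ∈ toTorus '' S} : ℝ)
        ≤ C₂ * (N : ℝ) ^ (1 - δ)

/-- The functions `x ↦ v(fⁿ x)` on the torus are real analytic, with a radius of analyticity that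
decays at most polynomially in `n`: their derivatives of order `k` are at most
`M k! (R (1 + ‖n‖)^κ)^k`. -/
def PolynomiallyAnalytic {d b : ℕ} (v : Torus b → ℝ) (f : (Fin d → ℤ) → Torus b → Torus b)
    (M R κ : ℝ) : Prop :=
  ∀ n : Fin d → ℤ,
    AnalyticOnNhd ℝ (fun y : Fin b → ℝ => v (f n (toTorus y))) Set.univ ∧
    ∀ (k : ℕ) (y : Fin b → ℝ),
      ‖iteratedFDeriv ℝ k (fun y : Fin b → ℝ => v (f n (toTorus y))) y‖ ≤
        M * (k.factorial : ℝ) * (R * (1 + ‖n‖) ^ κ) ^ k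

/-- The `p`-th moment `∑ₙ ‖n‖^p |(e^{-itH} φ, δₙ)|²` of the position operator at time `t`, with
values in `[0,∞]`. -/
noncomputable def moment {d : ℕ} (H : Hil d →L[ℂ] Hil d) (φ : Hil d) (p t : ℝ) : ℝ≥0∞ :=
  ∑' n : Fin d → ℤ,
    ENNReal.ofReal (‖n‖ ^ p * ‖(NormedSpace.exp ((-(Complex.I * (t : ℂ))) • H) φ) n‖ ^ 2)

/-- The time average `(2/T) ∫₀^∞ e^{-2t/T} (moment at time t) dt`, with values in `[0,∞]`. -/
noncomputable def avgMoment {d : ℕ} (H : Hil d →L[ℂ] Hil d) (φ : Hil d) (p T : ℝ) : ℝ≥0∞ :=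
  ENNReal.ofReal (2 / T) *
    ∫⁻ t in Set.Ioi (0 : ℝ), ENNReal.ofReal (Real.exp (-2 * t / T)) * moment H φ p t

end LongRange

namespace LongRange

/-! The bound is proved at each fixed large time T, and the averaged bound is deduced from it. Put l
= log T and L = ⌊l^α⌋ with α slightly larger than 1/δ. It suffices that e^{-iTH}φ is smaller than a
prescribed power of 1/T at every site with ‖n‖ ≥ L. The cube of size L then contributes about
l^{αp}, the sites with L ≤ ‖n‖ ≤ T² contribute O(1), and the region beyond T² is negligible by a
ballistic bound.

By Laplace transform and Fourier inversion (`norm_evolution_le`) the evolution at time T is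
controlled by an integral over E of the resolvent solution w of (H - z)w = -iφ on the line z = E +
i/T. For |E| ≥ K, conjugation with exponential weights gives decay in n together with a factor 1/E²,
so the integral converges (`exists_decay_constants`).

For |E| ≤ K the arithmetic of the orbit enters. By the cocycle property of f and translation
invariance of A, the Green's function of the cube of size N around n at phase x is the one around 0
at phase fⁿx. Replacing the potential by Taylor polynomials on a fine grid covers the phases that
are bad at scale N by a semi-algebraic set; its degree is polynomial in N and it lies inside the
exceptional set of the LDT (`exists_semialgebraic_cover`). With N a small power of L, the sublinear
bound leaves at most C₂ L^{1-δ} bad sites in the cube of size L (`ncard_not_hasGreenRow_le`).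

Since αδ > 1, more than C₂ L^{1-δ} disjoint shells of width of order log T fit into that cube, so
one contains no bad site (`exists_shell_avoiding`). In it, iterating the Green's function identity
makes w smaller at the middle sphere by a factor exp(-cW/4), a power of 1/T
(`norm_le_exp_of_shell`). Cutting w off at that sphere and applying ‖(H - z)⁻¹‖ ≤ T carries the
smallness to all sites outside (`norm_le_of_shell`); the losses are a power of T and a power of log
T, which the width of the shell is chosen to beat.

All thresholds are found before A, v, f and x are introduced: the asymptotic lemmas quantify over
the operators inside the `∀ᶠ`, which makes T₀ uniform. -/

/-! ### Bounded operators on ℓ²(ℤᵈ): Schur's test, self-adjointness, resolvent and unitary bounds.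
-/

theorem exists_mul_complex {d : ℕ} (b : (Fin d → ℤ) → ℂ) (W : ℝ) (hb : ∀ n, ‖b n‖ ≤ W) :
    ∃ S : Hil d →L[ℂ] Hil d, ‖S‖ ≤ W ∧ ∀ u m, (S u) m = b m * u m := by
  have hW : 0 ≤ W := (norm_nonneg _).trans (hb 0)
  have hbd : ∀ (u : Hil d) m, ‖b m * u m‖ ^ 2 ≤ W ^ 2 * ‖u m‖ ^ 2 := by
    intro u m
    rw [norm_mul, mul_pow]
    have := hb m
    gcongr
  have hs : ∀ u : Hil d, Summable fun m => ‖b m * u m‖ ^ 2 := fun u =>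
    Summable.of_nonneg_of_le (fun _ => by positivity) (hbd u)
      ((hil_norm_sq u).summable.mul_left _)
  have hmem : ∀ u : Hil d, Memℓp (fun m => b m * u m) 2 := by
    intro u
    apply memℓp_gen
    simpa using hs u
  let S₀ : Hil d →ₗ[ℂ] Hil d :=
    { toFun := fun u => ⟨fun m => b m * u m, hmem u⟩
      map_add' := fun u w => by
        ext m
        exact mul_add _ _ _
      map_smul' := fun a u => by
        ext m
        exact mul_left_comm _ _ _ }
  have hS : ∀ u, ‖S₀ u‖ ≤ W * ‖u‖ := by
    intro u
    have h1 := hil_norm_sq (S₀ u)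
    have h2 := (hil_norm_sq u).mul_left (W ^ 2)
    have h3 : ‖S₀ u‖ ^ 2 ≤ W ^ 2 * ‖u‖ ^ 2 := hasSum_le (hbd u) h1 h2
    rw [← mul_pow] at h3
    exact (pow_le_pow_iff_left₀ (norm_nonneg _) (by positivity) two_ne_zero).1 h3
  exact ⟨S₀.mkContinuous W hS, S₀.mkContinuous_norm_le hW hS, fun u m => rfl⟩

/-- Schur's test for kernels dominated by a convolution kernel. -/
theorem exists_schur {d : ℕ} (B : (Fin d → ℤ) → (Fin d → ℤ) → ℂ) (g : (Fin d → ℤ) → ℝ)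
    (hg : Summable g) (hB : ∀ m k, ‖B m (m + k)‖ ≤ g k) :
    ∃ S : Hil d →L[ℂ] Hil d, ‖S‖ ≤ ∑' k, g k ∧
      ∀ u m, HasSum (fun n => B m n * u n) ((S u) m) := by
  choose S hS1 hS using fun k : Fin d → ℤ => exists_shift k
  choose D hD1 hD using fun k : Fin d → ℤ =>
    exists_mul_complex (fun m => B m (m + k)) (g k) (fun m => hB m k)
  have hn : ∀ k, ‖D k * S k‖ ≤ g k := by
    intro k
    have hg0 : 0 ≤ g k := (norm_nonneg _).trans (hD1 k)
    calc ‖D k * S k‖ ≤ ‖D k‖ * ‖S k‖ := norm_mul_le _ _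
      _ ≤ g k * 1 := mul_le_mul (hD1 k) (hS1 k) (norm_nonneg _) hg0
      _ = g k := mul_one _
  have hsum : Summable fun k => D k * S k := Summable.of_norm_bounded hg hn
  refine ⟨∑' k, D k * S k, tsum_of_norm_bounded hg.hasSum hn, fun u m => ?_⟩
  let ev : (Hil d →L[ℂ] Hil d) →L[ℂ] ℂ :=
    (lp.evalCLM ℂ (fun _ : Fin d → ℤ => ℂ) 2 m).comp (ContinuousLinearMap.apply ℂ (Hil d) u)
  have h1 := hsum.hasSum.mapL ev
  rw [← (Equiv.addLeft m).hasSum_iff]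
  have he : (fun k => ev (D k * S k)) = (fun n => B m n * u n) ∘ Equiv.addLeft m := by
    funext k
    change (D k (S k u)) m = _
    rw [hD, hS]
    rfl
  exact he ▸ h1

theorem norm_coord_le {d : ℕ} (u : Hil d) (n : Fin d → ℤ) : ‖u n‖ ≤ ‖u‖ :=
  lp.norm_apply_le_norm (by simp) u n

theorem ActsBy.hasSum {d : ℕ} {A : (Fin d → ℤ) → (Fin d → ℤ) → ℂ} {V : (Fin d → ℤ) → ℝ}
    {H : Hil d →L[ℂ] Hil d} (h : ActsBy A V H) (u : Hil d) (m : Fin d → ℤ) :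
    HasSum (fun n => A m n * u n) ((H u) m - (V m : ℂ) * u m) := by
  have h1 := (h u m).1.hasSum
  rw [(h u m).2]
  simpa using h1

theorem ActsBy.isSelfAdjoint {d : ℕ} {A : (Fin d → ℤ) → (Fin d → ℤ) → ℂ}
    {V : (Fin d → ℤ) → ℝ} {H : Hil d →L[ℂ] Hil d} (h : ActsBy A V H)
    (hA : ∀ m n, A m n = (starRingEnd ℂ) (A n m)) : IsSelfAdjoint H := by
  classical
  have hcol : ∀ m n, (H (lp.single 2 m (1 : ℂ))) n = A n m + if n = m then (V m : ℂ) else 0 := by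
    intro m n
    rw [(h _ n).2, tsum_eq_single m]
    · by_cases hnm : n = m
      · subst hnm; simp
      · simp [hnm]
    · intro k hk
      simp [hk]
  rw [ContinuousLinearMap.isSelfAdjoint_iff']
  ext u m
  have h1 : (ContinuousLinearMap.adjoint H u) m
      = inner ℂ (lp.single 2 m (1 : ℂ)) (ContinuousLinearMap.adjoint H u) := by
    rw [lp.inner_single_left]; simp
  rw [h1, ContinuousLinearMap.adjoint_inner_right]
  have h2 := lp.hasSum_inner (𝕜 := ℂ) (H (lp.single 2 m (1 : ℂ))) u
  have h3 : HasSum (fun n => A m n * u n + if n = m then (V m : ℂ) * u m else 0)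
      ((H u) m - (V m : ℂ) * u m + (V m : ℂ) * u m) :=
    (h.hasSum u m).add (hasSum_ite_eq m _)
  rw [sub_add_cancel] at h3
  have h4 : (fun n => inner ℂ ((H (lp.single 2 m (1 : ℂ))) n) (u n))
      = fun n => A m n * u n + if n = m then (V m : ℂ) * u m else 0 := by
    funext n
    rw [hcol, hA m n]
    by_cases hnm : n = m
    · subst hnm; simp; ring
    · simp [hnm, mul_comm]
  rw [h4] at h2
  exact h2.unique h3

/-- For a self-adjoint operator the norm equals the spectral radius. The spectrum being nonempty
also forces K ≥ 1, which is needed to return from `ENNReal` to real numbers. -/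
theorem norm_le_of_spectrum_subset {d : ℕ} {H : Hil d →L[ℂ] Hil d} (hH : IsSelfAdjoint H)
    {K : ℝ} (hs : spectrum ℂ H ⊆ Complex.ofReal '' Set.Icc (-K + 1) (K - 1)) :
    ‖H‖ ≤ K - 1 := by
  classical
  have : Nontrivial (Hil d) := by
    refine ⟨lp.single 2 0 (1 : ℂ), 0, fun h0 => ?_⟩
    have := congrArg (fun u : Hil d => u 0) h0
    simp at this
  obtain ⟨z, hz⟩ := spectrum.nonempty H
  have hK : 0 ≤ K - 1 := by
    obtain ⟨E, ⟨h1, h2⟩, -⟩ := hs hz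
    linarith
  have h1 := hH.spectralRadius_eq_nnnorm
  have h2 : spectralRadius ℂ H ≤ ENNReal.ofReal (K - 1) := by
    rw [spectralRadius]
    refine iSup₂_le fun w hw => ?_
    obtain ⟨E, ⟨h1, h2⟩, rfl⟩ := hs hw
    rw [← enorm_eq_nnnorm, ← ofReal_norm]
    apply ENNReal.ofReal_le_ofReal
    rw [Complex.norm_real, Real.norm_eq_abs, abs_le]
    constructor <;> linarith
  rw [h1, ← enorm_eq_nnnorm, ← ofReal_norm] at h2
  exact (ENNReal.ofReal_le_ofReal_iff hK).1 h2

/-- ⟨w, Hw⟩ is real, so only -z contributes to the imaginary part of ⟨w, (H - z)w⟩; Cauchy–Schwarz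
finishes. This is the resolvent bound 1/Im z, in a form that needs no inverse. -/
theorem im_mul_norm_le {d : ℕ} {H : Hil d →L[ℂ] Hil d} (hH : IsSelfAdjoint H) (z : ℂ)
    (w : Hil d) : z.im * ‖w‖ ≤ ‖H w - z • w‖ := by
  have h1 : (inner ℂ w (H w)).im = 0 := by
    exact (hH.isSymmetric).im_inner_self_apply w
  have h2 : (inner ℂ w (H w - z • w)).im = -(z.im * ‖w‖ ^ 2) := by
    rw [inner_sub_right, inner_smul_right, Complex.sub_im, h1, inner_self_eq_norm_sq_to_K]
    simp [Complex.mul_im, ← Complex.ofReal_pow]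
  have h3 : z.im * ‖w‖ ^ 2 ≤ ‖w‖ * ‖H w - z • w‖ := by
    calc z.im * ‖w‖ ^ 2 ≤ |(inner ℂ w (H w - z • w)).im| := by
          rw [h2, abs_neg]; exact le_abs_self _
      _ ≤ ‖inner ℂ w (H w - z • w)‖ := Complex.abs_im_le_norm _
      _ ≤ _ := norm_inner_le_norm _ _
  rcases (norm_nonneg w).eq_or_lt with h0 | h0
  · rw [← h0]; simp
  · have : ‖w‖ * (z.im * ‖w‖) ≤ ‖w‖ * ‖H w - z • w‖ := by
      calc _ = z.im * ‖w‖ ^ 2 := by ring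
        _ ≤ _ := h3
    exact le_of_mul_le_mul_left this h0

theorem norm_exp_smul_apply_le {d : ℕ} {H : Hil d →L[ℂ] Hil d} (hH : IsSelfAdjoint H) (t : ℝ)
    (φ : Hil d) : ‖(NormedSpace.exp ((-(Complex.I * (t : ℂ))) • H)) φ‖ ≤ ‖φ‖ := by
  let +nondep : NormedAlgebra ℚ (Hil d →L[ℂ] Hil d) := .restrictScalars ℚ ℂ _
  have hsk : (-(Complex.I * (t : ℂ))) • H ∈ skewAdjoint (Hil d →L[ℂ] Hil d) := by
    rw [skewAdjoint.mem_iff, star_smul, hH.star_eq, ← neg_smul]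
    congr 1
    simp
  have hu := NormedSpace.exp_mem_unitary_of_mem_skewAdjoint hsk
  have h1 : ‖NormedSpace.exp ((-(Complex.I * (t : ℂ))) • H)‖ ≤ 1 := by
    rcases subsingleton_or_nontrivial (Hil d →L[ℂ] Hil d) with h | h
    · rw [Subsingleton.elim (NormedSpace.exp ((-(Complex.I * (t : ℂ))) • H)) 0, norm_zero]
      exact zero_le_one
    · exact (CStarRing.norm_of_mem_unitary hu).le
  calc _ ≤ ‖NormedSpace.exp ((-(Complex.I * (t : ℂ))) • H)‖ * ‖φ‖ :=
        ContinuousLinearMap.le_opNorm _ _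
    _ ≤ 1 * ‖φ‖ := by gcongr
    _ = _ := one_mul _

/-! ### Exponential weights: ballistic bound and decay of the resolvent off the spectrum. -/

theorem exists_weight (d : ℕ) {a : ℝ} (ha : 0 ≤ a) :
    ∃ D : Hil d →L[ℂ] Hil d, ∀ u n, (D u) n = (Real.exp (-a * ‖n‖) : ℂ) * u n := by
  obtain ⟨D, -, hD⟩ := exists_mul_complex (d := d) (fun n => (Real.exp (-a * ‖n‖) : ℂ)) 1 (by
    intro n
    rw [Complex.norm_real, Real.norm_eq_abs, abs_of_pos (Real.exp_pos _)]
    apply Real.exp_le_one_iff.2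
    nlinarith [norm_nonneg n])
  exact ⟨D, hD⟩

/-- Exponential weights `exp(-a‖n‖)` with small rate `a` intertwine `H` with a small
perturbation of `H`, uniformly over all kernels with given decay. -/
theorem exists_conjugation (d : ℕ) {C₁ c₁ : ℝ} (hC₁ : 0 < C₁) (hc₁ : 0 < c₁) :
    ∃ a : ℝ, 0 < a ∧ ∀ (A : (Fin d → ℤ) → (Fin d → ℤ) → ℂ) (V : (Fin d → ℤ) → ℝ)
      (H D : Hil d →L[ℂ] Hil d), IsKernel A C₁ c₁ → ActsBy A V H →
      (∀ u n, (D u) n = (Real.exp (-a * ‖n‖) : ℂ) * u n) →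
      ∃ H' : Hil d →L[ℂ] Hil d, ‖H'‖ ≤ ‖H‖ + 1 / 4 ∧ SemiconjBy D H' H := by
  set S := ∑' k : Fin d → ℤ, Real.exp (-(c₁ / 2) * ‖k‖) with hS
  have hS0 : 0 ≤ S := tsum_nonneg fun _ => (Real.exp_pos _).le
  -- The first entry keeps half of the decay rate of A: a quarter pays for exp(a‖k‖), another for
  -- the factor ‖k‖. The second makes the Schur bound of the perturbation at most 1/4.
  set a := min (c₁ / 4) (1 / (4 * (C₁ * (4 / c₁) * (S + 1)))) with ha
  have hq : 0 < C₁ * (4 / c₁) * (S + 1) := by positivity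
  have ha0 : 0 < a := lt_min (by positivity) (by positivity)
  have ha1 : a ≤ c₁ / 4 := min_le_left _ _
  have ha2 : a * (C₁ * (4 / c₁) * (S + 1)) ≤ 1 / 4 := by
    have : a ≤ 1 / (4 * (C₁ * (4 / c₁) * (S + 1))) := min_le_right _ _
    calc _ ≤ 1 / (4 * (C₁ * (4 / c₁) * (S + 1))) * (C₁ * (4 / c₁) * (S + 1)) := by gcongr
      _ = 1 / 4 := by field_simp
  refine ⟨a, ha0, fun A V H D hA hH hD => ?_⟩
  -- B is the kernel of D⁻¹HD - H. It is bounded although D⁻¹ is not, which is why the conclusion is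
  -- an intertwining relation.
  set B : (Fin d → ℤ) → (Fin d → ℤ) → ℂ :=
    fun m n => A m n * ((Real.exp (a * (‖m‖ - ‖n‖)) : ℂ) - 1) with hB
  have hexp : ∀ s t : ℝ, |s| ≤ t → |Real.exp s - 1| ≤ t * Real.exp t := by
    intro s t hst
    have h1 := Real.add_one_le_exp (-s)
    have h2 := Real.add_one_le_exp s
    have h3 : Real.exp s * Real.exp (-s) = 1 := by rw [← Real.exp_add]; simp
    have h4 : Real.exp s - 1 ≤ s * Real.exp s := by nlinarith [Real.exp_pos s]
    have h0 : 0 ≤ t := (abs_nonneg s).trans hst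
    have h5 : 1 ≤ Real.exp t := Real.one_le_exp h0
    obtain ⟨h6, h7⟩ := abs_le.1 hst
    have h8 : Real.exp s ≤ Real.exp t := Real.exp_le_exp.2 h7
    rw [abs_le]
    constructor
    · nlinarith
    · rcases le_total 0 s with hs | hs
      · calc _ ≤ s * Real.exp s := h4
          _ ≤ _ := by gcongr
      · have : Real.exp s ≤ 1 := Real.exp_le_one_iff.2 hs
        nlinarith [Real.exp_pos t]
  have hBb : ∀ m k, ‖B m (m + k)‖ ≤ a * (C₁ * (4 / c₁)) * Real.exp (-(c₁ / 2) * ‖k‖) := by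
    intro m k
    have h1 : ‖A m (m + k)‖ ≤ C₁ * Real.exp (-c₁ * ‖k‖) := by
      have := hA.decay m (m + k)
      rwa [sub_add_cancel_left, norm_neg] at this
    have h2 : |a * (‖m‖ - ‖m + k‖)| ≤ a * ‖k‖ := by
      rw [abs_mul, abs_of_pos ha0]
      gcongr
      have := abs_norm_sub_norm_le m (m + k)
      rwa [sub_add_cancel_left, norm_neg] at this
    have h3 := hexp _ _ h2
    have h4 : ‖((Real.exp (a * (‖m‖ - ‖m + k‖)) : ℂ) - 1)‖ ≤ a * ‖k‖ * Real.exp (a * ‖k‖) := by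
      rw [← Complex.ofReal_one, ← Complex.ofReal_sub, Complex.norm_real]
      exact h3
    have h5 : ‖k‖ ≤ (4 / c₁) * Real.exp (c₁ / 4 * ‖k‖) := by
      have := Real.add_one_le_exp (c₁ / 4 * ‖k‖)
      calc ‖k‖ = 4 / c₁ * (c₁ / 4 * ‖k‖) := by field_simp
        _ ≤ _ := by gcongr; linarith
    have h6 : Real.exp (a * ‖k‖) ≤ Real.exp (c₁ / 4 * ‖k‖) := by
      gcongr
    calc ‖B m (m + k)‖ = ‖A m (m + k)‖ * ‖((Real.exp (a * (‖m‖ - ‖m + k‖)) : ℂ) - 1)‖ :=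
          norm_mul _ _
      _ ≤ (C₁ * Real.exp (-c₁ * ‖k‖)) *
          (a * ((4 / c₁) * Real.exp (c₁ / 4 * ‖k‖)) * Real.exp (c₁ / 4 * ‖k‖)) := by
          refine mul_le_mul h1 (h4.trans ?_) (norm_nonneg _) (by positivity)
          gcongr
      _ = a * (C₁ * (4 / c₁)) *
          (Real.exp (-c₁ * ‖k‖) * Real.exp (c₁ / 4 * ‖k‖) * Real.exp (c₁ / 4 * ‖k‖)) := by ring
      _ = _ := by
          rw [← Real.exp_add, ← Real.exp_add]
          congr 2
          ring
  obtain ⟨P, hP1, hP⟩ := exists_schur B _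
    ((summable_exp_norm (d := d) (half_pos hc₁)).mul_left (a * (C₁ * (4 / c₁)))) hBb
  rw [tsum_mul_left] at hP1
  refine ⟨H + P, (norm_add_le _ _).trans ?_, ?_⟩
  · have : a * (C₁ * (4 / c₁)) * S ≤ a * (C₁ * (4 / c₁) * (S + 1)) := by
      have : 0 ≤ a * (C₁ * (4 / c₁)) := by positivity
      nlinarith
    linarith
  · ext u m
    change (D ((H + P) u)) m = (H (D u)) m
    rw [hD]
    have h1 := (hH.hasSum u m).add (hP u m)
    have h2 := h1.mul_left (Real.exp (-a * ‖m‖) : ℂ)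
    have h3 := hH.hasSum (D u) m
    have h4 : (fun n => A m n * (D u) n)
        = fun n => (Real.exp (-a * ‖m‖) : ℂ) * (A m n * u n + B m n * u n) := by
      funext n
      rw [hD, hB]
      have : (Real.exp (-a * ‖n‖) : ℂ)
          = (Real.exp (-a * ‖m‖) : ℂ) * (Real.exp (a * (‖m‖ - ‖n‖)) : ℂ) := by
        rw [← Complex.ofReal_mul, ← Real.exp_add]
        congr 2
        ring
      rw [this]
      ring
    rw [h4, hD] at h3
    have h5 := h2.unique h3
    have h6 : ((H + P) u) m = (H u) m + (P u) m := rfl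
    rw [h6]
    linear_combination h5

/-- Intertwining passes to the exponential, so the weight moves through the evolution without being
inverted. -/
theorem exp_apply_weight {d : ℕ} {H H' D : Hil d →L[ℂ] Hil d} (h : SemiconjBy D H' H) (c : ℂ)
    (u : Hil d) : NormedSpace.exp (c • H) (D u) = D (NormedSpace.exp (c • H') u) := by
  let +nondep : NormedAlgebra ℚ (Hil d →L[ℂ] Hil d) := .restrictScalars ℚ ℂ _
  have h1 : SemiconjBy D (c • H') (c • H) := by
    have : D * (c • H') = (c • H) * D := by
      rw [mul_smul_comm, smul_mul_assoc, h.eq]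
    exact this
  have h2 := h1.exp_right.eq
  exact (congrArg (fun X : Hil d →L[ℂ] Hil d => X u) h2).symm

theorem norm_exp_le_exp_norm {d : ℕ} (X : Hil d →L[ℂ] Hil d) :
    ‖NormedSpace.exp X‖ ≤ Real.exp ‖X‖ := by
  have h1 := NormedSpace.exp_series_hasSum_exp' (𝕂 := ℂ) X
  have h2 : HasSum (fun n : ℕ => (n.factorial : ℝ)⁻¹ * ‖X‖ ^ n) (Real.exp ‖X‖) := by
    have := NormedSpace.exp_series_hasSum_exp' (𝕂 := ℝ) ‖X‖
    rw [Real.exp_eq_exp_ℝ]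
    simpa using this
  refine h1.norm_le_of_bounded h2 fun n => ?_
  rw [norm_smul]
  simp only [norm_inv, Complex.norm_natCast]
  gcongr
  rcases n with _ | n
  · have : ‖(1 : Hil d →L[ℂ] Hil d)‖ ≤ 1 := ContinuousLinearMap.norm_id_le
    simpa using this
  · exact norm_pow_le' X n.succ_pos

/-- A finitely supported vector is in the range of the weight operator. -/
theorem exists_weight_preimage {d : ℕ} {φ : Hil d} (hφ : {n : Fin d → ℤ | φ n ≠ 0}.Finite)
    (a : ℝ) : ∃ φ' : Hil d, ∀ n, φ n = (Real.exp (-a * ‖n‖) : ℂ) * φ' n := by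
  refine ⟨⟨fun n => (Real.exp (a * ‖n‖) : ℂ) * φ n, memℓp_gen ?_⟩, fun n => ?_⟩
  · refine summable_of_hasFiniteSupport (hφ.subset fun n hn h0 => hn ?_)
    simp [h0]
  · change _ = (Real.exp (-a * ‖n‖) : ℂ) * ((Real.exp (a * ‖n‖) : ℂ) * φ n)
    rw [← mul_assoc, ← Complex.ofReal_mul, ← Real.exp_add]
    simp

/-- Ballistic upper bound for the evolution and exponential decay of the resolvent away from the
spectrum, with constants that are uniform over all kernels with given decay. -/
theorem exists_decay_constants (d : ℕ) {C₁ c₁ : ℝ} (hC₁ : 0 < C₁) (hc₁ : 0 < c₁) (K : ℝ)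
    {φ : Hil d} (hφ : {n : Fin d → ℤ | φ n ≠ 0}.Finite) :
    ∃ a C : ℝ, 0 < a ∧ 0 ≤ C ∧
      ∀ (A : (Fin d → ℤ) → (Fin d → ℤ) → ℂ) (V : (Fin d → ℤ) → ℝ) (H : Hil d →L[ℂ] Hil d),
        IsKernel A C₁ c₁ → ActsBy A V H → ‖H‖ ≤ K - 1 →
        (∀ t : ℝ, 0 ≤ t → ∀ n, ‖(NormedSpace.exp ((-(Complex.I * (t : ℂ))) • H) φ) n‖
          ≤ C * Real.exp (K * t) * Real.exp (-a * ‖n‖)) ∧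
        (∀ z : ℂ, K ≤ |z.re| → ∀ w : Hil d, H w - z • w = -Complex.I • φ → ∀ n, φ n = 0 →
          ‖w n‖ ≤ C * Real.exp (-a * ‖n‖) / z.re ^ 2) := by
  obtain ⟨a, ha, h⟩ := exists_conjugation d hC₁ hc₁
  obtain ⟨φ', hφ'⟩ := exists_weight_preimage hφ a
  obtain ⟨D, hD⟩ := exists_weight d ha.le
  have hDφ : D φ' = φ := by
    ext n
    rw [hD, hφ']
  have hDn : ∀ u n, ‖(D u) n‖ ≤ ‖u‖ * Real.exp (-a * ‖n‖) := by
    intro u n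
    rw [hD, norm_mul, Complex.norm_real, Real.norm_eq_abs, abs_of_pos (Real.exp_pos _), mul_comm]
    gcongr
    exact norm_coord_le u n
  refine ⟨a, (2 * K ^ 2 + 1) * ‖φ'‖, ha, by positivity, fun A V H hA hH hHK => ?_⟩
  have hK : 1 ≤ K := by linarith [norm_nonneg H]
  obtain ⟨H', hH', hs⟩ := h A V H D hA hH hD
  -- The gap 3/4 puts every z with |Re z| ≥ K in the resolvent set of the conjugated operator, with
  -- a uniform bound.
  have hH'K : ‖H'‖ ≤ K - 3 / 4 := by linarith
  constructor
  · intro t ht n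
    rw [← hDφ, exp_apply_weight hs]
    refine (hDn _ n).trans ?_
    gcongr
    calc ‖NormedSpace.exp ((-(Complex.I * (t : ℂ))) • H') φ'‖
        ≤ ‖NormedSpace.exp ((-(Complex.I * (t : ℂ))) • H')‖ * ‖φ'‖ :=
          ContinuousLinearMap.le_opNorm _ _
      _ ≤ Real.exp (K * t) * ‖φ'‖ := by
          gcongr
          refine (norm_exp_le_exp_norm _).trans (Real.exp_le_exp.2 ?_)
          rw [norm_smul]
          simp only [norm_neg, norm_mul, Complex.norm_I, one_mul, Complex.norm_real,
            Real.norm_eq_abs, abs_of_nonneg ht]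
          rw [mul_comm]
          gcongr
          linarith
      _ ≤ (2 * K ^ 2 + 1) * ‖φ'‖ * Real.exp (K * t) := by
          have : 0 ≤ K ^ 2 * (Real.exp (K * t) * ‖φ'‖) := by positivity
          nlinarith
  · intro z hz w hw n hn
    have hzE : |z.re| ≤ ‖z‖ := Complex.abs_re_le_norm z
    have hz0 : 0 < |z.re| := by linarith
    have hu : IsUnit (algebraMap ℂ (Hil d →L[ℂ] Hil d) z - H') := by
      have : z ∈ resolventSet ℂ H' := by
        apply spectrum.mem_resolventSet_of_norm_lt_mul
        have h1 : ‖(1 : Hil d →L[ℂ] Hil d)‖ ≤ 1 := ContinuousLinearMap.norm_id_le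
        calc ‖H'‖ * ‖(1 : Hil d →L[ℂ] Hil d)‖ ≤ ‖H'‖ * 1 := by gcongr
          _ < ‖z‖ := by linarith
      exact this
    obtain ⟨U, hU⟩ := hu
    set w' : Hil d := (U⁻¹ : (Hil d →L[ℂ] Hil d)ˣ).val (Complex.I • φ') with hw'
    have hw'eq : H' w' - z • w' = -Complex.I • φ' := by
      have h1 : (U.val * (U⁻¹ : (Hil d →L[ℂ] Hil d)ˣ).val) (Complex.I • φ') = Complex.I • φ' := by
        rw [U.mul_inv]; rfl
      have h2 : (U.val * (U⁻¹ : (Hil d →L[ℂ] Hil d)ˣ).val) (Complex.I • φ') = z • w' - H' w' := by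
        rw [hU]; rfl
      rw [neg_smul, ← h1, h2, neg_sub]
    have hDH : ∀ u, H (D u) = D (H' u) := fun u =>
      (congrArg (fun X : Hil d →L[ℂ] Hil d => X u) hs.eq).symm
    have hDw : H (D w') - z • D w' = -Complex.I • φ := by
      rw [hDH, ← map_smul, ← map_sub, hw'eq, map_smul, hDφ]
    -- The weighted vector solves the same equation as w, and the solution is unique because |z| >
    -- ‖H‖.
    have heq : w = D w' := by
      have h1 : H (w - D w') = z • (w - D w') := by
        have : (H w - z • w) - (H (D w') - z • D w') = 0 := by rw [hw, hDw, sub_self]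
        rw [map_sub, smul_sub, ← sub_eq_zero, ← this]
        abel
      have h2 : ‖z‖ * ‖w - D w'‖ ≤ (K - 1) * ‖w - D w'‖ := by
        rw [← norm_smul, ← h1]
        exact (H.le_opNorm _).trans (by gcongr)
      have h3 : ‖w - D w'‖ = 0 := by
        have := norm_nonneg (w - D w')
        nlinarith
      exact sub_eq_zero.1 (norm_eq_zero.1 h3)
    have hnorm : ‖z‖ * ‖w'‖ ≤ 2 * K * ‖φ'‖ := by
      have h1 : ‖z • w'‖ ≤ ‖H' w'‖ + ‖φ'‖ := by
        have : z • w' = H' w' - (-Complex.I • φ') := by rw [← hw'eq]; abel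
        rw [this]
        refine (norm_sub_le _ _).trans ?_
        rw [norm_smul, norm_neg, Complex.norm_I, one_mul]
      rw [norm_smul] at h1
      have h2 : ‖H' w'‖ ≤ (K - 3 / 4) * ‖w'‖ := (H'.le_opNorm _).trans (by gcongr)
      have h3 : (‖z‖ - (K - 3 / 4)) * ‖w'‖ ≤ ‖φ'‖ := by linarith
      have h4 : ‖z‖ ≤ 2 * K * (‖z‖ - (K - 3 / 4)) := by nlinarith
      calc ‖z‖ * ‖w'‖ ≤ 2 * K * (‖z‖ - (K - 3 / 4)) * ‖w'‖ := by gcongr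
        _ = 2 * K * ((‖z‖ - (K - 3 / 4)) * ‖w'‖) := by ring
        _ ≤ 2 * K * ‖φ'‖ := by gcongr
    -- Off the support of φ the equation reads z wₙ = (Hw)ₙ. This gains a second factor 1/|z|,
    -- without which the bound would not be integrable in the energy.
    have hzw : z * w n = (D (H' w')) n := by
      have h1 : (H w - z • w) n = (-Complex.I • φ) n := by rw [hw]
      change (H w) n - z * w n = -Complex.I * φ n at h1
      rw [hn, mul_zero, sub_eq_zero] at h1
      rw [← h1, heq, hDH]
    have hz2 : 0 < z.re ^ 2 := by rw [← sq_abs]; positivity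
    rw [le_div_iff₀ hz2, ← sq_abs]
    calc ‖w n‖ * |z.re| ^ 2 ≤ ‖w n‖ * ‖z‖ ^ 2 := by gcongr
      _ = ‖z‖ * ‖z * w n‖ := by rw [norm_mul]; ring
      _ ≤ ‖z‖ * ((K * ‖w'‖) * Real.exp (-a * ‖n‖)) := by
          rw [hzw]
          have : ‖H' w'‖ ≤ K * ‖w'‖ := (H'.le_opNorm _).trans (by gcongr; linarith)
          have := hDn (H' w') n
          gcongr
          refine this.trans ?_
          gcongr
      _ = K * (‖z‖ * ‖w'‖) * Real.exp (-a * ‖n‖) := by ring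
      _ ≤ K * (2 * K * ‖φ'‖) * Real.exp (-a * ‖n‖) := by gcongr
      _ = 2 * K ^ 2 * ‖φ'‖ * Real.exp (-a * ‖n‖) := by ring
      _ ≤ (2 * K ^ 2 + 1) * ‖φ'‖ * Real.exp (-a * ‖n‖) := by
          gcongr
          linarith

/-! ### From the resolvent to the evolution. -/

open MeasureTheory Filter Topology FourierTransform in
/-- The evolution is controlled by the resolvent on a line above the real axis, through Laplace
transform and Fourier inversion. -/
theorem norm_evolution_le {d : ℕ} {H : Hil d →L[ℂ] Hil d} (hH : IsSelfAdjoint H) (φ : Hil d)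
    {t T : ℝ} (ht : 0 < t) (hT : 0 < T) (n : Fin d → ℤ) (g : ℝ → ℝ) (hg : Integrable g)
    (h : ∀ (ξ : ℝ) (w : Hil d),
      H w - (((-(2 * Real.pi * ξ) : ℝ) : ℂ) + ((1 / T : ℝ) : ℂ) * Complex.I) • w
        = -Complex.I • φ → ‖w n‖ ≤ g ξ) :
    ‖(NormedSpace.exp ((-(Complex.I * (t : ℂ))) • H) φ) n‖ ≤ Real.exp (t / T) * ∫ ξ, g ξ := by
  set ψ : ℝ → Hil d := fun s => NormedSpace.exp ((-(Complex.I * (s : ℂ))) • H) φ with hψ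
  have hψd : ∀ s, HasDerivAt ψ (-Complex.I • H (ψ s)) s := by
    intro s
    have h0 := (hasDerivAt_exp_smul_const' (𝕂 := ℂ) (-Complex.I • H) (s : ℂ)).scomp s
      Complex.ofRealCLM.hasDerivAt
    have h1 : HasDerivAt (fun r : ℝ => NormedSpace.exp ((r : ℂ) • (-Complex.I • H)))
        ((-Complex.I • H) * NormedSpace.exp ((s : ℂ) • (-Complex.I • H))) s := by
      have h01 : Complex.ofRealCLM 1 = 1 := Complex.ofReal_one
      rw [h01, one_smul] at h0
      exact h0
    let ap : (Hil d →L[ℂ] Hil d) →L[ℝ] Hil d :=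
      (ContinuousLinearMap.apply ℂ (Hil d) φ).restrictScalars ℝ
    have h2 := ap.hasFDerivAt.comp_hasDerivAt s h1
    change HasDerivAt (fun r : ℝ => NormedSpace.exp ((r : ℂ) • (-Complex.I • H)) φ)
        (-Complex.I • H (NormedSpace.exp ((s : ℂ) • (-Complex.I • H)) φ)) s at h2
    have h3 : ∀ r : ℝ, (r : ℂ) • (-Complex.I • H) = (-(Complex.I * (r : ℂ))) • H := by
      intro r
      rw [smul_smul]
      congr 1
      ring
    simp only [h3] at h2
    exact h2
  have hψ0 : ψ 0 = φ := by simp [hψ]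
  have hψn : ∀ s, ‖ψ s‖ ≤ ‖φ‖ := fun s => norm_exp_smul_apply_le hH s φ
  have hψc : Continuous ψ := continuous_iff_continuousAt.2 fun s => (hψd s).continuousAt
  -- Integrand of the Laplace transform at 1/T + 2πiξ. Its s-derivative is -i(H - z)y with z = -2πξ
  -- + i/T, so its integral over s > 0 solves the resolvent equation.
  set y : ℝ → ℝ → Hil d := fun ξ s =>
    Complex.exp (-((1 / T : ℝ) + 2 * Real.pi * ξ * Complex.I) * s) • ψ s with hy
  have hyn : ∀ ξ s, ‖y ξ s‖ ≤ Real.exp (-(1 / T) * s) * ‖φ‖ := by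
    intro ξ s
    rw [hy]
    simp only
    rw [norm_smul, Complex.norm_exp]
    have : (-(((1 / T : ℝ) : ℂ) + 2 * Real.pi * ξ * Complex.I) * s).re = -(1 / T) * s := by
      simp
    rw [this]
    gcongr
    exact hψn s
  have hyc : ∀ ξ, Continuous (y ξ) := by
    intro ξ
    rw [hy]
    fun_prop
  have hint : IntegrableOn (fun s => Real.exp (-(1 / T) * s) * ‖φ‖) (Set.Ioi 0) :=
    (exp_neg_integrableOn_Ioi 0 (one_div_pos.2 hT)).mul_const _
  have hyi : ∀ ξ, IntegrableOn (y ξ) (Set.Ioi 0) := fun ξ =>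
    Integrable.mono' hint (hyc ξ).aestronglyMeasurable (ae_of_all _ (hyn ξ))
  set z : ℝ → ℂ := fun ξ => ((-(2 * Real.pi * ξ) : ℝ) : ℂ) + ((1 / T : ℝ) : ℂ) * Complex.I with hz
  have hyd : ∀ ξ s, HasDerivAt (y ξ) (-Complex.I • (H (y ξ s) - z ξ • y ξ s)) s := by
    intro ξ s
    have h1 : HasDerivAt (fun r : ℝ =>
        Complex.exp (-((1 / T : ℝ) + 2 * Real.pi * ξ * Complex.I) * r))
        (Complex.exp (-((1 / T : ℝ) + 2 * Real.pi * ξ * Complex.I) * s) *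
          (-((1 / T : ℝ) + 2 * Real.pi * ξ * Complex.I) * 1)) s := by
      have := ((hasDerivAt_id (s : ℂ)).const_mul
        (-(((1 / T : ℝ) : ℂ) + 2 * Real.pi * ξ * Complex.I))).cexp.comp_ofReal
      exact this
    have h2 := h1.smul (hψd s)
    refine h2.congr_deriv ?_
    simp only [hy]
    rw [map_smul, smul_sub, smul_smul, smul_smul, smul_smul, smul_smul, sub_eq_add_neg,
      ← neg_smul, mul_comm (-Complex.I) (Complex.exp _)]
    congr 2
    rw [hz]
    push_cast
    linear_combination (-(Complex.exp (-(1 / T + 2 * Real.pi * ξ * Complex.I) * s) * (1 / T)))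
      * Complex.I_sq
  have hw : ∀ ξ, H (∫ s in Set.Ioi 0, y ξ s) - z ξ • (∫ s in Set.Ioi 0, y ξ s)
      = -Complex.I • φ := by
    intro ξ
    have h0 : Tendsto (y ξ) atTop (𝓝 0) := by
      apply squeeze_zero_norm (hyn ξ)
      have : Tendsto (fun s : ℝ => Real.exp (-(1 / T) * s)) atTop (𝓝 0) := by
        apply Real.tendsto_exp_atBot.comp
        exact tendsto_id.const_mul_atTop_of_neg (by simpa using hT)
      simpa using this.mul_const ‖φ‖
    let X : Hil d →L[ℂ] Hil d := -Complex.I • (H - z ξ • ContinuousLinearMap.id ℂ (Hil d))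
    have h1 := integral_Ioi_of_hasDerivAt_of_tendsto' (a := 0) (fun s _ => hyd ξ s)
      (X.integrable_comp (hyi ξ)) h0
    have h2 : ∫ s in Set.Ioi 0, X (y ξ s) = X (∫ s in Set.Ioi 0, y ξ s) :=
      X.integral_comp_comm (hyi ξ)
    have h3 : X (∫ s in Set.Ioi 0, y ξ s) = -φ := by
      rw [← h2]
      refine h1.trans ?_
      simp [hy, hψ0]
    have h4 : H (∫ s in Set.Ioi 0, y ξ s) - z ξ • (∫ s in Set.Ioi 0, y ξ s)
        = Complex.I • X (∫ s in Set.Ioi 0, y ξ s) := by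
      change _ = Complex.I • -Complex.I • (H (∫ s in Set.Ioi 0, y ξ s) - z ξ • _)
      rw [smul_smul]
      simp
    rw [h4, h3, smul_neg, neg_smul]
  let ev : Hil d →L[ℂ] ℂ := lp.evalCLM ℂ (fun _ : Fin d → ℤ => ℂ) 2 n
  -- The damped evolution at site n, cut to positive times: its Fourier transform at ξ is the n-th
  -- coordinate of the resolvent solution.
  set f : ℝ → ℂ := (Set.Ioi (0 : ℝ)).indicator (fun s => ev (y 0 s)) with hf
  have hfi : Integrable f :=
    (integrable_indicator_iff measurableSet_Ioi).2 (ev.integrable_comp (hyi 0))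
  have hFf : ∀ ξ, 𝓕 f ξ = (∫ s in Set.Ioi 0, y ξ s) n := by
    intro ξ
    have h1 : (∫ s in Set.Ioi 0, y ξ s) n = ∫ s in Set.Ioi 0, ev (y ξ s) :=
      (ev.integral_comp_comm (hyi ξ)).symm
    rw [h1, Real.fourier_real_eq_integral_exp_smul, ← integral_indicator measurableSet_Ioi]
    congr 1
    funext s
    by_cases hs : s ∈ Set.Ioi (0 : ℝ)
    · rw [hf, Set.indicator_of_mem hs, Set.indicator_of_mem hs, ← map_smul]
      congr 1
      simp only [hy]
      rw [smul_smul, ← Complex.exp_add]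
      congr 2
      push_cast
      ring
    · rw [hf, Set.indicator_of_notMem hs, Set.indicator_of_notMem hs, smul_zero]
  have hb : ∀ ξ, ‖𝓕 f ξ‖ ≤ g ξ := fun ξ => by
    rw [hFf]
    exact h ξ _ (hw ξ)
  have hFc : Continuous (𝓕 f) :=
    VectorFourier.fourierIntegral_continuous Real.continuous_fourierChar
      (by exact continuous_inner) hfi
  have hFi : Integrable (𝓕 f) :=
    Integrable.mono' hg hFc.aestronglyMeasurable (ae_of_all _ hb)
  -- Pointwise inversion needs continuity at t. The cut creates a possible jump at 0 only, so t > 0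
  -- suffices.
  have hft : ContinuousAt f t := by
    have h1 : ContinuousAt (fun s => ev (y 0 s)) t := (ev.continuous.comp (hyc 0)).continuousAt
    refine h1.congr ?_
    filter_upwards [Ioi_mem_nhds ht] with s hs
    rw [hf, Set.indicator_of_mem hs]
  have hinv := hfi.fourierInv_fourier_eq hFi hft
  have h1 : ‖f t‖ ≤ ∫ ξ, g ξ := by
    rw [← hinv, Real.fourierInv_eq]
    refine (norm_integral_le_integral_norm _).trans ?_
    simp_rw [Circle.norm_smul]
    exact integral_mono hFi.norm hg hb
  have h2 : f t = Complex.exp (-((1 / T : ℝ) + 2 * Real.pi * (0 : ℝ) * Complex.I) * t) * ψ t n := by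
    rw [hf, Set.indicator_of_mem (by exact ht)]
    rfl
  have h3 : ‖f t‖ = Real.exp (-(t / T)) * ‖ψ t n‖ := by
    rw [h2, norm_mul, Complex.norm_exp]
    congr 2
    simp
    ring
  have h4 : ‖ψ t n‖ = Real.exp (t / T) * ‖f t‖ := by
    rw [h3, ← mul_assoc, ← Real.exp_add]
    simp
  change ‖ψ t n‖ ≤ _
  rw [h4]
  gcongr

/-! ### Polynomial functions and semi-algebraic approximation of the bad phases. -/

/-- `g` is a real polynomial function of degree at most `D`. -/
def IsPoly {b : ℕ} (D : ℕ) (g : (Fin b → ℝ) → ℝ) : Prop :=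
  ∃ P : MvPolynomial (Fin b) ℝ, P.totalDegree ≤ D ∧ ∀ y, g y = MvPolynomial.eval y P

theorem IsPoly.mono {b D E : ℕ} {g : (Fin b → ℝ) → ℝ} (h : IsPoly D g) (hDE : D ≤ E) :
    IsPoly E g := by
  obtain ⟨P, h1, h2⟩ := h
  exact ⟨P, h1.trans hDE, h2⟩

theorem isPoly_const {b D : ℕ} (r : ℝ) : IsPoly D (fun _ : Fin b → ℝ => r) :=
  ⟨MvPolynomial.C r, by simp, by simp⟩

theorem isPoly_coord {b : ℕ} (i : Fin b) : IsPoly 1 (fun y : Fin b → ℝ => y i) :=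
  ⟨MvPolynomial.X i, by simp, by simp⟩

theorem IsPoly.add {b D : ℕ} {g h : (Fin b → ℝ) → ℝ} (hg : IsPoly D g) (hh : IsPoly D h) :
    IsPoly D (fun y => g y + h y) := by
  obtain ⟨P, h1, h2⟩ := hg
  obtain ⟨Q, h3, h4⟩ := hh
  exact ⟨P + Q, (MvPolynomial.totalDegree_add _ _).trans (max_le h1 h3), fun y => by
    simp [h2, h4]⟩

theorem IsPoly.mul {b D E : ℕ} {g h : (Fin b → ℝ) → ℝ} (hg : IsPoly D g) (hh : IsPoly E h) :
    IsPoly (D + E) (fun y => g y * h y) := by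
  obtain ⟨P, h1, h2⟩ := hg
  obtain ⟨Q, h3, h4⟩ := hh
  exact ⟨P * Q, (MvPolynomial.totalDegree_mul _ _).trans (by lia), fun y => by simp [h2, h4]⟩

theorem IsPoly.const_mul {b D : ℕ} {g : (Fin b → ℝ) → ℝ} (hg : IsPoly D g) (r : ℝ) :
    IsPoly D (fun y => r * g y) := by
  simpa using (isPoly_const (D := 0) r).mul hg

theorem IsPoly.sub {b D : ℕ} {g h : (Fin b → ℝ) → ℝ} (hg : IsPoly D g) (hh : IsPoly D h) :
    IsPoly D (fun y => g y - h y) := by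
  have := hg.add (hh.const_mul (-1))
  convert this using 2
  ring

theorem isPoly_sum {b D : ℕ} {ι : Type*} (s : Finset ι) (g : ι → (Fin b → ℝ) → ℝ)
    (h : ∀ i ∈ s, IsPoly D (g i)) : IsPoly D (fun y => ∑ i ∈ s, g i y) := by
  classical
  induction s using Finset.induction_on with
  | empty => simpa using isPoly_const (D := D) (b := b) 0
  | insert i s hi ih =>
    simp only [Finset.sum_insert hi]
    exact (h i (Finset.mem_insert_self _ _)).add
      (ih fun j hj => h j (Finset.mem_insert_of_mem hj))

theorem isPoly_prod {b D : ℕ} {ι : Type*} (s : Finset ι) (g : ι → (Fin b → ℝ) → ℝ)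
    (h : ∀ i ∈ s, IsPoly D (g i)) : IsPoly (s.card * D) (fun y => ∏ i ∈ s, g i y) := by
  classical
  induction s using Finset.induction_on with
  | empty => simpa using isPoly_const (D := 0) (b := b) 1
  | insert i s hi ih =>
    simp only [Finset.prod_insert hi, Finset.card_insert_of_notMem hi]
    refine ((h i (Finset.mem_insert_self _ _)).mul
      (ih fun j hj => h j (Finset.mem_insert_of_mem hj))).mono ?_
    lia

/-- `g` is a complex-valued polynomial function of degree at most `D` of real variables. -/
def IsComplexPoly {b : ℕ} (D : ℕ) (g : (Fin b → ℝ) → ℂ) : Prop :=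
  IsPoly D (fun y => (g y).re) ∧ IsPoly D (fun y => (g y).im)

theorem IsComplexPoly.mono {b D E : ℕ} {g : (Fin b → ℝ) → ℂ} (h : IsComplexPoly D g)
    (hDE : D ≤ E) : IsComplexPoly E g :=
  ⟨h.1.mono hDE, h.2.mono hDE⟩

theorem isComplexPoly_const {b D : ℕ} (r : ℂ) : IsComplexPoly D (fun _ : Fin b → ℝ => r) :=
  ⟨isPoly_const _, isPoly_const _⟩

theorem IsPoly.ofReal {b D : ℕ} {g : (Fin b → ℝ) → ℝ} (hg : IsPoly D g) :
    IsComplexPoly D (fun y => (g y : ℂ)) := by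
  refine ⟨by simpa using hg, by simpa using isPoly_const (D := D) (b := b) 0⟩

theorem IsComplexPoly.add {b D : ℕ} {g h : (Fin b → ℝ) → ℂ} (hg : IsComplexPoly D g)
    (hh : IsComplexPoly D h) : IsComplexPoly D (fun y => g y + h y) := by
  simp only [IsComplexPoly, Complex.add_re, Complex.add_im]
  exact ⟨hg.1.add hh.1, hg.2.add hh.2⟩

theorem IsComplexPoly.mul {b D E : ℕ} {g h : (Fin b → ℝ) → ℂ} (hg : IsComplexPoly D g)
    (hh : IsComplexPoly E h) : IsComplexPoly (D + E) (fun y => g y * h y) := by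
  simp only [IsComplexPoly, Complex.mul_re, Complex.mul_im]
  exact ⟨(hg.1.mul hh.1).sub (hg.2.mul hh.2), (hg.1.mul hh.2).add (hg.2.mul hh.1)⟩

theorem isComplexPoly_sum {b D : ℕ} {ι : Type*} (s : Finset ι) (g : ι → (Fin b → ℝ) → ℂ)
    (h : ∀ i ∈ s, IsComplexPoly D (g i)) : IsComplexPoly D (fun y => ∑ i ∈ s, g i y) := by
  simp only [IsComplexPoly, Complex.re_sum, Complex.im_sum]
  exact ⟨isPoly_sum s _ fun i hi => (h i hi).1, isPoly_sum s _ fun i hi => (h i hi).2⟩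

theorem isComplexPoly_prod {b D : ℕ} {ι : Type*} (s : Finset ι) (g : ι → (Fin b → ℝ) → ℂ)
    (h : ∀ i ∈ s, IsComplexPoly D (g i)) :
    IsComplexPoly (s.card * D) (fun y => ∏ i ∈ s, g i y) := by
  classical
  induction s using Finset.induction_on with
  | empty => simpa using isComplexPoly_const (D := 0) (b := b) 1
  | insert i s hi ih =>
    simp only [Finset.prod_insert hi, Finset.card_insert_of_notMem hi]
    refine ((h i (Finset.mem_insert_self _ _)).mul
      (ih fun j hj => h j (Finset.mem_insert_of_mem hj))).mono ?_
    lia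

theorem IsComplexPoly.norm_sq {b D : ℕ} {g : (Fin b → ℝ) → ℂ} (hg : IsComplexPoly D g) :
    IsPoly (2 * D) (fun y => ‖g y‖ ^ 2) := by
  have h : (fun y => ‖g y‖ ^ 2) = fun y => (g y).re * (g y).re + (g y).im * (g y).im := by
    funext y
    rw [Complex.sq_norm, Complex.normSq_apply]
  rw [h, two_mul]
  exact (hg.1.mul hg.1).add (hg.2.mul hg.2)

theorem isComplexPoly_det {b D : ℕ} {ι : Type*} [Fintype ι] [DecidableEq ι]
    (G : (Fin b → ℝ) → Matrix ι ι ℂ) (h : ∀ m n, IsComplexPoly D (fun y => G y m n)) :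
    IsComplexPoly (Fintype.card ι * D) (fun y => (G y).det) := by
  simp only [Matrix.det_apply', ← Finset.card_univ]
  refine isComplexPoly_sum _ _ fun σ _ => ?_
  simpa using (isComplexPoly_const (D := 0) _).mul
    (isComplexPoly_prod Finset.univ (fun i y => G y (σ i) i) fun i _ => h _ _)

theorem isComplexPoly_adjugate {b D : ℕ} {ι : Type*} [Fintype ι] [DecidableEq ι]
    (G : (Fin b → ℝ) → Matrix ι ι ℂ) (h : ∀ m n, IsComplexPoly D (fun y => G y m n)) (m n : ι) :
    IsComplexPoly (Fintype.card ι * D) (fun y => (G y).adjugate m n) := by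
  simp only [Matrix.adjugate_apply]
  refine isComplexPoly_det _ fun i j => ?_
  by_cases hi : i = n
  · subst hi
    simpa using isComplexPoly_const _
  · simpa [Matrix.updateRow_ne hi] using h i j

/-- Expand y - a in the standard basis: each choice of k basis vectors contributes a product of k
affine coordinates. This is what makes Taylor sums polynomials in the formal sense. -/
theorem isPoly_multilinear {b k : ℕ}
    (f : ContinuousMultilinearMap ℝ (fun _ : Fin k => Fin b → ℝ) ℝ) (a : Fin b → ℝ) :
    IsPoly k (fun y => f fun _ => y - a) := by
  have h : ∀ y, (f fun _ => y - a)
      = ∑ r : Fin k → Fin b, (∏ i, (y (r i) - a (r i))) * f fun i => Pi.single (r i) 1 := by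
    intro y
    have h1 : y - a = ∑ j, (y j - a j) • (Pi.single j 1 : Fin b → ℝ) := by
      conv_lhs => rw [← Finset.univ_sum_single (y - a)]
      refine Finset.sum_congr rfl fun j _ => ?_
      rw [← Pi.single_smul]
      simp
    rw [h1, f.map_sum]
    refine Finset.sum_congr rfl fun r _ => ?_
    rw [f.map_smul_univ, smul_eq_mul]
  simp only [h]
  refine isPoly_sum _ _ fun r _ => ?_
  have h2 : IsPoly k (fun y : Fin b → ℝ => ∏ i : Fin k, (y (r i) - a (r i))) := by
    simpa using isPoly_prod Finset.univ (fun (i : Fin k) (y : Fin b → ℝ) => y (r i) - a (r i))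
      fun i _ => (isPoly_coord (r i)).sub (isPoly_const _)
  simpa using h2.mul (isPoly_const (D := 0) _)

/-- Taylor approximation of a function with factorial bounds on its derivatives. -/
theorem exists_taylor_poly {b : ℕ} {F : (Fin b → ℝ) → ℝ} (hF : AnalyticOnNhd ℝ F Set.univ)
    {M R : ℝ} (hM : 0 ≤ M) (hR : 0 ≤ R)
    (hb : ∀ k y, ‖iteratedFDeriv ℝ k F y‖ ≤ M * (k.factorial : ℝ) * R ^ k)
    (a : Fin b → ℝ) (r : ℝ) (hr : R * r ≤ 1 / 2) (n : ℕ) :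
    ∃ P : (Fin b → ℝ) → ℝ, IsPoly n P ∧
      ∀ y, ‖y - a‖ ≤ r → |F y - P y| ≤ M * (n + 1) * (1 / 2) ^ (n + 1) := by
  refine ⟨fun y => ∑ k ∈ Finset.range (n + 1),
    (k.factorial : ℝ)⁻¹ * (iteratedFDeriv ℝ k F a fun _ => y - a), ?_, fun y hy => ?_⟩
  · refine isPoly_sum _ _ fun k hk => ?_
    refine ((isPoly_multilinear _ a).const_mul _).mono ?_
    have := Finset.mem_range.1 hk
    lia
  · have hc : ContDiff ℝ (n + 1) F := hF.contDiff
    have h := map_add_eq_sum_add_integral_iteratedFDeriv (n := n) (x := a) (y := y - a)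
      (fun t _ => hc.contDiffAt)
    rw [add_sub_cancel] at h
    rw [h]
    simp only [smul_eq_mul, add_sub_cancel_left]
    -- Integral form of the remainder. The factorial bound cancels 1/n! up to a factor n + 1, and R
    -- r ≤ 1/2 supplies the powers of 1/2.
    have h1 : ‖∫ t in (0 : ℝ)..1, (1 - t) ^ n *
        iteratedFDeriv ℝ (n + 1) F (a + t • (y - a)) fun _ => y - a‖
        ≤ (M * ((n + 1).factorial : ℝ) * (1 / 2) ^ (n + 1)) * |1 - 0| := by
      apply intervalIntegral.norm_integral_le_of_norm_le_const
      intro t ht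
      rw [Set.uIoc_of_le zero_le_one] at ht
      have h2 : ‖iteratedFDeriv ℝ (n + 1) F (a + t • (y - a)) fun _ => y - a‖
          ≤ M * ((n + 1).factorial : ℝ) * R ^ (n + 1) * ‖y - a‖ ^ (n + 1) := by
        refine (ContinuousMultilinearMap.le_opNorm _ _).trans ?_
        simp only [Finset.prod_const, Finset.card_univ, Fintype.card_fin]
        gcongr
        exact hb _ _
      have h3 : R ^ (n + 1) * ‖y - a‖ ^ (n + 1) ≤ (1 / 2) ^ (n + 1) := by
        rw [← mul_pow]
        gcongr
        exact (mul_le_mul_of_nonneg_left hy hR).trans hr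
      have h4 : ‖(1 - t) ^ n‖ ≤ 1 := by
        rw [norm_pow]
        apply pow_le_one₀ (norm_nonneg _)
        rw [Real.norm_eq_abs, abs_le]
        constructor <;> linarith [ht.1, ht.2]
      rw [norm_mul]
      calc _ ≤ 1 * (M * ((n + 1).factorial : ℝ) * R ^ (n + 1) * ‖y - a‖ ^ (n + 1)) := by
            gcongr
        _ = M * ((n + 1).factorial : ℝ) * (R ^ (n + 1) * ‖y - a‖ ^ (n + 1)) := by ring
        _ ≤ _ := by gcongr
    rw [abs_mul, ← Real.norm_eq_abs (∫ t in (0 : ℝ)..1, _)]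
    have hn : (0 : ℝ) < n.factorial := by positivity
    rw [abs_of_pos (by positivity)]
    calc _ ≤ (n.factorial : ℝ)⁻¹ *
          ((M * ((n + 1).factorial : ℝ) * (1 / 2) ^ (n + 1)) * |1 - 0|) := by gcongr
      _ = _ := by
          rw [Nat.factorial_succ]
          push_cast
          simp only [sub_zero, abs_one, mul_one]
          field_simp

theorem isSemialgebraic_iUnion {b : ℕ} {ι κ : Type*} [Fintype ι] [Fintype κ] [DecidableEq κ]
    {D B : ℕ} (P : κ → (Fin b → ℝ) → ℝ) (hP : ∀ k, IsPoly D (P k)) (L : ι → Finset κ)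
    (hB : Fintype.card κ * D ≤ B) :
    IsSemialgebraicOfDegreeLE (⋃ j, ⋂ k ∈ L j, {y | 0 ≤ P k y}) B := by
  choose p hp1 hp2 using hP
  let e := Fintype.equivFin κ
  let e' := Fintype.equivFin ι
  refine ⟨Fintype.card κ, D, fun k => p (e.symm k), Fintype.card ι,
    fun j => (L (e'.symm j)).map e.toEmbedding, fun _ _ => .pos, hB, fun k => hp1 _, ?_⟩
  ext y
  simp only [Set.mem_iUnion, Set.mem_iInter, Set.mem_ofPred_eq, Finset.mem_map_equiv, hp2]
  constructor
  · rintro ⟨j, hj⟩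
    refine ⟨e' j, fun k hk => ?_⟩
    rw [Equiv.symm_apply_apply] at hk
    exact hj _ hk
  · rintro ⟨j, hj⟩
    refine ⟨e'.symm j, fun k hk => ?_⟩
    have := hj (e k)
    simp only [Equiv.symm_apply_apply] at this
    exact this hk

/-- The hermitian part has a real quadratic form, so a kernel vector u would satisfy Im z · Σ|u_m|²
= 0. The polynomial models stay invertible too, because their diagonal is also real before
subtracting z. -/
theorem det_ne_zero_of_im_pos {ι : Type*} [Fintype ι] [DecidableEq ι] {G : Matrix ι ι ℂ}
    (hG : G.IsHermitian) (V : ι → ℝ) {z : ℂ} (hz : 0 < z.im) :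
    (G + Matrix.diagonal fun m => (V m : ℂ) - z).det ≠ 0 := by
  intro h0
  obtain ⟨u, hu, h⟩ := Matrix.exists_mulVec_eq_zero_iff.2 h0
  have h1 := hG.im_star_dotProduct_mulVec_self u
  have h2 : star u ⬝ᵥ (G + Matrix.diagonal fun m => (V m : ℂ) - z).mulVec u = 0 := by
    rw [h, dotProduct_zero]
  rw [Matrix.add_mulVec, dotProduct_add] at h2
  have h3 := congrArg Complex.im h2
  rw [Complex.add_im] at h3
  have h1' : (star u ⬝ᵥ G.mulVec u).im = 0 := h1
  rw [h1', zero_add] at h3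
  have h4 : (star u ⬝ᵥ (Matrix.diagonal fun m => (V m : ℂ) - z).mulVec u).im
      = ∑ m, -(z.im * ‖u m‖ ^ 2) := by
    simp only [dotProduct, Matrix.mulVec_diagonal, Complex.im_sum]
    refine Finset.sum_congr rfl fun m _ => ?_
    have : star u m * (((V m : ℂ) - z) * u m) = ((V m : ℂ) - z) * ((‖u m‖ ^ 2 : ℝ) : ℂ) := by
      have h5 : star (u m) * u m = ((‖u m‖ ^ 2 : ℝ) : ℂ) := by
        rw [mul_comm, Complex.star_def, Complex.mul_conj, Complex.normSq_eq_norm_sq]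
      rw [← h5, Pi.star_apply]
      ring
    rw [this, Complex.im_mul_ofReal]
    simp
  rw [h4, Finset.sum_neg_distrib, Complex.zero_im, neg_eq_zero, ← Finset.mul_sum] at h3
  have h5 := (mul_eq_zero.1 h3).resolve_left hz.ne'
  rw [Finset.sum_eq_zero_iff_of_nonneg fun _ _ => by positivity] at h5
  apply hu
  funext m
  simpa using h5 m (Finset.mem_univ m)

/-- By the resolvent identity, the largest entry s of the perturbed inverse satisfies s ≤ g + s/2,
hence s ≤ 2g. Inserting this into the identity once more bounds the difference. -/
theorem norm_inv_sub_inv_le {ι : Type*} [Fintype ι] [DecidableEq ι] {G G' : Matrix ι ι ℂ}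
    (Δ : ι → ℂ) (hΔ : G' = G + Matrix.diagonal Δ) (hG : G.det ≠ 0) (hG' : G'.det ≠ 0)
    {η g : ℝ} (hη : ∀ m, ‖Δ m‖ ≤ η) (hg : ∀ m n, ‖G⁻¹ m n‖ ≤ g)
    (hs : 2 * Fintype.card ι * g * η ≤ 1) (m n : ι) :
    ‖G'⁻¹ m n - G⁻¹ m n‖ ≤ 2 * Fintype.card ι * g ^ 2 * η := by
  have hg0 : 0 ≤ g := (norm_nonneg _).trans (hg m n)
  have hη0 : 0 ≤ η := (norm_nonneg _).trans (hη m)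
  have hid : G'⁻¹ - G⁻¹ = -(G'⁻¹ * Matrix.diagonal Δ * G⁻¹) := by
    have h1 : G * G⁻¹ = 1 := Matrix.mul_nonsing_inv _ (Ne.isUnit hG)
    have h2 : G'⁻¹ * G' = 1 := Matrix.nonsing_inv_mul _ (Ne.isUnit hG')
    have h3 : Matrix.diagonal Δ = G' - G := by rw [hΔ]; abel
    rw [h3, mul_sub, sub_mul, h2, mul_assoc, h1, one_mul, mul_one]
    abel
  obtain ⟨⟨i₀, j₀⟩, -, hmax⟩ := Finset.exists_max_image (Finset.univ : Finset (ι × ι))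
    (fun p => ‖G'⁻¹ p.1 p.2‖) ⟨(m, n), Finset.mem_univ _⟩
  set s := ‖G'⁻¹ i₀ j₀‖ with hsdef
  have hs0 : 0 ≤ s := norm_nonneg _
  have hdiff : ∀ i j, ‖G'⁻¹ i j - G⁻¹ i j‖ ≤ Fintype.card ι * (s * η * g) := by
    intro i j
    have h1 : G'⁻¹ i j - G⁻¹ i j = -∑ k, G'⁻¹ i k * Δ k * G⁻¹ k j := by
      have := congrFun (congrFun hid i) j
      rw [Matrix.sub_apply] at this
      rw [this, Matrix.neg_apply, Matrix.mul_apply]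
      simp only [Matrix.mul_diagonal]
    rw [h1, norm_neg]
    refine (norm_sum_le _ _).trans ?_
    have h2 : ∀ k ∈ Finset.univ, ‖G'⁻¹ i k * Δ k * G⁻¹ k j‖ ≤ s * η * g := by
      intro k _
      rw [norm_mul, norm_mul]
      have h3 := hmax (i, k) (Finset.mem_univ _)
      have h4 := hη k
      have h5 := hg k j
      gcongr
    refine (Finset.sum_le_card_nsmul _ _ _ h2).trans ?_
    simp
  have h1 : s ≤ 2 * g := by
    have h2 : s ≤ ‖G⁻¹ i₀ j₀‖ + ‖G'⁻¹ i₀ j₀ - G⁻¹ i₀ j₀‖ := by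
      rw [hsdef]
      have := norm_add_le (G⁻¹ i₀ j₀) (G'⁻¹ i₀ j₀ - G⁻¹ i₀ j₀)
      rwa [add_sub_cancel] at this
    have h3 := hdiff i₀ j₀
    have h4 := hg i₀ j₀
    nlinarith
  calc _ ≤ Fintype.card ι * (s * η * g) := hdiff m n
    _ ≤ Fintype.card ι * (2 * g * η * g) := by gcongr
    _ = _ := by ring

/-- Cramer's rule turns a bound on an entry of the inverse into a polynomial inequality in the
entries of G. -/
theorem norm_inv_apply_lt_iff {ι : Type*} [Fintype ι] [DecidableEq ι] {G : Matrix ι ι ℂ}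
    (hG : G.det ≠ 0) {t : ℝ} (ht : 0 < t) (m n : ι) :
    ‖G⁻¹ m n‖ < t ↔ ‖G.adjugate m n‖ ^ 2 - t ^ 2 * ‖G.det‖ ^ 2 < 0 := by
  have hd : 0 < ‖G.det‖ := norm_pos_iff.2 hG
  have h : G⁻¹ m n = G.det⁻¹ * G.adjugate m n := by
    rw [Matrix.inv_def, Ring.inverse_eq_inv']
    rfl
  rw [h, norm_mul, norm_inv, inv_mul_lt_iff₀ hd, sub_neg, ← mul_pow,
    pow_lt_pow_iff_left₀ (norm_nonneg _) (by positivity) two_ne_zero, mul_comm]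

theorem exists_grid_center {J : ℕ} (hJ : 0 < J) {y : ℝ} (h0 : 0 ≤ y) (h1 : y ≤ 1) :
    ∃ c : Fin J, |y - ((c : ℕ) + 1 / 2 : ℝ) / J| ≤ 1 / (2 * J) := by
  have hJ' : (0 : ℝ) < J := by exact_mod_cast hJ
  have key : ∀ c : ℕ, (c : ℝ) ≤ J * y → J * y ≤ c + 1 →
      |y - ((c : ℝ) + 1 / 2) / J| ≤ 1 / (2 * J) := by
    intro c h2 h3
    have h4 : y - ((c : ℝ) + 1 / 2) / J = (J * y - (c + 1 / 2)) / J := by field_simp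
    rw [h4, abs_div, abs_of_pos hJ', ← div_div]
    gcongr
    rw [abs_le]
    constructor <;> linarith
  by_cases h : ⌊(J : ℝ) * y⌋₊ < J
  · exact ⟨⟨_, h⟩, key _ (Nat.floor_le (by positivity)) (Nat.lt_floor_add_one _).le⟩
  -- Only y = 1 reaches this case, and it belongs to the last cell.
  · refine ⟨⟨J - 1, by lia⟩, key (J - 1) ?_ ?_⟩
    · push Not at h
      have h2 : (J : ℝ) ≤ J * y := (Nat.cast_le.2 h).trans (Nat.floor_le (by positivity))
      rw [Nat.cast_sub hJ]
      push_cast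
      linarith
    · rw [Nat.cast_sub hJ]
      push_cast
      nlinarith

/-- The set of points of the unit cube at which the inverse of `G₀ + F(y) - z` is large can be
covered by a semi-algebraic set of controlled degree on which the inverse is still fairly large. -/
theorem exists_semialgebraic_cover {b : ℕ} {ι : Type*} [Fintype ι] [DecidableEq ι]
    {G₀ : Matrix ι ι ℂ} (hG₀ : G₀.IsHermitian) {z : ℂ} (hz : 0 < z.im)
    (F : ι → (Fin b → ℝ) → ℝ) (hF : ∀ m, AnalyticOnNhd ℝ (F m) Set.univ)
    {M R : ℝ} (hM : 0 ≤ M) (hR : 0 ≤ R)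
    (hb : ∀ m k y, ‖iteratedFDeriv ℝ k (F m) y‖ ≤ M * (k.factorial : ℝ) * R ^ k)
    (τ : ι → ι → ℝ) {τ₀ g : ℝ} (hτ₀ : 0 < τ₀) (hτ₀1 : τ₀ ≤ 1) (hg : 1 ≤ g)
    (hτ : ∀ m n, τ₀ ≤ τ m n) (hτg : ∀ m n, τ m n ≤ g) {J : ℕ} (hJ : 0 < J) (hRJ : R ≤ J) (k : ℕ)
    (hk : 8 * Fintype.card ι * g ^ 2 * (M * (k + 1) * (1 / 2) ^ (k + 1)) < τ₀) :
    ∃ S : Set (Fin b → ℝ),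
      IsSemialgebraicOfDegreeLE S
        (J ^ b * (b + Fintype.card ι * Fintype.card ι) * (2 * (Fintype.card ι * k) + 2)) ∧
      S ⊆ Set.Icc 0 1 ∧
      (∀ y ∈ Set.Icc (0 : Fin b → ℝ) 1, y ∉ S → ∀ m n,
        ‖(G₀ + Matrix.diagonal fun i => (F i y : ℂ) - z)⁻¹ m n‖ ≤ 3 * τ m n) ∧
      ∀ y ∈ S, ¬ ∀ m n, ‖(G₀ + Matrix.diagonal fun i => (F i y : ℂ) - z)⁻¹ m n‖ ≤ τ m n := by
  have hJ' : (0 : ℝ) < J := by exact_mod_cast hJ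
  set η : ℝ := M * (k + 1) * (1 / 2) ^ (k + 1) with hη
  have hη0 : 0 ≤ η := by positivity
  set r : ℝ := 1 / (2 * J) with hr
  have hr0 : 0 < r := by positivity
  have hRr : R * r ≤ 1 / 2 := by
    rw [hr, mul_one_div, div_le_div_iff₀ (by positivity) two_pos]
    linarith
  let a : (Fin b → Fin J) → (Fin b → ℝ) := fun c i => (((c i : ℕ) : ℝ) + 1 / 2) / J
  choose P hP1 hP2 using fun (c : Fin b → Fin J) (m : ι) =>
    exists_taylor_poly (hF m) hM hR (hb m) (a c) r hRr k
  let G : (Fin b → ℝ) → Matrix ι ι ℂ := fun y => G₀ + Matrix.diagonal fun i => (F i y : ℂ) - z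
  let G' : (Fin b → Fin J) → (Fin b → ℝ) → Matrix ι ι ℂ :=
    fun c y => G₀ + Matrix.diagonal fun i => (P c i y : ℂ) - z
  have hGd : ∀ y, (G y).det ≠ 0 := fun y => det_ne_zero_of_im_pos hG₀ _ hz
  have hGd' : ∀ c y, (G' c y).det ≠ 0 := fun c y => det_ne_zero_of_im_pos hG₀ _ hz
  have hGp : ∀ c m n, IsComplexPoly k (fun y => G' c y m n) := by
    intro c m n
    have h0 : IsComplexPoly k fun _ : Fin b → ℝ => G₀ m n := isComplexPoly_const _
    by_cases hmn : m = n
    · subst hmn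
      have h1 := h0.add (((hP1 c m).ofReal).add (isComplexPoly_const (-z)))
      simpa [G', sub_eq_add_neg] using h1
    · simpa [G', hmn] using h0
  -- Two kinds of constraints: y lies in the cell of center a c, and an entry of the inverse of that
  -- cell's polynomial model is at least 2τ. The threshold 2τ leaves room for the Taylor error on
  -- both sides, between τ and 3τ.
  let p : (Fin b → Fin J) × (Fin b ⊕ ι × ι) → (Fin b → ℝ) → ℝ := fun q y =>
    match q with
    | (c, .inl i) => r ^ 2 - (y i - a c i) * (y i - a c i)
    | (c, .inr (m, n)) =>
      ‖(G' c y).adjugate m n‖ ^ 2 - (2 * τ m n) ^ 2 * ‖(G' c y).det‖ ^ 2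
  have hp : ∀ q, IsPoly (2 * (Fintype.card ι * k) + 2) (p q) := by
    rintro ⟨c, i | ⟨m, n⟩⟩
    · have h1 : IsPoly 1 fun y : Fin b → ℝ => y i - a c i :=
        (isPoly_coord i).sub (isPoly_const _)
      exact ((isPoly_const _).sub (h1.mul h1)).mono (by lia)
    · exact (((isComplexPoly_adjugate _ (hGp c) m n).norm_sq).sub
        (((isComplexPoly_det _ (hGp c)).norm_sq).const_mul _)).mono (by lia)
  let L : (Fin b → Fin J) × ι × ι → Finset ((Fin b → Fin J) × (Fin b ⊕ ι × ι)) := fun q =>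
    insert (q.1, .inr q.2) (Finset.univ.image fun i => (q.1, .inl i))
  have hmem : ∀ y, (y ∈ ⋃ j, ⋂ q ∈ L j, {y | 0 ≤ p q y}) ↔
      ∃ c m n, ‖y - a c‖ ≤ r ∧ ¬ ‖(G' c y)⁻¹ m n‖ < 2 * τ m n := by
    intro y
    have hball : ∀ c, ‖y - a c‖ ≤ r ↔ ∀ i, 0 ≤ p (c, .inl i) y := by
      intro c
      rw [pi_norm_le_iff_of_nonneg hr0.le]
      refine forall_congr' fun i => ?_
      change ‖y i - a c i‖ ≤ r ↔ 0 ≤ r ^ 2 - (y i - a c i) * (y i - a c i)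
      rw [sub_nonneg, ← sq, sq_le_sq, Real.norm_eq_abs, abs_of_pos hr0]
    have hbad : ∀ c m n, (¬ ‖(G' c y)⁻¹ m n‖ < 2 * τ m n) ↔ 0 ≤ p (c, .inr (m, n)) y := by
      intro c m n
      rw [norm_inv_apply_lt_iff (hGd' c y) (by linarith [hτ m n]), not_lt]
    simp only [Set.mem_iUnion, Set.mem_iInter, L, Finset.mem_insert, Finset.mem_image,
      Finset.mem_univ, true_and, Prod.exists, hball, hbad]
    constructor
    · rintro ⟨c, m, n, h⟩
      exact ⟨c, m, n, fun i => h _ (Or.inr ⟨i, rfl⟩), h _ (Or.inl rfl)⟩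
    · rintro ⟨c, m, n, h1, h2⟩
      refine ⟨c, m, n, ?_⟩
      rintro q (rfl | ⟨i, rfl⟩)
      · exact h2
      · exact h1 i
  have hsmall : 8 * Fintype.card ι * g ^ 2 * η < 1 := hk.trans_le hτ₀1
  have hsmall' : 8 * Fintype.card ι * g * η ≤ 1 := by
    have : 8 * Fintype.card ι * g * η ≤ 8 * Fintype.card ι * g ^ 2 * η := by
      have : g ≤ g ^ 2 := by nlinarith
      gcongr
    linarith
  have hdiff : ∀ c y m, ‖y - a c‖ ≤ r → ‖((F m y : ℂ) - z) - ((P c m y : ℂ) - z)‖ ≤ η := by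
    intro c y m hy
    have := hP2 c m y hy
    rw [sub_sub_sub_cancel_right, ← Complex.ofReal_sub, Complex.norm_real]
    exact this
  refine ⟨⋃ j, ⋂ q ∈ L j, {y | 0 ≤ p q y}, ?_, ?_, ?_, ?_⟩
  · refine isSemialgebraic_iUnion p hp L (le_of_eq ?_)
    simp
  · intro y hy
    obtain ⟨c, -, -, h, -⟩ := (hmem y).1 hy
    rw [pi_norm_le_iff_of_nonneg hr0.le] at h
    have hrJ : r = (1 / 2) / J := by rw [hr]; field_simp
    constructor <;> intro i
    · have h1 := (abs_le.1 (h i)).1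
      have h2 : r ≤ a c i := by
        rw [hrJ]
        change _ ≤ (((c i : ℕ) : ℝ) + 1 / 2) / J
        gcongr
        simp
      have h3 : (y - a c) i = y i - a c i := rfl
      rw [h3] at h1
      change 0 ≤ y i
      linarith
    · have h1 := (abs_le.1 (h i)).2
      have h2 : a c i + r ≤ 1 := by
        have h4 : ((c i : ℕ) : ℝ) + 1 ≤ J := by exact_mod_cast (c i).2
        rw [hrJ]
        change (((c i : ℕ) : ℝ) + 1 / 2) / J + 1 / 2 / J ≤ 1
        rw [← add_div, div_le_one hJ']
        linarith
      have h3 : (y - a c) i = y i - a c i := rfl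
      rw [h3] at h1
      change y i ≤ 1
      linarith
  · intro y hy hyS m n
    rw [hmem] at hyS
    push Not at hyS
    choose c hc using fun i => exists_grid_center hJ (hy.1 i) (hy.2 i)
    have hyc : ‖y - a c‖ ≤ r := by
      rw [pi_norm_le_iff_of_nonneg hr0.le]
      exact hc
    have h1 : ∀ i j, ‖(G' c y)⁻¹ i j‖ ≤ 2 * g := fun i j =>
      (hyS c i j hyc).le.trans (by linarith [hτg i j])
    have h2 : G y = G' c y
        + Matrix.diagonal fun i => ((F i y : ℂ) - z) - ((P c i y : ℂ) - z) := by
      simp only [G, G']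
      rw [add_assoc, Matrix.diagonal_add]
      congr 2
      funext i
      ring
    -- Here the known inverse is that of the model, with entries at most 2g; this is the origin of
    -- the factor 8 = 2·2² in `hk`. The error is below τ₀ ≤ τ.
    have h3 := norm_inv_sub_inv_le _ h2 (hGd' c y) (hGd y) (fun i => hdiff c y i hyc) h1
      (by linarith) m n
    have h4 : ‖(G y)⁻¹ m n‖ ≤ ‖(G' c y)⁻¹ m n‖ + ‖(G y)⁻¹ m n - (G' c y)⁻¹ m n‖ := by
      have := norm_add_le ((G' c y)⁻¹ m n) ((G y)⁻¹ m n - (G' c y)⁻¹ m n)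
      rwa [add_sub_cancel] at this
    have h5 := hyS c m n hyc
    have h6 := hτ m n
    change ‖(G y)⁻¹ m n‖ ≤ _
    nlinarith
  · intro y hy hgood
    obtain ⟨c, m, n, hyc, hbad⟩ := (hmem y).1 hy
    have h1 : ∀ i j, ‖(G y)⁻¹ i j‖ ≤ g := fun i j => (hgood i j).trans (hτg i j)
    have h2 : G' c y = G y
        + Matrix.diagonal fun i => ((P c i y : ℂ) - z) - ((F i y : ℂ) - z) := by
      simp only [G, G']
      rw [add_assoc, Matrix.diagonal_add]
      congr 2
      funext i
      ring
    have h3 := norm_inv_sub_inv_le _ h2 (hGd y) (hGd' c y)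
      (fun i => by rw [norm_sub_rev]; exact hdiff c y i hyc) h1
      (by
        have : 0 ≤ Fintype.card ι * g * η := by positivity
        nlinarith) m n
    have h4 : ‖(G' c y)⁻¹ m n‖ ≤ ‖(G y)⁻¹ m n‖ + ‖(G' c y)⁻¹ m n - (G y)⁻¹ m n‖ := by
      have := norm_add_le ((G y)⁻¹ m n) ((G' c y)⁻¹ m n - (G y)⁻¹ m n)
      rwa [add_sub_cancel] at this
    have h5 : ‖(G y)⁻¹ m n‖ ≤ τ m n := hgood m n
    have h6 := hτ m n
    have h7 : 0 ≤ Fintype.card ι * g ^ 2 * η := by positivity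
    apply hbad
    nlinarith

/-! ### Counting the sites with a bad Green's function. -/

theorem mem_cube_iff {d N : ℕ} (n : Fin d → ℤ) : n ∈ cube d N ↔ ‖n‖ ≤ N := by
  rw [cube, Fintype.mem_piFinset, pi_norm_le_iff_of_nonneg (Nat.cast_nonneg _)]
  refine forall_congr' fun i => ?_
  rw [Finset.mem_Icc, ← abs_le, Int.norm_eq_abs]
  exact_mod_cast Iff.rfl

theorem card_cube (d N : ℕ) : (cube d N).card = (2 * N + 1) ^ d := by
  rw [cube, Fintype.card_piFinset]
  simp only [Int.card_Icc, Finset.prod_const, Finset.card_univ, Fintype.card_fin]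
  congr 1
  lia

theorem exists_toTorus_eq {b : ℕ} (x : Torus b) : ∃ y ∈ Set.Icc (0 : Fin b → ℝ) 1,
    toTorus y = x := by
  have h : ∀ t : UnitAddCircle, ∃ s : ℝ, 0 ≤ s ∧ s ≤ 1 ∧ (s : UnitAddCircle) = t := by
    intro t
    obtain ⟨s, rfl⟩ := QuotientAddGroup.mk_surjective t
    refine ⟨Int.fract s, Int.fract_nonneg s, (Int.fract_lt_one s).le, ?_⟩
    change ((s - ⌊s⌋ : ℝ) : UnitAddCircle) = (s : UnitAddCircle)
    rw [AddCircle.coe_sub, sub_eq_self]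
    exact (AddCircle.coe_eq_zero_iff (1 : ℝ)).2 ⟨⌊s⌋, by simp⟩
  choose s h0 h1 h2 using fun i => h (x i)
  exact ⟨s, ⟨h0, h1⟩, funext h2⟩

/-- The projection of the unit cube to the torus preserves measure. X is replaced by a measurable
hull, since the exceptional set of the LDT is not assumed measurable. -/
theorem volume_le_of_toTorus_mem {b : ℕ} {S : Set (Fin b → ℝ)} (hS : S ⊆ Set.Icc 0 1)
    {X : Set (Torus b)} (h : ∀ y ∈ S, toTorus y ∈ X) :
    MeasureTheory.volume S ≤ MeasureTheory.volume X := by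
  have h1 : MeasureTheory.MeasurePreserving ((↑) : ℝ → UnitAddCircle)
      (MeasureTheory.volume.restrict (Set.Icc 0 1)) MeasureTheory.volume := by
    have := UnitAddCircle.measurePreserving_mk 0
    rwa [zero_add, MeasureTheory.restrict_Ioc_eq_restrict_Icc] at this
  have h2 := MeasureTheory.measurePreserving_pi
    (fun _ : Fin b => MeasureTheory.volume.restrict (Set.Icc (0 : ℝ) 1))
    (fun _ : Fin b => (MeasureTheory.volume : MeasureTheory.Measure UnitAddCircle))
    (fun _ => h1)
  rw [← MeasureTheory.Measure.restrict_pi_pi, Set.pi_univ_Icc] at h2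
  calc MeasureTheory.volume S
      ≤ MeasureTheory.volume
          (toTorus ⁻¹' (MeasureTheory.toMeasurable MeasureTheory.volume X) ∩ Set.Icc 0 1) :=
        MeasureTheory.measure_mono fun y hy =>
          ⟨MeasureTheory.subset_toMeasurable _ _ (h y hy), hS hy⟩
    _ = (MeasureTheory.volume.restrict (Set.Icc 0 1))
          (toTorus ⁻¹' (MeasureTheory.toMeasurable MeasureTheory.volume X)) := by
        rw [MeasureTheory.Measure.restrict_apply']
        exact measurableSet_Icc
    _ = MeasureTheory.volume (MeasureTheory.toMeasurable MeasureTheory.volume X) :=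
        h2.measure_preimage (MeasureTheory.measurableSet_toMeasurable _ _).nullMeasurableSet
    _ = MeasureTheory.volume X := MeasureTheory.measure_toMeasurable _

open Classical in
theorem green_eq {d : ℕ} (A : (Fin d → ℤ) → (Fin d → ℤ) → ℂ) (V : (Fin d → ℤ) → ℝ)
    (Q : Finset (Fin d → ℤ)) (z : ℂ) :
    green A V Q z = ((Matrix.of fun m n : Q => A m n)
      + Matrix.diagonal fun m : Q => (V m : ℂ) - z)⁻¹ := by
  have h : (Matrix.of fun m n : Q => A (m : Fin d → ℤ) (n : Fin d → ℤ)
      + if m = n then (V (m : Fin d → ℤ) : ℂ) - z else 0)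
      = (Matrix.of fun m n : Q => A m n) + Matrix.diagonal fun m : Q => (V m : ℂ) - z := by
    ext m n
    rw [Matrix.add_apply, Matrix.of_apply, Matrix.of_apply, Matrix.diagonal_apply]
  rw [← h, green]

theorem norm_apply_le_norm_toEuclideanCLM {ι : Type*} [Fintype ι] [DecidableEq ι]
    (G : Matrix ι ι ℂ) (m n : ι) : ‖G m n‖ ≤ ‖Matrix.toEuclideanCLM (n := ι) (𝕜 := ℂ) G‖ := by
  have h1 := (Matrix.toEuclideanCLM (n := ι) (𝕜 := ℂ) G).le_opNorm (EuclideanSpace.single n 1)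
  have h2 := PiLp.norm_apply_le
    (Matrix.toEuclideanCLM (n := ι) (𝕜 := ℂ) G (EuclideanSpace.single n 1)) m
  have h3 : (Matrix.toEuclideanCLM (n := ι) (𝕜 := ℂ) G (EuclideanSpace.single n 1)) m = G m n := by
    have := congrFun (Matrix.ofLp_toEuclideanCLM G (EuclideanSpace.single n (1 : ℂ))) m
    rw [this]
    simp
  rw [h3] at h2
  simpa using h2.trans h1

/-- The row at the center of the Green's function of the cube of size `N` centered at `n`
exists and satisfies, up to a factor, the bounds of the large deviation theorem. -/
def HasGreenRow {d : ℕ} (A : (Fin d → ℤ) → (Fin d → ℤ) → ℂ) (V : (Fin d → ℤ) → ℝ)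
    (σ₁ c₂ : ℝ) (N : ℕ) (z : ℂ) (n : Fin d → ℤ) : Prop :=
  ∃ G : (Fin d → ℤ) → ℂ,
    (∀ k ∈ cube d N, ∑ m ∈ cube d N, G m * (A m k + if m = k then (V (n + m) : ℂ) - z else 0)
      = if k = 0 then 1 else 0) ∧
    (∀ m ∈ cube d N, ‖G m‖ ≤ 3 * Real.exp ((N : ℝ) ^ σ₁)) ∧
    ∀ m ∈ cube d N, (N : ℝ) / 10 ≤ ‖m‖ → ‖G m‖ ≤ 3 * Real.exp (-c₂ * ‖m‖)

open Classical in
-- Covariance: the potential on n + cube at phase x is the potential on the cube at phase fⁿx, and A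
-- is translation invariant. The wanted row is row 0 of the inverse matrix at y.
theorem hasGreenRow_of_norm_inv_le {d b : ℕ} {A : (Fin d → ℤ) → (Fin d → ℤ) → ℂ} {C₁ c₁ : ℝ}
    (hA : IsKernel A C₁ c₁) {v : Torus b → ℝ} {f : (Fin d → ℤ) → Torus b → Torus b}
    (hf : ∀ m n x, f (m + n) x = f m (f n x)) {x : Torus b} {σ₁ c₂ : ℝ} {N : ℕ} {z : ℂ}
    (hz : 0 < z.im) {n : Fin d → ℤ} {y : Fin b → ℝ} (hy : toTorus y = f n x)
    (h : ∀ m k : cube d N, ‖((Matrix.of fun m k : cube d N => A m k)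
      + Matrix.diagonal fun m : cube d N => ((v (f m (toTorus y)) : ℝ) : ℂ) - z)⁻¹ m k‖
      ≤ 3 * if (N : ℝ) / 10 ≤ ‖(m : Fin d → ℤ) - k‖
        then Real.exp (-c₂ * ‖(m : Fin d → ℤ) - k‖) else Real.exp ((N : ℝ) ^ σ₁))
    (hle : ∀ m k : cube d N, (if (N : ℝ) / 10 ≤ ‖(m : Fin d → ℤ) - k‖
        then Real.exp (-c₂ * ‖(m : Fin d → ℤ) - k‖) else Real.exp ((N : ℝ) ^ σ₁))
        ≤ Real.exp ((N : ℝ) ^ σ₁)) :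
    HasGreenRow A (potential v f x) σ₁ c₂ N z n := by
  set X : Matrix (cube d N) (cube d N) ℂ := (Matrix.of fun m k : cube d N => A m k)
      + Matrix.diagonal fun m : cube d N => ((v (f m (toTorus y)) : ℝ) : ℂ) - z with hX
  have hherm : (Matrix.of fun m k : cube d N => A m k).IsHermitian := by
    ext i j
    rw [Matrix.conjTranspose_apply]
    exact (hA.hermitian i j).symm
  have hdet : X.det ≠ 0 := det_ne_zero_of_im_pos hherm _ hz
  have h0 : (0 : Fin d → ℤ) ∈ cube d N := (mem_cube_iff _).2 (by simp)
  obtain ⟨G, hG⟩ : ∃ G : (Fin d → ℤ) → ℂ, ∀ m (hm : m ∈ cube d N),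
      G m = X⁻¹ ⟨0, h0⟩ ⟨m, hm⟩ :=
    ⟨fun m => if hm : m ∈ cube d N then X⁻¹ ⟨0, h0⟩ ⟨m, hm⟩ else 0, fun m hm => dif_pos hm⟩
  refine ⟨G, ?_, ?_, ?_⟩
  · intro k hk
    have h1 : (X⁻¹ * X) ⟨0, h0⟩ ⟨k, hk⟩ = if k = 0 then 1 else 0 := by
      rw [Matrix.nonsing_inv_mul _ (Ne.isUnit hdet), Matrix.one_apply]
      simp [eq_comm]
    rw [← h1, Matrix.mul_apply, ← Finset.sum_coe_sort]
    refine Finset.sum_congr rfl fun m _ => ?_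
    rw [hG _ m.2, hX]
    congr 1
    rw [Matrix.add_apply, Matrix.of_apply]
    congr 1
    by_cases hmk : (m : Fin d → ℤ) = k
    · have : m = ⟨k, hk⟩ := Subtype.ext hmk
      subst this
      simp only [Matrix.diagonal_apply_eq, if_true]
      rw [potential, add_comm n, hf, hy]
    · rw [if_neg hmk, Matrix.diagonal_apply_ne]
      exact fun h2 => hmk (congrArg Subtype.val h2)
  · intro m hm
    rw [hG _ hm]
    exact (h _ _).trans (by linarith [hle ⟨0, h0⟩ ⟨m, hm⟩])
  · intro m hm hm2
    rw [hG _ hm]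
    have := h ⟨0, h0⟩ ⟨m, hm⟩
    simp only [zero_sub, norm_neg] at this
    rwa [if_pos hm2] at this

/-- Under the LDT and the sublinear bound, few sites of a large cube lack a good Green's row. -/
theorem ncard_not_hasGreenRow_le {d b : ℕ} {K σ₁ σ₂ δ ε₀ c₁ c₂ C₁ C₂ C₃ M R κ : ℝ} {N₀ : ℕ}
    (hc₂ : 0 < c₂) (hM : 0 < M) (hR : 0 < R)
    {N L k J B : ℕ} (hN₀ : N₀ ≤ N) (hL : 1 ≤ L)
    (hJ : R * (1 + N : ℝ) ^ (⌈κ⌉₊) ≤ J) (hσN : (N : ℝ) ^ σ₁ ≤ N)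
    (hk : 8 * ((2 * N + 1) ^ d : ℕ) * Real.exp N ^ 2 * (M * (k + 1) * (1 / 2) ^ (k + 1))
      < Real.exp (-(2 * c₂ * N)))
    (hB : J ^ b * (b + (2 * N + 1) ^ d * (2 * N + 1) ^ d) * (2 * ((2 * N + 1) ^ d * k) + 2) ≤ B)
    (hBL : Real.log B ≤ C₃ * Real.log L)
    (hLη : Real.log L < (N : ℝ) ^ σ₂ - Real.log 2)
    {A : (Fin d → ℤ) → (Fin d → ℤ) → ℂ} {v : Torus b → ℝ} {f : (Fin d → ℤ) → Torus b → Torus b}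
    (hA : IsKernel A C₁ c₁) (hf : ∀ m n x, f (m + n) x = f m (f n x))
    (hv : PolynomiallyAnalytic v f M R κ) (hldt : LDT A v f K σ₁ σ₂ c₂ ε₀ N₀) {x : Torus b}
    (hx : SublinearBound f x δ C₂ C₃) {E ε' : ℝ} (hE : |E| ≤ K) (hε' : 0 < ε') (hε₀ : ε' ≤ ε₀) :
    (Set.ncard {n : Fin d → ℤ | n ∈ cube d L ∧
      ¬ HasGreenRow A (potential v f x) σ₁ c₂ N ((E : ℂ) + (ε' : ℂ) * Complex.I) n} : ℝ)
      ≤ C₂ * (L : ℝ) ^ (1 - δ) := by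
  classical
  set z : ℂ := (E : ℂ) + (ε' : ℂ) * Complex.I with hz
  have hzim : 0 < z.im := by simpa [hz] using hε'
  set Q := cube d N with hQ
  have hherm : (Matrix.of fun m k : Q => A m k).IsHermitian := by
    ext i j
    rw [Matrix.conjTranspose_apply]
    exact (hA.hermitian i j).symm
  let F : Q → (Fin b → ℝ) → ℝ := fun m y => v (f m (toTorus y))
  -- The thresholds are the LDT bounds themselves. They lie between exp(-2c₂N), as sites of the cube
  -- are at distance at most 2N, and exp(N).
  let τ : Q → Q → ℝ := fun m k => if (N : ℝ) / 10 ≤ ‖(m : Fin d → ℤ) - k‖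
        then Real.exp (-c₂ * ‖(m : Fin d → ℤ) - k‖) else Real.exp ((N : ℝ) ^ σ₁)
  have hN0 : (0 : ℝ) ≤ N := Nat.cast_nonneg _
  have hσ0 : 0 ≤ (N : ℝ) ^ σ₁ := Real.rpow_nonneg hN0 _
  have hτle : ∀ m k, τ m k ≤ Real.exp ((N : ℝ) ^ σ₁) := by
    intro m k
    simp only [τ]
    split_ifs
    · apply Real.exp_le_exp.2
      have := mul_nonneg hc₂.le (norm_nonneg ((m : Fin d → ℤ) - k))
      linarith
    · exact le_rfl
  have hτge : ∀ m k, Real.exp (-(2 * c₂ * N)) ≤ τ m k := by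
    intro m k
    simp only [τ]
    split_ifs
    · apply Real.exp_le_exp.2
      have h1 := (mem_cube_iff _).1 m.2
      have h2 := (mem_cube_iff _).1 k.2
      have h3 : ‖(m : Fin d → ℤ) - k‖ ≤ 2 * N := (norm_sub_le _ _).trans (by linarith)
      nlinarith
    · apply Real.exp_le_exp.2
      have : 0 ≤ 2 * c₂ * N := by positivity
      linarith
  have hb : ∀ (m : Q) (j : ℕ) (y : Fin b → ℝ), ‖iteratedFDeriv ℝ j (F m) y‖
      ≤ M * (j.factorial : ℝ) * (R * (1 + N : ℝ) ^ (⌈κ⌉₊)) ^ j := by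
    intro m j y
    refine ((hv m).2 j y).trans ?_
    have h1 := (mem_cube_iff _).1 m.2
    have h2 : (1 + ‖(m : Fin d → ℤ)‖) ^ κ ≤ (1 + N : ℝ) ^ (⌈κ⌉₊) := by
      calc (1 + ‖(m : Fin d → ℤ)‖) ^ κ ≤ (1 + ‖(m : Fin d → ℤ)‖) ^ ((⌈κ⌉₊ : ℕ) : ℝ) := by
            apply Real.rpow_le_rpow_of_exponent_le
            · linarith [norm_nonneg (m : Fin d → ℤ)]
            · exact Nat.le_ceil κ
        _ = (1 + ‖(m : Fin d → ℤ)‖) ^ (⌈κ⌉₊) := Real.rpow_natCast _ _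
        _ ≤ _ := by gcongr
    have h3 : 0 ≤ (1 + ‖(m : Fin d → ℤ)‖) ^ κ := by positivity
    gcongr
  have hR' : 0 < R * (1 + N : ℝ) ^ (⌈κ⌉₊) := by positivity
  have hJ0 : 0 < J := by exact_mod_cast hR'.trans_le hJ
  have hcard : Fintype.card Q = (2 * N + 1) ^ d := by rw [Fintype.card_coe, card_cube]
  obtain ⟨S, hS1, hS2, hS3, hS4⟩ := exists_semialgebraic_cover hherm hzim F
    (fun m => (hv m).1) hM.le hR'.le hb τ (τ₀ := Real.exp (-(2 * c₂ * N))) (g := Real.exp N)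
    (Real.exp_pos _) (Real.exp_le_one_iff.2 (by
      have : 0 ≤ 2 * c₂ * N := by positivity
      linarith)) (Real.one_le_exp hN0) hτge
    (fun m k => (hτle m k).trans (Real.exp_le_exp.2 hσN)) hJ0 hJ k (by rw [hcard]; exact hk)
  rw [hcard] at hS1
  have hS1' : IsSemialgebraicOfDegreeLE S B := by
    obtain ⟨s, D, P, J', L', ς, h1, h2⟩ := hS1
    exact ⟨s, D, P, J', L', ς, h1.trans hB, h2⟩
  obtain ⟨X, hX1, hX2⟩ := hldt N hN₀ E ε' hE hε' hε₀
  -- On S some entry exceeds its LDT bound, so S projects into the exceptional set and inherits its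
  -- small measure.
  have hSX : ∀ y ∈ S, toTorus y ∈ X := by
    intro y hy
    by_contra hyX
    have hgood := hX2 _ hyX Q (Or.inl rfl)
    refine hS4 y hy fun m k => ?_
    obtain ⟨h1, h2⟩ := hgood
    have hgr : green A (potential v f (toTorus y)) Q z
        = ((Matrix.of fun m k : Q => A m k) + Matrix.diagonal fun i => (F i y : ℂ) - z)⁻¹ :=
      by
        have hFV : (fun i : Q => (F i y : ℂ) - z)
            = fun m : Q => ((potential v f (toTorus y) m : ℝ) : ℂ) - z := rfl
        rw [hFV]
        convert green_eq A (potential v f (toTorus y)) Q z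
    rw [← hgr]
    simp only [τ]
    split_ifs with hmk
    · exact h2 m k hmk
    · exact (@norm_apply_le_norm_toEuclideanCLM _ _ _ (green A _ Q z) m k).trans h1
  -- The factor 2 produces the strict inequality required by the sublinear bound; it costs the log 2
  -- in `hLη`.
  have hvol : MeasureTheory.volume S < ENNReal.ofReal (2 * Real.exp (-((N : ℝ) ^ σ₂))) := by
    refine ((volume_le_of_toTorus_mem hS2 hSX).trans hX1).trans_lt ?_
    rw [ENNReal.ofReal_lt_ofReal_iff (by positivity)]
    linarith [Real.exp_pos (-((N : ℝ) ^ σ₂))]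
  have hB1 : 1 ≤ B := by
    refine le_trans ?_ hB
    have h1 : 0 < (2 * N + 1) ^ d := by positivity
    have h2 : 0 < J ^ b := by positivity
    have h3 : 0 < b + (2 * N + 1) ^ d * (2 * N + 1) ^ d := by positivity
    exact Nat.one_le_iff_ne_zero.2 (by positivity)
  have hlog : Real.log (1 / (2 * Real.exp (-((N : ℝ) ^ σ₂)))) = (N : ℝ) ^ σ₂ - Real.log 2 := by
    rw [one_div, Real.log_inv, Real.log_mul two_ne_zero (Real.exp_pos _).ne', Real.log_exp]
    ring
  have hcount := hx B (2 * Real.exp (-((N : ℝ) ^ σ₂))) S hB1 (by positivity) hS1' hS2 hvol L hL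
    hBL (by rw [hlog]; exact hLη)
  refine le_trans ?_ hcount
  rw [Nat.cast_le]
  apply Set.ncard_le_ncard
  · rintro n ⟨hn, hbad⟩
    refine ⟨hn, ?_⟩
    obtain ⟨y, hy, hyn⟩ := exists_toTorus_eq (f n x)
    refine ⟨y, ?_, hyn⟩
    by_contra hyS
    apply hbad
    refine hasGreenRow_of_norm_inv_le hA hf hzim hyn ?_ ?_
    · intro m k
      convert hS3 y hy hyS m k using 4
    · intro m k
      convert hτle m k using 3
  · exact (Finset.finite_toSet (cube d L)).subset fun n hn => hn.1

/-! ### Smallness of the resolvent beyond a shell of good sites. -/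

/-- A good Green's row at `n` contracts any subexponential bound for an eigensolution near `n`. -/
theorem norm_le_half_of_hasGreenRow {d : ℕ} {A : (Fin d → ℤ) → (Fin d → ℤ) → ℂ}
    {C₁ c₁ c₂ σ₁ c : ℝ} (hC₁ : 0 < C₁) (hc : 0 < c) (hcc₁ : c ≤ c₁) (hcc₂ : c ≤ c₂)
    (hA : IsKernel A C₁ c₁) {V : (Fin d → ℤ) → ℝ} {H : Hil d →L[ℂ] Hil d} (hH : ActsBy A V H)
    {z : ℂ} {w : Hil d} {N : ℕ} {n : Fin d → ℤ} (hrow : HasGreenRow A V σ₁ c₂ N z n)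
    (hw : ∀ m, ‖m‖ ≤ N → (H w) (n + m) = z * w (n + m)) {Φ : ℝ}
    (hΦ : ∀ k, ‖w (n + k)‖ ≤ Φ * Real.exp (c / 4 * ‖k‖))
    (hN : (2 * N + 1 : ℝ) ^ d * (3 * C₁ * Real.exp ((N : ℝ) ^ σ₁) * Real.exp (-(2 / 5 * c * N)) *
      ∑' k : Fin d → ℤ, Real.exp (-(c / 4) * ‖k‖)) ≤ 1 / 2) :
    ‖w n‖ ≤ Φ / 2 := by
  classical
  have hΦ0 : 0 ≤ Φ := by
    have := (norm_nonneg _).trans (hΦ 0)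
    simpa using this
  obtain ⟨G, hG1, hG2, hG3⟩ := hrow
  have hsum : ∀ m, HasSum (fun k => A m k * w (n + k))
      ((H w) (n + m) - (V (n + m) : ℂ) * w (n + m)) := by
    intro m
    have h1 := hH.hasSum w (n + m)
    rw [← (Equiv.addLeft n).hasSum_iff] at h1
    have h2 : ((fun k => A (n + m) k * w k) ∘ Equiv.addLeft n) = fun k => A m k * w (n + k) := by
      funext k
      have := hA.translation m k n
      rw [add_comm m, add_comm k] at this
      simp [this]
    rwa [h2] at h1
  set r : (Fin d → ℤ) → ℂ := fun m => ∑ k ∈ cube d N,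
    (A m k + if m = k then (V (n + m) : ℂ) - z else 0) * w (n + k) with hr
  -- The equation holds on the whole cube around n, so the truncated operator applied to w sees only
  -- the coupling to sites outside the cube.
  have hout : ∀ m ∈ cube d N,
      HasSum (fun k => if k ∈ cube d N then 0 else A m k * w (n + k)) (-r m) := by
    intro m hm
    have h1 : HasSum (fun k => if k ∈ cube d N then A m k * w (n + k) else 0)
        (∑ k ∈ cube d N, A m k * w (n + k)) := by
      rw [← Finset.sum_congr rfl fun k hk => if_pos hk]
      exact hasSum_sum_of_ne_finset_zero fun k hk => if_neg hk
    have h2 := (hsum m).sub h1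
    have h3 : (fun k => A m k * w (n + k) - if k ∈ cube d N then A m k * w (n + k) else 0)
        = fun k => if k ∈ cube d N then 0 else A m k * w (n + k) := by
      funext k
      split_ifs <;> simp
    rw [h3] at h2
    have h4 : r m = ∑ k ∈ cube d N, A m k * w (n + k) + ((V (n + m) : ℂ) - z) * w (n + m) := by
      simp only [hr, add_mul, Finset.sum_add_distrib, ite_mul, zero_mul]
      rw [Finset.sum_ite_eq, if_pos hm]
    have h5 : -r m = (H w) (n + m) - (V (n + m) : ℂ) * w (n + m)
        - ∑ k ∈ cube d N, A m k * w (n + k) := by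
      rw [h4, hw m ((mem_cube_iff _).1 hm)]
      ring
    rw [h5]
    exact h2
  -- The row of the Green's function inverts the truncated operator at the center: wₙ is expressed
  -- through exterior values only.
  have hwn : w n = ∑ m ∈ cube d N, G m * r m := by
    have h0 : (0 : Fin d → ℤ) ∈ cube d N := (mem_cube_iff _).2 (by simp)
    calc w n = ∑ k ∈ cube d N, (if k = 0 then 1 else 0) * w (n + k) := by
          simp [h0]
      _ = ∑ k ∈ cube d N, (∑ m ∈ cube d N,
            G m * (A m k + if m = k then (V (n + m) : ℂ) - z else 0)) * w (n + k) :=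
          Finset.sum_congr rfl fun k hk => by rw [hG1 k hk]
      _ = _ := by
          simp only [hr, Finset.sum_mul, Finset.mul_sum]
          rw [Finset.sum_comm]
          refine Finset.sum_congr rfl fun m _ => Finset.sum_congr rfl fun k _ => ?_
          ring
  set Θ := 3 * C₁ * Real.exp ((N : ℝ) ^ σ₁) * Real.exp (-(2 / 5 * c * N)) with hΘ
  have hterm : ∀ m ∈ cube d N, ‖G m * r m‖
      ≤ Φ * Θ * ∑' k : Fin d → ℤ, Real.exp (-(c / 4) * ‖k‖) := by
    intro m hm
    have hs : Summable fun k : Fin d → ℤ => Real.exp (-(c / 4) * ‖k‖) :=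
      summable_exp_norm (by positivity)
    rw [← norm_neg, ← mul_neg]
    refine ((hout m hm).mul_left (G m)).norm_le_of_bounded (hs.hasSum.mul_left (Φ * Θ)) ?_
    intro k
    by_cases hk : k ∈ cube d N
    · simp only [if_pos hk, mul_zero, norm_zero]
      positivity
    · simp only [if_neg hk]
      have hkN : (N : ℝ) < ‖k‖ := not_le.1 fun h => hk ((mem_cube_iff _).2 h)
      have hA' := hA.decay m k
      -- If ‖m‖ ≥ N/10, the Green's function and A share the path from 0 to k. Otherwise ‖m - k‖ ≥
      -- 9/10 ‖k‖ and A alone decays enough.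
      have hG : ‖G m‖ * Real.exp (-c₁ * ‖m - k‖)
          ≤ 3 * (Real.exp ((N : ℝ) ^ σ₁) * Real.exp (-(9 / 10 * c * ‖k‖))) := by
        have htri : ‖k‖ ≤ ‖m‖ + ‖m - k‖ := by
          have := norm_sub_le m (m - k)
          rwa [sub_sub_cancel] at this
        by_cases hm10 : (N : ℝ) / 10 ≤ ‖m‖
        · have h1 := hG3 m hm hm10
          calc _ ≤ 3 * Real.exp (-c₂ * ‖m‖) * Real.exp (-c₁ * ‖m - k‖) := by gcongr
            _ = 3 * Real.exp (-c₂ * ‖m‖ + -c₁ * ‖m - k‖) := by rw [Real.exp_add]; ring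
            _ ≤ _ := by
              rw [← Real.exp_add]
              refine mul_le_mul_of_nonneg_left (Real.exp_le_exp.2 ?_) zero_le_three
              have h2 : 0 ≤ (N : ℝ) ^ σ₁ := Real.rpow_nonneg (Nat.cast_nonneg _) _
              have h3 : c * ‖m‖ ≤ c₂ * ‖m‖ := by gcongr
              have h4 : c * ‖m - k‖ ≤ c₁ * ‖m - k‖ := by gcongr
              have h5 : c * ‖k‖ ≤ c * (‖m‖ + ‖m - k‖) := by gcongr
              have h6 : 0 ≤ c * ‖k‖ := by positivity
              linarith
        · have h1 := hG2 m hm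
          push Not at hm10
          calc _ ≤ 3 * Real.exp ((N : ℝ) ^ σ₁) * Real.exp (-c₁ * ‖m - k‖) := by gcongr
            _ = 3 * Real.exp ((N : ℝ) ^ σ₁ + -c₁ * ‖m - k‖) := by rw [Real.exp_add]; ring
            _ ≤ _ := by
              rw [← Real.exp_add]
              gcongr
              have h4 : c * ‖m - k‖ ≤ c₁ * ‖m - k‖ := by gcongr
              have h5 : c * (9 / 10 * ‖k‖) ≤ c * ‖m - k‖ := by
                gcongr
                linarith
              linarith
      have hΦk := hΦ k
      calc ‖G m * (A m k * w (n + k))‖ = ‖G m‖ * (‖A m k‖ * ‖w (n + k)‖) := by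
            rw [norm_mul, norm_mul]
        _ ≤ ‖G m‖ * ((C₁ * Real.exp (-c₁ * ‖m - k‖)) * (Φ * Real.exp (c / 4 * ‖k‖))) := by
            gcongr
        _ = C₁ * Φ * Real.exp (c / 4 * ‖k‖) * (‖G m‖ * Real.exp (-c₁ * ‖m - k‖)) := by ring
        _ ≤ C₁ * Φ * Real.exp (c / 4 * ‖k‖) *
            (3 * (Real.exp ((N : ℝ) ^ σ₁) * Real.exp (-(9 / 10 * c * ‖k‖)))) := by gcongr
        _ = 3 * C₁ * Φ * Real.exp ((N : ℝ) ^ σ₁) *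
            (Real.exp (c / 4 * ‖k‖) * Real.exp (-(9 / 10 * c * ‖k‖))) := by ring
        _ ≤ 3 * C₁ * Φ * Real.exp ((N : ℝ) ^ σ₁) *
            (Real.exp (-(2 / 5 * c * N)) * Real.exp (-(c / 4) * ‖k‖)) := by
            -- Budget of the rate: 9/10 = 1/4 + 1/4 + 2/5, for the growth of w, the sum over k, and
            -- the gain in N.
            rw [← Real.exp_add, ← Real.exp_add]
            refine mul_le_mul_of_nonneg_left (Real.exp_le_exp.2 ?_) (by positivity)
            have : c * N ≤ c * ‖k‖ := by gcongr
            linarith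
        _ = _ := by rw [hΘ]; ring
  rw [hwn]
  refine (norm_sum_le _ _).trans ((Finset.sum_le_card_nsmul _ _ _ hterm).trans ?_)
  rw [card_cube, nsmul_eq_mul]
  push_cast
  calc _ = Φ * ((2 * N + 1 : ℝ) ^ d * (Θ * ∑' k : Fin d → ℤ, Real.exp (-(c / 4) * ‖k‖))) := by
        ring
    _ ≤ Φ * (1 / 2) := by gcongr
    _ = Φ / 2 := by ring

/-- In a shell of good sites a bounded solution decays exponentially towards the middle. -/
theorem norm_le_exp_of_shell {d : ℕ} {A : (Fin d → ℤ) → (Fin d → ℤ) → ℂ}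
    {C₁ c₁ c₂ σ₁ c : ℝ} (hC₁ : 0 < C₁) (hc : 0 < c) (hcc₁ : c ≤ c₁) (hcc₂ : c ≤ c₂)
    (hA : IsKernel A C₁ c₁) {V : (Fin d → ℤ) → ℝ} {H : Hil d →L[ℂ] Hil d} (hH : ActsBy A V H)
    {z : ℂ} {w φ : Hil d} (hw : H w - z • w = φ) {N : ℕ} {r₀ ρ W : ℝ}
    (hφ : ∀ n, φ n ≠ 0 → ‖n‖ ≤ r₀) (hρ : r₀ + N < ρ - W) (hW : 0 ≤ W)
    (hgood : ∀ n : Fin d → ℤ, |‖n‖ - ρ| ≤ W → HasGreenRow A V σ₁ c₂ N z n)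
    {Y : ℝ} (hY : ∀ n, ‖w n‖ ≤ Y)
    (hN : (2 * N + 1 : ℝ) ^ d * (3 * C₁ * Real.exp ((N : ℝ) ^ σ₁) * Real.exp (-(2 / 5 * c * N)) *
      ∑' k : Fin d → ℤ, Real.exp (-(c / 4) * ‖k‖)) ≤ 1 / 2) (n : Fin d → ℤ) :
    ‖w n‖ ≤ Y * Real.exp (-(c / 4) * (W - |‖n‖ - ρ|)) := by
  have hY0 : 0 ≤ Y := (norm_nonneg _).trans (hY 0)
  -- A tent weight, zero outside the shell and Lipschitz with constant c/4, exactly the growth that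
  -- a good Green's row tolerates.
  set g : (Fin d → ℤ) → ℝ := fun n => c / 4 * max 0 (W - |‖n‖ - ρ|) with hg
  have hg0 : ∀ n, 0 ≤ g n := fun n => by positivity
  have hgW : ∀ n, g n ≤ c / 4 * W := fun n => by
    simp only [hg]
    gcongr
    exact max_le hW (by linarith [abs_nonneg (‖n‖ - ρ)])
  have hglip : ∀ n k, g n ≤ g (n + k) + c / 4 * ‖k‖ := by
    intro n k
    simp only [hg]
    rw [← mul_add]
    gcongr
    have h1 : |‖n + k‖ - ρ| ≤ |‖n‖ - ρ| + ‖k‖ := by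
      have h2 := abs_norm_sub_norm_le (n + k) n
      rw [add_sub_cancel_left] at h2
      have h3 := abs_add_le (‖n + k‖ - ‖n‖) (‖n‖ - ρ)
      rw [sub_add_sub_cancel] at h3
      linarith
    apply max_le
    · positivity
    · have := le_max_right 0 (W - |‖n + k‖ - ρ|)
      linarith
  have hbdd : BddAbove (Set.range fun n => ‖w n‖ * Real.exp (g n)) := by
    refine ⟨Y * Real.exp (c / 4 * W), ?_⟩
    rintro _ ⟨n, rfl⟩
    have := hY n
    have := hgW n
    dsimp only
    gcongr
  set M₀ := ⨆ n, ‖w n‖ * Real.exp (g n) with hM₀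
  have hle : ∀ n, ‖w n‖ * Real.exp (g n) ≤ M₀ := fun n => le_ciSup hbdd n
  have hM0 : 0 ≤ M₀ := le_trans (by positivity) (hle 0)
  -- Inside the shell the weighted supremum M₀ is halved; outside, the weight is 1. As M₀ is finite,
  -- M₀ ≤ max(Y, M₀/2) forces M₀ ≤ Y, with no iteration.
  have hstep : ∀ n, ‖w n‖ * Real.exp (g n) ≤ max Y (M₀ / 2) := by
    intro n
    by_cases hn : |‖n‖ - ρ| ≤ W
    · apply le_max_of_le_right
      have h1 : ‖w n‖ ≤ M₀ * Real.exp (-g n) / 2 := by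
        refine norm_le_half_of_hasGreenRow hC₁ hc hcc₁ hcc₂ hA hH (hgood n hn) ?_ ?_ hN
        · intro m hm
          have h2 : φ (n + m) = 0 := by
            by_contra h
            have h3 := hφ _ h
            have h4 : ‖n‖ ≤ ‖n + m‖ + ‖m‖ := by
              have := norm_sub_le (n + m) m
              rwa [add_sub_cancel_right] at this
            have h5 := (abs_le.1 hn).1
            linarith
          have h3 : (H w) (n + m) - z * w (n + m) = φ (n + m) := by
            rw [← hw]; rfl
          rw [h2] at h3
          exact sub_eq_zero.1 h3
        · intro k
          have h2 : ‖w (n + k)‖ = ‖w (n + k)‖ * Real.exp (g (n + k)) * Real.exp (-g (n + k)) := by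
            rw [mul_assoc, ← Real.exp_add]
            simp
          rw [h2, mul_assoc M₀, ← Real.exp_add]
          have h3 := hle (n + k)
          have h4 := hglip n k
          gcongr
          linarith
      calc _ ≤ M₀ * Real.exp (-g n) / 2 * Real.exp (g n) := by gcongr
        _ = M₀ / 2 * (Real.exp (-g n) * Real.exp (g n)) := by ring
        _ = M₀ / 2 := by rw [← Real.exp_add]; simp
    · apply le_max_of_le_left
      have h1 : g n = 0 := by
        simp only [hg]
        rw [max_eq_left (by linarith), mul_zero]
      rw [h1]
      simpa using hY n
  have hM : M₀ ≤ Y := by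
    have h1 : M₀ ≤ max Y (M₀ / 2) := ciSup_le hstep
    rcases le_max_iff.1 h1 with h2 | h2 <;> linarith
  have h1 : ‖w n‖ = ‖w n‖ * Real.exp (g n) * Real.exp (-g n) := by
    rw [mul_assoc, ← Real.exp_add]
    simp
  rw [h1]
  have h2 := (hle n).trans hM
  gcongr
  simp only [hg]
  rw [neg_mul]
  gcongr
  exact le_max_right _ _

/-- Decay of the resolvent outside a shell of good sites. -/
theorem norm_le_of_shell {d : ℕ} {A : (Fin d → ℤ) → (Fin d → ℤ) → ℂ}
    {C₁ c₁ c₂ σ₁ c : ℝ} (hC₁ : 0 < C₁) (hc : 0 < c) (hcc₁ : c ≤ c₁) (hcc₂ : c ≤ c₂)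
    (hA : IsKernel A C₁ c₁) {V : (Fin d → ℤ) → ℝ} {H : Hil d →L[ℂ] Hil d} (hH : ActsBy A V H)
    {z : ℂ} (hz : 0 < z.im) {w φ : Hil d} (hw : H w - z • w = φ) {N ρ : ℕ} {r₀ W : ℝ}
    (hφ : ∀ n, φ n ≠ 0 → ‖n‖ ≤ r₀) (hρ : r₀ + N < ρ - W) (hW : 0 ≤ W)
    (hgood : ∀ n : Fin d → ℤ, |‖n‖ - ρ| ≤ W → HasGreenRow A V σ₁ c₂ N z n)
    (hN : (2 * N + 1 : ℝ) ^ d * (3 * C₁ * Real.exp ((N : ℝ) ^ σ₁) * Real.exp (-(2 / 5 * c * N)) *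
      ∑' k : Fin d → ℤ, Real.exp (-(c / 4) * ‖k‖)) ≤ 1 / 2) (n : Fin d → ℤ) (hn : ρ ≤ ‖n‖) :
    ‖w n‖ ≤ z.im⁻¹ ^ 2 * ‖φ‖ * Real.exp (-(c / 4) * W) *
      (C₁ * (∑' k : Fin d → ℤ, Real.exp (-(c₁ / 4) * ‖k‖)) *
        ((4 * ρ + 1 : ℝ) ^ d + ∑' k : Fin d → ℤ, Real.exp (-(c₁ / 2) * ‖k‖))) := by
  classical
  have hc₁ : 0 < c₁ := hc.trans_le hcc₁
  have hself := hH.isSelfAdjoint hA.hermitian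
  set Y := z.im⁻¹ * ‖φ‖ with hYdef
  have hwY : ‖w‖ ≤ Y := by
    rw [hYdef, le_inv_mul_iff₀ hz, ← hw]
    exact im_mul_norm_le hself z w
  have hY0 : 0 ≤ Y := by positivity
  have hdecay := norm_le_exp_of_shell hC₁ hc hcc₁ hcc₂ hA hH hw hφ hρ hW hgood
    (fun n => (norm_coord_le w n).trans hwY) hN
  set S₁ := ∑' k : Fin d → ℤ, Real.exp (-(c₁ / 4) * ‖k‖) with hS₁
  set S₂ := ∑' k : Fin d → ℤ, Real.exp (-(c₁ / 2) * ‖k‖) with hS₂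
  have hS₁0 : 0 ≤ S₁ := tsum_nonneg fun _ => (Real.exp_pos _).le
  have hS₂0 : 0 ≤ S₂ := tsum_nonneg fun _ => (Real.exp_pos _).le
  -- P cuts off to ‖n‖ ≥ ρ. As φ vanishes there, (H - z)Pw is the commutator of H and P applied to
  -- w; it is concentrated near the middle sphere, where w is small.
  obtain ⟨P, -, hP⟩ := exists_mul_complex (d := d)
    (fun n => if (ρ : ℝ) ≤ ‖n‖ then (1 : ℂ) else 0) 1 (fun n => by
      split_ifs <;> simp)
  set β := C₁ * Y * Real.exp (-(c / 4) * W) * S₁ with hβ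
  have hβ0 : 0 ≤ β := by positivity
  set h : Hil d := H (P w) - z • P w with hh
  have hhn : ∀ m, ‖h m‖ ≤ β * Real.exp (-(c₁ / 2) * |‖m‖ - ρ|) := by
    intro m
    set χ : (Fin d → ℤ) → ℂ := fun n => if (ρ : ℝ) ≤ ‖n‖ then (1 : ℂ) else 0 with hχ
    have h1 := hH.hasSum (P w) m
    have h2 := (hH.hasSum w m).mul_left (χ m)
    have h3 := h1.sub h2
    have h4 : ((H (P w)) m - (V m : ℂ) * (P w) m)
        - χ m * ((H w) m - (V m : ℂ) * w m) = h m := by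
      have h5 : (H w) m - z * w m = φ m := by rw [← hw]; rfl
      have h6 : χ m * φ m = 0 := by
        by_cases hm : (ρ : ℝ) ≤ ‖m‖
        · have : φ m = 0 := by
            by_contra h0
            have h7 := hφ m h0
            have : (0 : ℝ) ≤ N := Nat.cast_nonneg _
            linarith
          rw [this, mul_zero]
        · simp [hχ, hm]
      have h7 : h m = (H (P w)) m - z * (P w) m := rfl
      have h8 : (P w) m = χ m * w m := hP w m
      rw [h7, h8]
      linear_combination -h6 - χ m * h5
    rw [h4] at h3
    have hs : Summable fun k : Fin d → ℤ => Real.exp (-(c₁ / 4) * ‖k‖) :=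
      summable_exp_norm (by positivity)
    have hs' : HasSum (fun k : Fin d → ℤ => Real.exp (-(c₁ / 4) * ‖k - m‖)) S₁ := by
      have := hs.hasSum
      rw [← (Equiv.subRight m).hasSum_iff] at this
      exact this
    have h9 := h3.norm_le_of_bounded (hs'.mul_left
      (C₁ * Y * Real.exp (-(c / 4) * W) * Real.exp (-(c₁ / 2) * |‖m‖ - ρ|))) (fun k => ?_)
    · refine h9.trans (le_of_eq ?_)
      rw [hβ]
      ring
    · have hk : A m k * (P w) k - χ m * (A m k * w k) = (χ k - χ m) * (A m k * w k) := by
        rw [show (P w) k = χ k * w k from hP w k]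
        ring
      rw [hk]
      by_cases hcross : χ k = χ m
      · rw [hcross, sub_self, zero_mul, norm_zero]
        positivity
      · have hcr : |‖m‖ - ρ| ≤ ‖k - m‖ ∧ |‖k‖ - ρ| ≤ ‖k - m‖ ∧ ‖χ k - χ m‖ ≤ 1 := by
          have h10 := abs_le.1 (abs_norm_sub_norm_le k m)
          simp only [hχ] at hcross ⊢
          by_cases hk1 : (ρ : ℝ) ≤ ‖k‖ <;> by_cases hm1 : (ρ : ℝ) ≤ ‖m‖
          · simp [hk1, hm1] at hcross
          · simp only [hk1, hm1, if_true, if_false]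
            push Not at hm1
            refine ⟨abs_le.2 ⟨?_, ?_⟩, abs_le.2 ⟨?_, ?_⟩, by simp⟩ <;> linarith
          · simp only [hk1, hm1, if_true, if_false]
            push Not at hk1
            refine ⟨abs_le.2 ⟨?_, ?_⟩, abs_le.2 ⟨?_, ?_⟩, by simp⟩ <;> linarith
          · simp [hk1, hm1] at hcross
        obtain ⟨hcr1, hcr2, hcr3⟩ := hcr
        have hAk := hA.decay m k
        rw [norm_sub_rev] at hAk
        have hwk := hdecay k
        rw [norm_mul, norm_mul]
        calc _ ≤ 1 * ((C₁ * Real.exp (-c₁ * ‖k - m‖)) *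
              (Y * Real.exp (-(c / 4) * (W - |‖k‖ - ρ|)))) := by gcongr
          _ = C₁ * Y * (Real.exp (-c₁ * ‖k - m‖) * Real.exp (-(c / 4) * (W - |‖k‖ - ρ|))) := by
              ring
          _ ≤ C₁ * Y * (Real.exp (-(c / 4) * W) * Real.exp (-(c₁ / 2) * |‖m‖ - ρ|)
              * Real.exp (-(c₁ / 4) * ‖k - m‖)) := by
              rw [← Real.exp_add, ← Real.exp_add, ← Real.exp_add]
              refine mul_le_mul_of_nonneg_left (Real.exp_le_exp.2 ?_) (by positivity)
              have h11 : c / 4 * |‖k‖ - ρ| ≤ c₁ / 4 * ‖k - m‖ := by gcongr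
              have h12 : c₁ / 2 * |‖m‖ - ρ| ≤ c₁ / 2 * ‖k - m‖ := by gcongr
              linarith
          _ = _ := by ring
  have hhnorm : ‖h‖ ^ 2 ≤ (β * ((4 * ρ + 1 : ℝ) ^ d + S₂)) ^ 2 := by
    have h1 := hil_norm_sq h
    -- Inside the cube of size 2ρ sites are merely counted; beyond it |‖m‖ - ρ| ≥ ‖m‖/2 and the
    -- exponential is summable.
    have h2 : HasSum (fun m => if m ∈ cube d (2 * ρ) then (1 : ℝ) else 0)
        (∑ _m ∈ cube d (2 * ρ), (1 : ℝ)) := by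
      rw [← Finset.sum_congr rfl fun k hk => if_pos hk]
      exact hasSum_sum_of_ne_finset_zero fun k hk => if_neg hk
    have h3 : Summable fun k : Fin d → ℤ => Real.exp (-(c₁ / 2) * ‖k‖) :=
      summable_exp_norm (by positivity)
    have h4 := (h2.add h3.hasSum).mul_left (β ^ 2)
    have h5 : ‖h‖ ^ 2 ≤ β ^ 2 * (∑ _m ∈ cube d (2 * ρ), (1 : ℝ) + S₂) := by
      refine hasSum_le (fun m => ?_) h1 h4
      calc ‖h m‖ ^ 2 ≤ (β * Real.exp (-(c₁ / 2) * |‖m‖ - ρ|)) ^ 2 := by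
            gcongr
            exact hhn m
        _ = β ^ 2 * Real.exp (-c₁ * |‖m‖ - ρ|) := by
            rw [mul_pow, ← Real.exp_nat_mul]
            congr 2
            push_cast
            ring
        _ ≤ _ := by
            gcongr
            by_cases hm : m ∈ cube d (2 * ρ)
            · rw [if_pos hm]
              have : Real.exp (-c₁ * |‖m‖ - ρ|) ≤ 1 := by
                apply Real.exp_le_one_iff.2
                have := mul_nonneg hc₁.le (abs_nonneg (‖m‖ - ρ))
                linarith
              linarith [Real.exp_pos (-(c₁ / 2) * ‖m‖)]
            · rw [if_neg hm, zero_add]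
              apply Real.exp_le_exp.2
              have hm' : 2 * (ρ : ℝ) < ‖m‖ := by
                have := not_le.1 fun h => hm ((mem_cube_iff _).2 h)
                push_cast at this
                exact this
              have : ‖m‖ / 2 ≤ |‖m‖ - ρ| := le_trans (by linarith) (le_abs_self _)
              nlinarith
    have h6 : ∑ _m ∈ cube d (2 * ρ), (1 : ℝ) = (4 * ρ + 1 : ℝ) ^ d := by
      rw [Finset.sum_const, card_cube, nsmul_eq_mul, mul_one]
      push_cast
      ring
    rw [h6] at h5
    refine h5.trans ?_
    rw [mul_pow β]
    have h7 : 1 ≤ (4 * ρ + 1 : ℝ) ^ d + S₂ := by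
      have : 1 ≤ (4 * ρ + 1 : ℝ) ^ d := one_le_pow₀ (by
        have : (0 : ℝ) ≤ ρ := Nat.cast_nonneg _
        linarith)
      linarith
    exact mul_le_mul_of_nonneg_left (by nlinarith) (sq_nonneg β)
  have hh' : ‖h‖ ≤ β * ((4 * ρ + 1 : ℝ) ^ d + S₂) :=
    (pow_le_pow_iff_left₀ (norm_nonneg _) (by positivity) two_ne_zero).1 hhnorm
  have hPw : z.im * ‖P w‖ ≤ ‖h‖ := im_mul_norm_le hself z (P w)
  have hPn : (P w) n = w n := by
    rw [hP]
    simp [hn]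
  calc ‖w n‖ ≤ ‖P w‖ := by
        rw [← hPn]
        exact norm_coord_le _ _
    _ ≤ z.im⁻¹ * ‖h‖ := by rwa [le_inv_mul_iff₀ hz]
    _ ≤ z.im⁻¹ * (β * ((4 * ρ + 1 : ℝ) ^ d + S₂)) := by gcongr
    _ = _ := by
        rw [hβ, hYdef]
        ring

/-- Among many disjoint shells one avoids a given small set. -/
theorem exists_shell_avoiding {E : Type*} [Norm E] {s : Set E} (hs : s.Finite) {m : ℕ}
    (hm : s.ncard ≤ m) (r W : ℕ) :
    ∃ j ≤ m, ∀ n ∈ s, ¬ |‖n‖ - ((r + j * (2 * W + 1) + W : ℕ) : ℝ)| ≤ W := by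
  by_contra! hcon
  obtain ⟨n₀, -, -⟩ := hcon 0 (Nat.zero_le _)
  have : Nonempty E := ⟨n₀⟩
  choose! e he1 he2 using hcon
  have hinj : Set.InjOn e (Finset.range (m + 1) : Set ℕ) := by
    -- Shells of half-width W with centers 2W + 1 apart are disjoint, so m + 1 shells that are all
    -- hit would give m + 1 points of the set.
    have key : ∀ i ≤ m, ∀ j ≤ m, i < j → e i ≠ e j := by
      intro i hi j hj hij heq
      have h1 := (abs_le.1 (he2 i hi)).2
      have h2 := (abs_le.1 (he2 j hj)).1
      rw [heq] at h1
      push_cast at h1 h2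
      have h3 : (i : ℝ) + 1 ≤ j := by exact_mod_cast hij
      have h4 : (0 : ℝ) ≤ W := Nat.cast_nonneg _
      nlinarith
    intro i hi j hj heq
    have hi' := Nat.lt_succ_iff.1 (Finset.mem_range.1 hi)
    have hj' := Nat.lt_succ_iff.1 (Finset.mem_range.1 hj)
    rcases lt_trichotomy i j with h | h | h
    · exact absurd heq (key i hi' j hj' h)
    · exact h
    · exact absurd heq.symm (key j hj' i hi' h)
  have h1 := Set.ncard_le_ncard_of_injOn (s := (Finset.range (m + 1) : Set ℕ)) (t := s) e
    (fun i hi => he1 i (Nat.lt_succ_iff.1 (Finset.mem_range.1 hi))) hinj hs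
  rw [Set.ncard_coe_finset, Finset.card_range] at h1
  lia

/-- Pigeonhole over m + 1 shells inside the cube of size L. Starting them at r > r₀ + N keeps every
Green's cube off the support of φ. -/
theorem norm_resolvent_le_of_ncard_le {d : ℕ} {A : (Fin d → ℤ) → (Fin d → ℤ) → ℂ}
    {C₁ c₁ c₂ σ₁ c : ℝ} (hC₁ : 0 < C₁) (hc : 0 < c) (hcc₁ : c ≤ c₁) (hcc₂ : c ≤ c₂)
    (hA : IsKernel A C₁ c₁) {V : (Fin d → ℤ) → ℝ} {H : Hil d →L[ℂ] Hil d} (hH : ActsBy A V H)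
    {z : ℂ} (hz : 0 < z.im) {w φ : Hil d} (hw : H w - z • w = φ) {N L W m r : ℕ} {r₀ : ℝ}
    (hφ : ∀ n, φ n ≠ 0 → ‖n‖ ≤ r₀) (hr : r₀ + N < r) (hL : r + (m + 1) * (2 * W + 1) ≤ L)
    (hcard : {n : Fin d → ℤ | n ∈ cube d L ∧ ¬ HasGreenRow A V σ₁ c₂ N z n}.ncard ≤ m)
    (hN : (2 * N + 1 : ℝ) ^ d * (3 * C₁ * Real.exp ((N : ℝ) ^ σ₁) * Real.exp (-(2 / 5 * c * N)) *
      ∑' k : Fin d → ℤ, Real.exp (-(c / 4) * ‖k‖)) ≤ 1 / 2) (n : Fin d → ℤ) (hn : L ≤ ‖n‖) :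
    ‖w n‖ ≤ z.im⁻¹ ^ 2 * ‖φ‖ * Real.exp (-(c / 4) * W) *
      (C₁ * (∑' k : Fin d → ℤ, Real.exp (-(c₁ / 4) * ‖k‖)) *
        ((4 * L + 1 : ℝ) ^ d + ∑' k : Fin d → ℤ, Real.exp (-(c₁ / 2) * ‖k‖))) := by
  have hfin : {n : Fin d → ℤ | n ∈ cube d L ∧ ¬ HasGreenRow A V σ₁ c₂ N z n}.Finite :=
    (Finset.finite_toSet (cube d L)).subset fun n hn => hn.1
  obtain ⟨j, hj, havoid⟩ := exists_shell_avoiding hfin hcard r W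
  set ρ : ℕ := r + j * (2 * W + 1) + W with hρ
  have hρL : ρ + W ≤ L := by nlinarith
  have hρL' : (ρ : ℝ) + W ≤ L := by exact_mod_cast hρL
  have hρr : (r : ℝ) ≤ ρ - W := by
    rw [hρ]
    push_cast
    have : (0 : ℝ) ≤ j * (2 * W + 1) := by positivity
    linarith
  have hW : (0 : ℝ) ≤ W := Nat.cast_nonneg _
  have h1 := norm_le_of_shell (W := W) hC₁ hc hcc₁ hcc₂ hA hH hz hw hφ (ρ := ρ)
    (by linarith) hW (fun n hn => by
      by_contra hbad
      refine havoid n ⟨(mem_cube_iff _).2 ?_, hbad⟩ hn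
      have := (abs_le.1 hn).2
      linarith) hN n (by linarith)
  refine h1.trans ?_
  have hS : 0 ≤ ∑' k : Fin d → ℤ, Real.exp (-(c₁ / 4) * ‖k‖) :=
    tsum_nonneg fun _ => (Real.exp_pos _).le
  have hle : (ρ : ℝ) ≤ L := by linarith
  gcongr

/-! ### From resolvent bounds to moments. -/

/-- With E = -2πξ, both energy ranges are dominated by a multiple of 1/(1 + ξ²), whose integral is
π. The factor e is exp(t/T) at t = T. -/
theorem norm_evolution_le_of_resolvent {d : ℕ} {H : Hil d →L[ℂ] Hil d} (hH : IsSelfAdjoint H)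
    (φ : Hil d) {T K β γ : ℝ} (hT : 0 < T) (hK : 1 ≤ K) (hβ : 0 ≤ β) (hγ : 0 ≤ γ)
    (n : Fin d → ℤ)
    (hin : ∀ E : ℝ, |E| ≤ K → ∀ w : Hil d,
      H w - ((E : ℂ) + ((1 / T : ℝ) : ℂ) * Complex.I) • w = -Complex.I • φ → ‖w n‖ ≤ β)
    (hout : ∀ E : ℝ, K ≤ |E| → ∀ w : Hil d,
      H w - ((E : ℂ) + ((1 / T : ℝ) : ℂ) * Complex.I) • w = -Complex.I • φ →
      ‖w n‖ ≤ γ / E ^ 2) :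
    ‖(NormedSpace.exp ((-(Complex.I * (T : ℂ))) • H) φ) n‖
      ≤ Real.exp 1 * Real.pi * (β * (1 + K ^ 2) + 2 * γ) := by
  have h := norm_evolution_le hH φ hT hT n
    (fun ξ => (β * (1 + K ^ 2) + 2 * γ) * (1 + ξ ^ 2)⁻¹) (integrable_inv_one_add_sq.const_mul _) ?_
  · rw [MeasureTheory.integral_const_mul, integral_univ_inv_one_add_sq, div_self hT.ne'] at h
    linarith
  · intro ξ w hw
    have hπ : 1 ≤ 2 * Real.pi := by linarith [Real.pi_gt_three]
    have hξ : ξ ^ 2 ≤ (-(2 * Real.pi * ξ)) ^ 2 := by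
      have : (1 : ℝ) ≤ (2 * Real.pi) ^ 2 := one_le_pow₀ hπ
      nlinarith [sq_nonneg ξ]
    have hpos : 0 < 1 + ξ ^ 2 := by positivity
    rw [← div_eq_mul_inv, le_div_iff₀ hpos]
    rcases le_total |-(2 * Real.pi * ξ)| K with hE | hE
    · have h1 := hin _ hE w hw
      have h2 : (-(2 * Real.pi * ξ)) ^ 2 ≤ K ^ 2 := by
        rw [← sq_abs]
        gcongr
      calc ‖w n‖ * (1 + ξ ^ 2) ≤ β * (1 + K ^ 2) :=
            mul_le_mul h1 (by linarith) hpos.le hβ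
        _ ≤ _ := by linarith
    · have h1 := hout _ hE w hw
      have h2 : 1 ≤ (-(2 * Real.pi * ξ)) ^ 2 := by
        rw [← sq_abs]
        exact one_le_pow₀ (hK.trans hE)
      set E2 := (-(2 * Real.pi * ξ)) ^ 2 with hE2
      calc ‖w n‖ * (1 + ξ ^ 2) ≤ γ / E2 * (E2 + E2) := by
            gcongr
        _ = 2 * γ := by field_simp; ring
        _ ≤ _ := by
            have : 0 ≤ β * (1 + K ^ 2) := by positivity
            linarith

theorem summable_rpow_mul_exp {d : ℕ} {a p : ℝ} (ha : 0 < a) (hp : 0 ≤ p) :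
    Summable fun n : Fin d → ℤ => ‖n‖ ^ p * Real.exp (-a * ‖n‖) := by
  set k := ⌈p⌉₊ with hk
  refine Summable.of_nonneg_of_le (fun n => by positivity) (fun n => ?_)
    ((summable_exp_norm (d := d) (half_pos ha)).mul_left (1 + (2 / a) ^ k * k.factorial))
  have hx : 0 ≤ ‖n‖ := norm_nonneg n
  have h1 : ‖n‖ ^ p ≤ 1 + ‖n‖ ^ k := by
    rcases le_total ‖n‖ 1 with h | h
    · have := Real.rpow_le_one hx h hp
      have : 0 ≤ ‖n‖ ^ k := by positivity
      linarith
    · have : ‖n‖ ^ p ≤ ‖n‖ ^ (k : ℝ) := Real.rpow_le_rpow_of_exponent_le h (Nat.le_ceil p)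
      rw [Real.rpow_natCast] at this
      linarith
  have h2 : ‖n‖ ^ k ≤ (2 / a) ^ k * k.factorial * Real.exp (a / 2 * ‖n‖) := by
    have h3 := Real.pow_div_factorial_le_exp (x := a / 2 * ‖n‖) (by positivity) k
    rw [div_le_iff₀ (by positivity)] at h3
    calc ‖n‖ ^ k = (2 / a) ^ k * (a / 2 * ‖n‖) ^ k := by
          rw [← mul_pow]
          congr 1
          field_simp
      _ ≤ (2 / a) ^ k * (Real.exp (a / 2 * ‖n‖) * k.factorial) := by gcongr
      _ = _ := by ring
  have h4 : 1 ≤ Real.exp (a / 2 * ‖n‖) := Real.one_le_exp (by positivity)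
  calc ‖n‖ ^ p * Real.exp (-a * ‖n‖)
      ≤ ((1 + (2 / a) ^ k * k.factorial) * Real.exp (a / 2 * ‖n‖)) * Real.exp (-a * ‖n‖) := by
        gcongr
        linarith
    _ = (1 + (2 / a) ^ k * k.factorial) * (Real.exp (a / 2 * ‖n‖) * Real.exp (-a * ‖n‖)) := by
        ring
    _ = _ := by
        rw [← Real.exp_add]
        congr 2
        ring

theorem moment_le_of_hasSum {d : ℕ} {H : Hil d →L[ℂ] Hil d} {φ : Hil d} {p t : ℝ}
    {g : (Fin d → ℤ) → ℝ} {s : ℝ} (hg : HasSum g s)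
    (h : ∀ n, ‖n‖ ^ p * ‖(NormedSpace.exp ((-(Complex.I * (t : ℂ))) • H) φ) n‖ ^ 2 ≤ g n) :
    moment H φ p t ≤ ENNReal.ofReal s := by
  have hg0 : ∀ n, 0 ≤ g n := fun n => le_trans (by positivity) (h n)
  rw [moment, ← hg.tsum_eq, ENNReal.ofReal_tsum_of_nonneg hg0 hg.summable]
  exact ENNReal.tsum_le_tsum fun n => ENNReal.ofReal_le_ofReal (h n)

/-- A priori bound on the moments from exponential localization. -/
theorem moment_le_of_exp_decay {d : ℕ} {H : Hil d →L[ℂ] Hil d} {φ : Hil d} {p t a C : ℝ}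
    (hp : 0 ≤ p) (ha : 0 < a)
    (h : ∀ n, ‖(NormedSpace.exp ((-(Complex.I * (t : ℂ))) • H) φ) n‖
      ≤ C * Real.exp (-a * ‖n‖)) :
    moment H φ p t
      ≤ ENNReal.ofReal (C ^ 2 * ∑' n : Fin d → ℤ, ‖n‖ ^ p * Real.exp (-a * ‖n‖)) := by
  refine moment_le_of_hasSum ((summable_rpow_mul_exp ha hp).hasSum.mul_left (C ^ 2)) fun n => ?_
  have h1 : Real.exp (-a * ‖n‖) ^ 2 ≤ Real.exp (-a * ‖n‖) := by
    have : Real.exp (-a * ‖n‖) ≤ 1 := Real.exp_le_one_iff.2 (by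
      have := mul_nonneg ha.le (norm_nonneg n)
      linarith)
    nlinarith [Real.exp_pos (-a * ‖n‖)]
  calc _ ≤ ‖n‖ ^ p * (C * Real.exp (-a * ‖n‖)) ^ 2 := by
        gcongr
        exact h n
    _ = ‖n‖ ^ p * (C ^ 2 * Real.exp (-a * ‖n‖) ^ 2) := by ring
    _ ≤ ‖n‖ ^ p * (C ^ 2 * Real.exp (-a * ‖n‖)) := by gcongr
    _ = _ := by ring

/-- Bound on the moments when the evolution is small in the annulus `L ≤ ‖n‖ ≤ D` and
exponentially localized outside. -/
theorem moment_le_of_annulus {d : ℕ} {H : Hil d →L[ℂ] Hil d} (hH : IsSelfAdjoint H) {φ : Hil d}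
    {p t a C γ : ℝ} {L D : ℕ} (hp : 0 ≤ p) (ha : 0 < a)
    (h : ∀ n, ‖(NormedSpace.exp ((-(Complex.I * (t : ℂ))) • H) φ) n‖
      ≤ C * Real.exp (-a * ‖n‖))
    (hann : ∀ n : Fin d → ℤ, L ≤ ‖n‖ →
      ‖(NormedSpace.exp ((-(Complex.I * (t : ℂ))) • H) φ) n‖ ≤ γ) :
    moment H φ p t ≤ ENNReal.ofReal ((L : ℝ) ^ p * ‖φ‖ ^ 2
      + (2 * D + 1 : ℝ) ^ d * ((D : ℝ) ^ p * γ ^ 2)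
      + C ^ 2 * Real.exp (-a * D) * ∑' n : Fin d → ℤ, ‖n‖ ^ p * Real.exp (-a * ‖n‖)) := by
  classical
  set ψ := NormedSpace.exp ((-(Complex.I * (t : ℂ))) • H) φ with hψ
  have hs1 := (hil_norm_sq ψ).mul_left ((L : ℝ) ^ p)
  have hs2 : HasSum (fun n => if n ∈ cube d D then (D : ℝ) ^ p * γ ^ 2 else 0)
      (∑ _n ∈ cube d D, (D : ℝ) ^ p * γ ^ 2) := by
    rw [← Finset.sum_congr rfl fun k hk => if_pos hk]
    exact hasSum_sum_of_ne_finset_zero fun k hk => if_neg hk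
  have hs3 := (summable_rpow_mul_exp (d := d) ha hp).hasSum.mul_left (C ^ 2 * Real.exp (-a * D))
  refine (moment_le_of_hasSum ((hs1.add hs2).add hs3) fun n => ?_).trans ?_
  · have h1 : 0 ≤ (L : ℝ) ^ p * ‖ψ n‖ ^ 2 := by positivity
    have h2 : 0 ≤ if n ∈ cube d D then (D : ℝ) ^ p * γ ^ 2 else 0 := by
      split_ifs <;> positivity
    have h3 : 0 ≤ C ^ 2 * Real.exp (-a * D) * (‖n‖ ^ p * Real.exp (-a * ‖n‖)) := by positivity
    change ‖n‖ ^ p * ‖ψ n‖ ^ 2 ≤ _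
    rcases le_total ‖n‖ (L : ℝ) with hn | hn
    · have : ‖n‖ ^ p * ‖ψ n‖ ^ 2 ≤ (L : ℝ) ^ p * ‖ψ n‖ ^ 2 := by gcongr
      linarith
    · by_cases hD : n ∈ cube d D
      · have h4 := hann n hn
        have h5 := (mem_cube_iff _).1 hD
        rw [if_pos hD] at h2 ⊢
        have : ‖n‖ ^ p * ‖ψ n‖ ^ 2 ≤ (D : ℝ) ^ p * γ ^ 2 := by gcongr
        linarith
      · have h5 : (D : ℝ) < ‖n‖ := not_le.1 fun h => hD ((mem_cube_iff _).2 h)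
        have h6 : ‖n‖ ^ p * ‖ψ n‖ ^ 2
            ≤ C ^ 2 * Real.exp (-a * D) * (‖n‖ ^ p * Real.exp (-a * ‖n‖)) := by
          calc _ ≤ ‖n‖ ^ p * (C * Real.exp (-a * ‖n‖)) ^ 2 := by
                gcongr
                exact h n
            _ = C ^ 2 * Real.exp (-a * ‖n‖) * (‖n‖ ^ p * Real.exp (-a * ‖n‖)) := by ring
            _ ≤ _ := by
                have : Real.exp (-a * ‖n‖) ≤ Real.exp (-a * D) := by
                  apply Real.exp_le_exp.2
                  nlinarith
                gcongr
        linarith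
  · apply ENNReal.ofReal_le_ofReal
    rw [Finset.sum_const, card_cube, nsmul_eq_mul]
    push_cast
    have := norm_exp_smul_apply_le hH t φ
    gcongr

/-! ### The range of δ and the asymptotic choice of scales. -/

/-- The sublinear bound fails for `δ > 1`, because points are semi-algebraic. -/
theorem SublinearBound.delta_le_one {d b : ℕ} (hb : 1 ≤ b)
    {f : (Fin d → ℤ) → Torus b → Torus b} {x : Torus b} {δ C₂ C₃ : ℝ} (hC₃ : 0 < C₃)
    (h : SublinearBound f x δ C₂ C₃) : δ ≤ 1 := by
  by_contra! hδ
  obtain ⟨y, hy, hyx⟩ := exists_toTorus_eq (f 0 x)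
  have hsemi : IsSemialgebraicOfDegreeLE ({y} : Set (Fin b → ℝ)) b := by
    refine ⟨b, 1, fun i => MvPolynomial.X i - MvPolynomial.C (y i), 1, fun _ => Finset.univ,
      fun _ _ => .zero, by simp, fun i => ?_, ?_⟩
    · refine (MvPolynomial.totalDegree_sub _ _).trans ?_
      simp
    · ext u
      simp [sub_eq_zero, funext_iff]
  have hvol : MeasureTheory.volume ({y} : Set (Fin b → ℝ)) = 0 := by
    have : Nonempty (Fin b) := ⟨⟨0, hb⟩⟩
    exact MeasureTheory.measure_singleton y
  -- The point f⁰x is visited by n = 0 in every cube, while for δ > 1 the allowed number of visits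
  -- tends to 0.
  have h1 : ∀ᶠ N : ℕ in Filter.atTop, C₂ * (N : ℝ) ^ (1 - δ) < 1 := by
    have h2 : Filter.Tendsto (fun N : ℕ => C₂ * (N : ℝ) ^ (1 - δ)) Filter.atTop (nhds (C₂ * 0)) := by
      have := (tendsto_rpow_neg_atTop (y := δ - 1) (by linarith)).comp
        tendsto_natCast_atTop_atTop
      simp only [neg_sub] at this
      exact this.const_mul C₂
    rw [mul_zero] at h2
    exact h2.eventually_lt_const one_pos
  have h2 : ∀ᶠ N : ℕ in Filter.atTop, Real.log b ≤ C₃ * Real.log N :=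
    ((Real.tendsto_log_atTop.comp tendsto_natCast_atTop_atTop).const_mul_atTop
      hC₃).eventually_ge_atTop _
  obtain ⟨N, hN1, hN2, hN3⟩ := (h1.and (h2.and (Filter.eventually_ge_atTop 1))).exists
  have hN : (1 : ℝ) ≤ N := by exact_mod_cast hN3
  have h3 := h b (1 / (2 * N)) {y} hb (by positivity) hsemi (by simpa using hy)
    (by rw [hvol]; simpa using by linarith) N hN3 hN2 (by
      rw [one_div_one_div]
      exact Real.log_lt_log (by linarith) (by linarith))
  have h4 : 1 ≤ {n : Fin d → ℤ | n ∈ cube d N ∧ f n x ∈ toTorus '' {y}}.ncard := by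
    refine (Set.ncard_pos ((Finset.finite_toSet (cube d N)).subset fun n hn => hn.1)).2 ?_
    exact ⟨0, (mem_cube_iff _).2 (by simp), y, rfl, hyx⟩
  have h5 : (1 : ℝ) ≤ _ := (Nat.one_le_cast.2 h4).trans h3
  linarith

theorem eventually_mul_rpow_le_exp (C s : ℝ) {a : ℝ} (ha : 0 < a) :
    ∀ᶠ x : ℝ in Filter.atTop, C * x ^ s ≤ Real.exp (a * x) := by
  filter_upwards [((isLittleO_rpow_exp_pos_mul_atTop s ha).const_mul_left C).bound one_pos]
    with x hx
  rw [one_mul, Real.norm_eq_abs, Real.norm_eq_abs, Real.abs_exp] at hx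
  exact (le_abs_self _).trans hx

theorem eventually_mul_pow_le_exp (C : ℝ) (m : ℕ) {a : ℝ} (ha : 0 < a) :
    ∀ᶠ N : ℕ in Filter.atTop, C * (N : ℝ) ^ m ≤ Real.exp (a * N) := by
  filter_upwards [tendsto_natCast_atTop_atTop.eventually (eventually_mul_rpow_le_exp C m ha)]
    with N hN
  rwa [Real.rpow_natCast] at hN

theorem eventually_mul_rpow_le_rpow (C : ℝ) {s s' : ℝ} (h : s < s') :
    ∀ᶠ x : ℝ in Filter.atTop, C * x ^ s ≤ x ^ s' := by
  filter_upwards [(tendsto_rpow_atTop (sub_pos.2 h)).eventually_ge_atTop C,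
    Filter.eventually_gt_atTop 0] with x hx hx0
  calc C * x ^ s ≤ x ^ (s' - s) * x ^ s := by gcongr
    _ = x ^ s' := by rw [← Real.rpow_add hx0]; congr 1; ring

/-- Degree count for the semi-algebraic approximation at scale `N`. -/
theorem eventually_degree_le (b d ρ κ' : ℕ) :
    ∀ᶠ N : ℕ in Filter.atTop,
      (ρ * (1 + N) ^ κ') ^ b * (b + (2 * N + 1) ^ d * (2 * N + 1) ^ d) *
        (2 * ((2 * N + 1) ^ d * N ^ 2) + 2) ≤ N ^ (κ' * b + (d + d) + (d + 2) + 1) := by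
  filter_upwards [Filter.eventually_ge_atTop 1,
    Filter.eventually_ge_atTop
      ((ρ * 2 ^ κ') ^ b * (b + 3 ^ d * 3 ^ d) * (2 * 3 ^ d + 2))] with N h1 hN
  have h2 : 1 + N ≤ 2 * N := by omega
  have h3 : 2 * N + 1 ≤ 3 * N := by omega
  have hb : b ≤ b * N ^ (d + d) := Nat.le_mul_of_pos_right _ (by positivity)
  have h4 : 2 ≤ 2 * N ^ (d + 2) := Nat.le_mul_of_pos_right _ (by positivity)
  calc _ ≤ (ρ * (2 * N) ^ κ') ^ b * (b * N ^ (d + d) + (3 * N) ^ d * (3 * N) ^ d) *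
        (2 * ((3 * N) ^ d * N ^ 2) + 2 * N ^ (d + 2)) := by gcongr
    _ = ((ρ * 2 ^ κ') ^ b * (b + 3 ^ d * 3 ^ d) * (2 * 3 ^ d + 2)) *
        N ^ (κ' * b + (d + d) + (d + 2)) := by
        simp only [mul_pow, pow_add, pow_mul]
        ring
    _ ≤ N * N ^ (κ' * b + (d + d) + (d + 2)) := by gcongr
    _ = _ := by ring

/-- Taylor degree N² makes the remainder about 2^(-N²), which beats every exponential in N; the
degree stays polynomial in N. -/
theorem eventually_taylor_remainder_lt (d : ℕ) (c₂ : ℝ) {M : ℝ} (hM : 0 < M) :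
    ∀ᶠ N : ℕ in Filter.atTop,
      8 * ((2 * N + 1) ^ d : ℕ) * Real.exp N ^ 2 *
        (M * ((N ^ 2 : ℕ) + 1) * (1 / 2) ^ (N ^ 2 + 1)) < Real.exp (-(2 * c₂ * N)) := by
  have hlog : 0 < Real.log 2 := Real.log_pos one_lt_two
  filter_upwards [Filter.eventually_ge_atTop 1,
    eventually_mul_pow_le_exp (8 * 3 ^ d * M * 2) (d + 2) one_pos,
    tendsto_natCast_atTop_atTop.eventually_ge_atTop ((3 + 2 * c₂) / Real.log 2)] with N h1 h2 h3
  have hN : (1 : ℝ) ≤ N := by exact_mod_cast h1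
  rw [div_le_iff₀ hlog] at h3
  have h4 : ((2 * N + 1 : ℕ) : ℝ) ≤ 3 * N := by push_cast; linarith
  have h5 : ((N ^ 2 : ℕ) : ℝ) + 1 ≤ 2 * N ^ 2 := by
    push_cast
    nlinarith
  have h6 : (1 / 2 : ℝ) ^ (N ^ 2 + 1) < Real.exp (-((3 + 2 * c₂) * N)) := by
    rw [← Real.exp_log (show (0 : ℝ) < (1 / 2) ^ (N ^ 2 + 1) by positivity), Real.log_pow,
      one_div, Real.log_inv]
    apply Real.exp_lt_exp.2
    push_cast
    nlinarith
  have h7 : 8 * (((2 * N + 1) ^ d : ℕ) : ℝ) * (M * ((N ^ 2 : ℕ) + 1)) ≤ Real.exp N := by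
    rw [one_mul] at h2
    refine le_trans ?_ h2
    rw [Nat.cast_pow]
    calc 8 * ((2 * N + 1 : ℕ) : ℝ) ^ d * (M * ((N ^ 2 : ℕ) + 1))
        ≤ 8 * (3 * N : ℝ) ^ d * (M * (2 * N ^ 2)) := by gcongr
      _ = _ := by rw [mul_pow, pow_add]; ring
  calc _ = (8 * (((2 * N + 1) ^ d : ℕ) : ℝ) * (M * ((N ^ 2 : ℕ) + 1))) * Real.exp N ^ 2 *
        (1 / 2) ^ (N ^ 2 + 1) := by ring
    _ ≤ Real.exp N * Real.exp N ^ 2 * (1 / 2) ^ (N ^ 2 + 1) := by gcongr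
    _ < Real.exp N * Real.exp N ^ 2 * Real.exp (-((3 + 2 * c₂) * N)) := by gcongr
    _ = _ := by
        rw [← Real.exp_nat_mul, ← Real.exp_add, ← Real.exp_add]
        congr 1
        push_cast
        ring

theorem eventually_log_lt_rpow {σ : ℝ} (hσ : 0 < σ) (q : ℕ) :
    ∀ᶠ N : ℕ in Filter.atTop, Real.log (((N : ℝ) + 1) ^ q) < (N : ℝ) ^ σ - Real.log 2 := by
  have h1 : ∀ᶠ x : ℝ in Filter.atTop, (q + 1 : ℝ) * Real.log x ≤ x ^ σ / 2 := by
    filter_upwards [((isLittleO_log_rpow_atTop hσ).const_mul_left (q + 1 : ℝ)).bound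
      (half_pos one_pos), Filter.eventually_gt_atTop 0] with x hx hx0
    rw [Real.norm_eq_abs, Real.norm_eq_abs, abs_of_pos (Real.rpow_pos_of_pos hx0 _)] at hx
    linarith [le_abs_self ((q + 1 : ℝ) * Real.log x)]
  filter_upwards [tendsto_natCast_atTop_atTop.eventually h1, Filter.eventually_ge_atTop 2,
    ((tendsto_rpow_atTop hσ).comp tendsto_natCast_atTop_atTop).eventually_gt_atTop
      (2 * ((q + 1) * Real.log 2))] with N hN h2 h3
  have hN2 : (2 : ℝ) ≤ N := by exact_mod_cast h2
  have h4 : Real.log ((N : ℝ) + 1) ≤ Real.log 2 + Real.log N := by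
    rw [← Real.log_mul (by norm_num) (by positivity)]
    exact Real.log_le_log (by positivity) (by linarith)
  have h5 : 0 ≤ Real.log N := Real.log_nonneg (by linarith)
  simp only [Function.comp_apply] at h3
  rw [Real.log_pow]
  have h6 : (q : ℝ) * Real.log ((N : ℝ) + 1) ≤ q * (Real.log 2 + Real.log N) := by gcongr
  nlinarith

theorem eventually_resolvent_sum_le (d : ℕ) {σ₁ c : ℝ} (hσ₁ : σ₁ < 1) (hc : 0 < c) {D : ℝ}
    (hD : 0 ≤ D) :
    ∀ᶠ N : ℕ in Filter.atTop, (2 * N + 1 : ℝ) ^ d *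
      (D * Real.exp ((N : ℝ) ^ σ₁) * Real.exp (-(2 / 5 * c * N))) ≤ 1 / 2 := by
  filter_upwards [Filter.eventually_ge_atTop 1,
    eventually_mul_pow_le_exp (2 * 3 ^ d * D) d (a := c / 5) (by positivity),
    tendsto_natCast_atTop_atTop.eventually
      (eventually_mul_rpow_le_rpow (5 / c) hσ₁)] with N h1 h2 h3
  have hN : (1 : ℝ) ≤ N := by exact_mod_cast h1
  rw [Real.rpow_one, div_mul_eq_mul_div, div_le_iff₀ hc] at h3
  have h4 : Real.exp ((N : ℝ) ^ σ₁) ≤ Real.exp (c / 5 * N) := Real.exp_le_exp.2 (by linarith)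
  calc _ ≤ (3 * N : ℝ) ^ d * (D * Real.exp (c / 5 * N) * Real.exp (-(2 / 5 * c * N))) := by
        gcongr
        linarith
    _ = 1 / 2 * (2 * 3 ^ d * D * (N : ℝ) ^ d) *
        (Real.exp (c / 5 * N) * Real.exp (-(2 / 5 * c * N))) := by rw [mul_pow]; ring
    _ ≤ 1 / 2 * Real.exp (c / 5 * N) *
        (Real.exp (c / 5 * N) * Real.exp (-(2 / 5 * c * N))) := by gcongr
    _ = 1 / 2 := by
        rw [mul_assoc, ← Real.exp_add, ← Real.exp_add]
        ring_nf
        simp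

theorem exists_pow_le_lt_succ_pow {q : ℕ} (hq : q ≠ 0) (L : ℕ) :
    ∃ N : ℕ, N ^ q ≤ L ∧ L < (N + 1) ^ q := by
  have h : ∃ N : ℕ, L < (N + 1) ^ q :=
    ⟨L, (Nat.lt_succ_self L).trans_le (Nat.le_self_pow hq _)⟩
  classical
  refine ⟨Nat.find h, ?_, Nat.find_spec h⟩
  rcases hN : Nat.find h with _ | k
  · simp [hq]
  · exact not_lt.1 (Nat.find_min h (m := k) (by omega))

/-- For a large size `L` there is a scale `N ≤ √L` at which the large deviation theorem and the
sublinear bound apply, and at which the decay of the Green's function beats all other factors. -/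
theorem eventually_exists_scale (d b : ℕ) {K σ₁ σ₂ δ ε₀ c₁ c₂ c C₁ C₂ C₃ M R κ : ℝ}
    (N₀ : ℕ) (hσ₁ : σ₁ < 1) (hσ₂ : 0 < σ₂) (hc : 0 < c) (hc₂ : 0 < c₂) (hC₁ : 0 < C₁)
    (hC₃ : 0 < C₃) (hM : 0 < M) (hR : 0 < R) :
    ∀ᶠ L : ℕ in Filter.atTop, ∃ N : ℕ, N ^ 2 ≤ L ∧
      (2 * N + 1 : ℝ) ^ d * (3 * C₁ * Real.exp ((N : ℝ) ^ σ₁) * Real.exp (-(2 / 5 * c * N)) *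
        ∑' k : Fin d → ℤ, Real.exp (-(c / 4) * ‖k‖)) ≤ 1 / 2 ∧
      ∀ (A : (Fin d → ℤ) → (Fin d → ℤ) → ℂ) (v : Torus b → ℝ)
        (f : (Fin d → ℤ) → Torus b → Torus b), IsKernel A C₁ c₁ →
        (∀ m n x, f (m + n) x = f m (f n x)) → PolynomiallyAnalytic v f M R κ →
        LDT A v f K σ₁ σ₂ c₂ ε₀ N₀ → ∀ x, SublinearBound f x δ C₂ C₃ →
        ∀ E ε' : ℝ, |E| ≤ K → 0 < ε' → ε' ≤ ε₀ →
          (Set.ncard {n : Fin d → ℤ | n ∈ cube d L ∧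
            ¬ HasGreenRow A (potential v f x) σ₁ c₂ N ((E : ℂ) + (ε' : ℂ) * Complex.I) n} : ℝ)
            ≤ C₂ * (L : ℝ) ^ (1 - δ) := by
  set κ' := ⌈κ⌉₊ with hκ'
  set m₀ := κ' * b + (d + d) + (d + 2) + 1 with hm₀
  -- N is the integer q-th root of L. The bound q ≥ 2 gives N² ≤ L, and q ≥ m₀/C₃ gives log B = m₀
  -- log N ≤ C₃ log L for the degree bound B = N^m₀.
  set q := max 2 ⌈m₀ / C₃⌉₊ with hq
  have hq2 : 2 ≤ q := le_max_left _ _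
  have hqm : (m₀ : ℝ) ≤ C₃ * q := by
    have h1 : (m₀ : ℝ) / C₃ ≤ q := (Nat.le_ceil _).trans (by exact_mod_cast le_max_right _ _)
    rw [div_le_iff₀ hC₃] at h1
    linarith
  have hS : 0 ≤ ∑' k : Fin d → ℤ, Real.exp (-(c / 4) * ‖k‖) :=
    tsum_nonneg fun _ => (Real.exp_pos _).le
  obtain ⟨N₁, hN₁⟩ := Filter.eventually_atTop.1
    ((eventually_degree_le b d ⌈R⌉₊ κ').and ((eventually_taylor_remainder_lt d c₂ hM).and
      ((eventually_log_lt_rpow hσ₂ q).and ((eventually_resolvent_sum_le d hσ₁ hc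
        (mul_nonneg (mul_nonneg zero_le_three hC₁.le) hS)).and
        ((Filter.eventually_ge_atTop N₀).and (Filter.eventually_ge_atTop 1))))))
  filter_upwards [Filter.eventually_ge_atTop (N₁ ^ q)] with L hL
  obtain ⟨N, hNL, hLN⟩ := exists_pow_le_lt_succ_pow (q := q) (by omega) L
  have hNN : N₁ ≤ N :=
    Nat.lt_succ_iff.1 (lt_of_pow_lt_pow_left₀ q (Nat.zero_le _) (hL.trans_lt hLN))
  obtain ⟨hdeg, htaylor, hlog, hsum, hN₀, hN1⟩ := hN₁ N hNN
  have hN1' : (1 : ℝ) ≤ N := by exact_mod_cast hN1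
  have hL1 : 1 ≤ L := (Nat.one_le_pow _ _ hN1).trans hNL
  have hL1' : (1 : ℝ) ≤ L := by exact_mod_cast hL1
  refine ⟨N, (Nat.pow_le_pow_right hN1 hq2).trans hNL, le_of_eq_of_le (by ring) hsum, ?_⟩
  intro A v f hA hf hv hldt x hx E ε' hE hε' hε₀
  refine ncard_not_hasGreenRow_le hc₂ hM hR (k := N ^ 2) (J := ⌈R⌉₊ * (1 + N) ^ κ')
    (B := N ^ m₀) hN₀ hL1 ?_ ?_ htaylor hdeg ?_ ?_ hA hf hv hldt hx hE hε' hε₀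
  · push_cast
    gcongr
    exact Nat.le_ceil R
  · calc (N : ℝ) ^ σ₁ ≤ (N : ℝ) ^ (1 : ℝ) := Real.rpow_le_rpow_of_exponent_le hN1' hσ₁.le
      _ = N := Real.rpow_one _
  · have h1 : (q : ℝ) * Real.log N ≤ Real.log L := by
      rw [← Real.log_pow]
      exact Real.log_le_log (by positivity) (by exact_mod_cast hNL)
    have h2 : 0 ≤ Real.log N := Real.log_nonneg hN1'
    rw [Nat.cast_pow, Real.log_pow]
    calc (m₀ : ℝ) * Real.log N ≤ C₃ * q * Real.log N := by gcongr
      _ = C₃ * (q * Real.log N) := by ring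
      _ ≤ C₃ * Real.log L := by gcongr
  -- L < (N + 1)^q, so log L grows like log N and stays below N^σ₂.
  · refine lt_of_le_of_lt (Real.log_le_log (by linarith) ?_) hlog
    exact_mod_cast hLN.le

/-- Up to `C₂ L^(1-δ)` bad sites can be avoided by one of the disjoint shells of width of order
`log T` in the cube of size `L = (log T)^α`, `α > 1/δ`. -/
theorem eventually_shells_fit {C₂ δ α s : ℝ} (hC₂ : 0 < C₂) (hδ : 0 < δ) (hδ' : δ ≤ 1)
    (hα : 1 < α * δ) (hs : 0 ≤ s) (ρ₀ : ℕ) :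
    ∀ᶠ l : ℝ in Filter.atTop, ∀ N : ℕ, N ^ 2 ≤ ⌊l ^ α⌋₊ →
      ρ₀ + N + 1 + (⌊C₂ * (⌊l ^ α⌋₊ : ℝ) ^ (1 - δ)⌋₊ + 1) * (2 * ⌈s * l⌉₊ + 1) ≤ ⌊l ^ α⌋₊ := by
  have hα0 : 0 < α := by
    by_contra! h
    nlinarith
  -- The heart of the exponent 1/δ: the number of bad sites, of order l^(α(1-δ)), times the width,
  -- of order l, must be small against L.
  have hexp : α * (1 - δ) + 1 < α := by linarith
  filter_upwards [Filter.eventually_ge_atTop 1,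
    eventually_mul_rpow_le_rpow (4 * ((C₂ + 1) * (2 * s + 3))) hexp,
    (tendsto_rpow_atTop hα0).eventually_ge_atTop (4 * ρ₀ + 100)] with l hl h1 h2 N hN
  set L := ⌊l ^ α⌋₊ with hL
  have hlα : 0 ≤ l ^ α := by positivity
  have hLle : (L : ℝ) ≤ l ^ α := Nat.floor_le hlα
  have hLge : l ^ α < L + 1 := Nat.lt_floor_add_one _
  have hρ : (0 : ℝ) ≤ ρ₀ := Nat.cast_nonneg _
  have hN' : (N : ℝ) ^ 2 ≤ L := by exact_mod_cast hN
  have hN4 : (N : ℝ) ≤ L / 8 + 2 := by nlinarith [sq_nonneg ((N : ℝ) - 4)]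
  have h3 : ((⌊C₂ * (L : ℝ) ^ (1 - δ)⌋₊ : ℝ) + 1) ≤ (C₂ + 1) * l ^ (α * (1 - δ)) := by
    have h4 : (⌊C₂ * (L : ℝ) ^ (1 - δ)⌋₊ : ℝ) ≤ C₂ * (L : ℝ) ^ (1 - δ) :=
      Nat.floor_le (by positivity)
    have h5 : (L : ℝ) ^ (1 - δ) ≤ l ^ (α * (1 - δ)) := by
      rw [Real.rpow_mul (by linarith)]
      exact Real.rpow_le_rpow (by positivity) hLle (by linarith)
    have h6 : 1 ≤ l ^ (α * (1 - δ)) := Real.one_le_rpow hl (mul_nonneg hα0.le (by linarith))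
    nlinarith
  have h4 : (2 * (⌈s * l⌉₊ : ℝ) + 1) ≤ (2 * s + 3) * l := by
    have := Nat.ceil_lt_add_one (a := s * l) (by positivity)
    nlinarith
  have h5 : ((⌊C₂ * (L : ℝ) ^ (1 - δ)⌋₊ : ℝ) + 1) * (2 * (⌈s * l⌉₊ : ℝ) + 1) ≤ l ^ α / 4 := by
    calc _ ≤ ((C₂ + 1) * l ^ (α * (1 - δ))) * ((2 * s + 3) * l) := by gcongr
      _ = (4 * ((C₂ + 1) * (2 * s + 3)) * l ^ (α * (1 - δ) + 1)) / 4 := by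
          rw [Real.rpow_add (by linarith), Real.rpow_one]
          ring
      _ ≤ _ := by gcongr
  have h6 : ((ρ₀ + N + 1 + (⌊C₂ * (L : ℝ) ^ (1 - δ)⌋₊ + 1) * (2 * ⌈s * l⌉₊ + 1) : ℕ) : ℝ)
      ≤ L := by
    push_cast
    linarith
  exact_mod_cast h6

/-- The width 4(u + 4)l/c gives exp(-(u + 4)l). Of this, 2l is lost to the two factors 1/Im z =
exp(l), and l to the constants and powers of l. -/
theorem eventually_resolvent_bound_le (d : ℕ) {K α u c : ℝ} (hα : 0 < α) (hc : 0 < c)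
    {D Φ : ℝ} (hD : 0 ≤ D) (hΦ : 0 ≤ Φ) (S : ℝ) :
    ∀ᶠ l : ℝ in Filter.atTop, Real.exp 1 * Real.pi *
      ((Real.exp l ^ 2 * Φ * Real.exp (-(c / 4) * ⌈4 / c * (u + 4) * l⌉₊) *
        (D * ((4 * ⌊l ^ α⌋₊ + 1 : ℝ) ^ d + S))) * (1 + K ^ 2)) ≤ Real.exp (-(u + 1) * l) := by
  set Q := Real.exp 1 * Real.pi * Φ * D * (1 + K ^ 2) with hQ
  have hQ0 : 0 ≤ Q := by positivity
  filter_upwards [Filter.eventually_ge_atTop 1,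
    eventually_mul_rpow_le_exp (2 * Q * 5 ^ d) (α * d) one_pos,
    eventually_mul_rpow_le_exp (2 * Q * S) 0 one_pos] with l hl h1 h2
  rw [one_mul] at h1 h2
  rw [Real.rpow_zero, mul_one] at h2
  have hlα : 1 ≤ l ^ α := Real.one_le_rpow hl hα.le
  have h3 : (4 * ⌊l ^ α⌋₊ + 1 : ℝ) ^ d ≤ 5 ^ d * l ^ (α * d) := by
    rw [Real.rpow_mul (by linarith), Real.rpow_natCast, ← mul_pow]
    have : (⌊l ^ α⌋₊ : ℝ) ≤ l ^ α := Nat.floor_le (by linarith)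
    gcongr
    linarith
  have h4 : Q * ((4 * ⌊l ^ α⌋₊ + 1 : ℝ) ^ d + S) ≤ Real.exp l := by
    have : Q * (4 * ⌊l ^ α⌋₊ + 1 : ℝ) ^ d ≤ Q * (5 ^ d * l ^ (α * d)) := by gcongr
    linarith
  have h5 : Real.exp (-(c / 4) * ⌈4 / c * (u + 4) * l⌉₊) ≤ Real.exp (-(u + 4) * l) := by
    apply Real.exp_le_exp.2
    have := Nat.le_ceil (4 / c * (u + 4) * l)
    have h6 : c / 4 * (4 / c * (u + 4) * l) ≤ c / 4 * ⌈4 / c * (u + 4) * l⌉₊ := by gcongr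
    have h7 : c / 4 * (4 / c * (u + 4) * l) = (u + 4) * l := by field_simp
    linarith
  calc _ = (Q * ((4 * ⌊l ^ α⌋₊ + 1 : ℝ) ^ d + S)) *
        (Real.exp l ^ 2 * Real.exp (-(c / 4) * ⌈4 / c * (u + 4) * l⌉₊)) := by
        rw [hQ]
        ring
    _ ≤ Real.exp l * (Real.exp l ^ 2 * Real.exp (-(u + 4) * l)) := by gcongr
    _ = _ := by
        rw [← Real.exp_nat_mul, ← Real.exp_add, ← Real.exp_add]
        congr 1
        push_cast
        ring

theorem eventually_exp_floor_rpow_le {α a : ℝ} (hα : 1 < α) (ha : 0 < a) (u : ℝ) {C : ℝ}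
    (hC : 0 ≤ C) :
    ∀ᶠ l : ℝ in Filter.atTop, C * Real.exp (-a * ⌊l ^ α⌋₊) ≤ Real.exp (-u * l) := by
  filter_upwards [Filter.eventually_ge_atTop 1,
    eventually_mul_rpow_le_rpow ((u + 1) / a) hα,
    eventually_mul_rpow_le_exp (C * Real.exp a) 0 one_pos] with l hl h1 h2
  rw [Real.rpow_one, div_mul_eq_mul_div, div_le_iff₀ ha] at h1
  rw [Real.rpow_zero, mul_one, one_mul] at h2
  have h3 : l ^ α < ⌊l ^ α⌋₊ + 1 := Nat.lt_floor_add_one _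
  have h4 : Real.exp (-a * ⌊l ^ α⌋₊) ≤ Real.exp a * Real.exp (-(u + 1) * l) := by
    rw [← Real.exp_add]
    apply Real.exp_le_exp.2
    nlinarith
  calc _ ≤ C * (Real.exp a * Real.exp (-(u + 1) * l)) := by gcongr
    _ = C * Real.exp a * Real.exp (-(u + 1) * l) := by ring
    _ ≤ Real.exp l * Real.exp (-(u + 1) * l) := by gcongr
    _ = _ := by
        rw [← Real.exp_add]
        congr 1
        ring

/-- At time `T = exp l` the evolution is smaller than any given power of `T` outside the cube of
size `l^α`. -/
theorem eventually_norm_evolution_le (d : ℕ) {C₁ c₁ c₂ σ₁ c K δ C₂ α a C : ℝ} (hC₁ : 0 < C₁)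
    (hc : 0 < c) (hcc₁ : c ≤ c₁) (hcc₂ : c ≤ c₂) (hK : 1 ≤ K) (hC₂ : 0 < C₂) (hδ : 0 < δ)
    (hδ' : δ ≤ 1) (hα : 1 < α * δ) (ha : 0 < a) (hC : 0 ≤ C) {φ : Hil d}
    (hφ : {n : Fin d → ℤ | φ n ≠ 0}.Finite) {u : ℝ} (hu : 0 ≤ u) :
    ∀ᶠ l : ℝ in Filter.atTop, ∀ N : ℕ, N ^ 2 ≤ ⌊l ^ α⌋₊ →
      (2 * N + 1 : ℝ) ^ d * (3 * C₁ * Real.exp ((N : ℝ) ^ σ₁) * Real.exp (-(2 / 5 * c * N)) *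
        ∑' k : Fin d → ℤ, Real.exp (-(c / 4) * ‖k‖)) ≤ 1 / 2 →
      ∀ (A : (Fin d → ℤ) → (Fin d → ℤ) → ℂ) (V : (Fin d → ℤ) → ℝ) (H : Hil d →L[ℂ] Hil d),
        IsKernel A C₁ c₁ → ActsBy A V H →
        (∀ z : ℂ, K ≤ |z.re| → ∀ w : Hil d, H w - z • w = -Complex.I • φ → ∀ n, φ n = 0 →
          ‖w n‖ ≤ C * Real.exp (-a * ‖n‖) / z.re ^ 2) →
        (∀ E : ℝ, |E| ≤ K → (Set.ncard {n : Fin d → ℤ | n ∈ cube d ⌊l ^ α⌋₊ ∧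
          ¬ HasGreenRow A V σ₁ c₂ N ((E : ℂ) + ((1 / Real.exp l : ℝ) : ℂ) * Complex.I) n} : ℝ)
            ≤ C₂ * (⌊l ^ α⌋₊ : ℝ) ^ (1 - δ)) →
        ∀ n : Fin d → ℤ, ⌊l ^ α⌋₊ ≤ ‖n‖ →
          ‖(NormedSpace.exp ((-(Complex.I * ((Real.exp l : ℝ) : ℂ))) • H) φ) n‖
            ≤ Real.exp (-u * l) := by
  have hα1 : 1 < α := by nlinarith
  obtain ⟨ρ₀, hρ₀⟩ : ∃ ρ₀ : ℕ, ∀ n, φ n ≠ 0 → ‖n‖ ≤ ρ₀ := by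
    obtain ⟨B, hB⟩ := (hφ.image fun n => ‖n‖).bddAbove
    exact ⟨⌈B⌉₊, fun n hn => (hB ⟨n, hn, rfl⟩).trans (Nat.le_ceil B)⟩
  have hS₁ : 0 ≤ ∑' k : Fin d → ℤ, Real.exp (-(c₁ / 4) * ‖k‖) :=
    tsum_nonneg fun _ => (Real.exp_pos _).le
  have hS₂ : 0 ≤ ∑' k : Fin d → ℤ, Real.exp (-(c₁ / 2) * ‖k‖) :=
    tsum_nonneg fun _ => (Real.exp_pos _).le
  filter_upwards [Filter.eventually_ge_atTop 1,
    eventually_shells_fit (s := 4 / c * (u + 4)) hC₂ hδ hδ' hα (by positivity) ρ₀,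
    eventually_resolvent_bound_le d (K := K) (u := u) (zero_lt_one.trans hα1) hc
      (mul_nonneg hC₁.le hS₁) (norm_nonneg φ)
      (∑' k : Fin d → ℤ, Real.exp (-(c₁ / 2) * ‖k‖)),
    eventually_exp_floor_rpow_le hα1 ha (u + 1) (C := Real.exp 1 * Real.pi * (2 * C))
      (by positivity)] with l hl hfit hβ hγ N hN hsum A V H hA hH hout hcard n hn
  set L := ⌊l ^ α⌋₊ with hL
  have hφ' : ∀ n, (-Complex.I • φ : Hil d) n ≠ 0 → ‖n‖ ≤ ρ₀ := by
    intro n hn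
    refine hρ₀ n fun h => hn ?_
    change -Complex.I * φ n = 0
    rw [h, mul_zero]
  have hφn : φ n = 0 := by
    by_contra h
    have h1 := hρ₀ n h
    have h2 : (ρ₀ : ℝ) + 1 ≤ L := by
      have := hfit N hN
      exact_mod_cast (show ρ₀ + 1 ≤ L by nlinarith)
    linarith
  have h := norm_evolution_le_of_resolvent (hH.isSelfAdjoint hA.hermitian) φ (Real.exp_pos l) hK
    (β := Real.exp l ^ 2 * ‖φ‖ * Real.exp (-(c / 4) * ⌈4 / c * (u + 4) * l⌉₊) *
      (C₁ * (∑' k : Fin d → ℤ, Real.exp (-(c₁ / 4) * ‖k‖)) *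
        ((4 * L + 1 : ℝ) ^ d + ∑' k : Fin d → ℤ, Real.exp (-(c₁ / 2) * ‖k‖))))
    (γ := C * Real.exp (-a * L)) (by positivity) (by positivity) n ?_ ?_
  · refine h.trans ?_
    -- The low and high energy parts are estimated with u + 1 in place of u, so that their sum is
    -- absorbed by exp(l) ≥ 2.
    have h1 : Real.exp (-(u + 1) * l) + Real.exp (-(u + 1) * l) ≤ Real.exp (-u * l) := by
      have h2 : Real.exp (-u * l) = Real.exp l * Real.exp (-(u + 1) * l) := by
        rw [← Real.exp_add]
        congr 1
        ring
      have h3 : 2 ≤ Real.exp l := by linarith [Real.add_one_le_exp l]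
      rw [h2]
      nlinarith [Real.exp_pos (-(u + 1) * l)]
    refine le_trans (le_of_eq ?_) ((add_le_add hβ hγ).trans h1)
    ring
  · intro E hE w hw
    have him : ∀ t : ℝ, ((E : ℂ) + (t : ℂ) * Complex.I).im = t := fun t => by simp
    have h1 := norm_resolvent_le_of_ncard_le hC₁ hc hcc₁ hcc₂ hA hH
      (z := (E : ℂ) + ((1 / Real.exp l : ℝ) : ℂ) * Complex.I) (by rw [him]; positivity) hw
      (r := ρ₀ + N + 1) (r₀ := ρ₀) (W := ⌈4 / c * (u + 4) * l⌉₊) hφ' (by push_cast; linarith)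
      (hfit N hN) (Nat.le_floor (hcard E hE)) hsum n hn
    refine h1.trans (le_of_eq ?_)
    rw [him, one_div, inv_inv, norm_smul, norm_neg, Complex.norm_I, one_mul]
  · intro E hE w hw
    have hre : ∀ t : ℝ, ((E : ℂ) + (t : ℂ) * Complex.I).re = E := fun t => by simp
    have h1 := hout _ (by rwa [hre]) w hw n hφn
    rw [hre] at h1
    refine h1.trans ?_
    have : Real.exp (-a * ‖n‖) ≤ Real.exp (-a * L) := by
      apply Real.exp_le_exp.2
      nlinarith
    gcongr

/-- Cut at D ≈ T² with T = exp(l). Up to D there are O(T^(2d)) sites of weight O(T^(2p)), balanced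
by the squared amplitude T^(-2(d+p)). Beyond D, the ballistic loss exp(2KT) is beaten by exp(-aT²).
Only the inner cube, of order l^(αp), grows. -/
theorem eventually_moment_le (d : ℕ) {p K α s a C : ℝ} (hp : 0 < p) (hα : 0 < α)
    (hs : α * p < s) (ha : 0 < a) (φ : Hil d) :
    ∀ᶠ l : ℝ in Filter.atTop, ∀ H : Hil d →L[ℂ] Hil d, IsSelfAdjoint H →
      (∀ t : ℝ, 0 ≤ t → ∀ n, ‖(NormedSpace.exp ((-(Complex.I * (t : ℂ))) • H) φ) n‖
        ≤ C * Real.exp (K * t) * Real.exp (-a * ‖n‖)) →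
      (∀ n : Fin d → ℤ, ⌊l ^ α⌋₊ ≤ ‖n‖ →
        ‖(NormedSpace.exp ((-(Complex.I * ((Real.exp l : ℝ) : ℂ))) • H) φ) n‖
          ≤ Real.exp (-(d + p) * l)) →
      moment H φ p (Real.exp l) ≤ ENNReal.ofReal (l ^ s) := by
  set S := ∑' n : Fin d → ℤ, ‖n‖ ^ p * Real.exp (-a * ‖n‖) with hS
  have hS0 : 0 ≤ S := tsum_nonneg fun n => by positivity
  filter_upwards [Filter.eventually_ge_atTop 1, eventually_mul_rpow_le_rpow
      (‖φ‖ ^ 2 + 5 ^ d * 2 ^ p + C ^ 2 * S) hs,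
    Real.tendsto_exp_atTop.eventually_ge_atTop (2 * K / a)] with l hl h1 h2 H hH hdecay hann
  refine (moment_le_of_annulus hH hp.le ha (hdecay _ (Real.exp_pos l).le) hann
    (D := ⌈Real.exp l ^ 2⌉₊)).trans (ENNReal.ofReal_le_ofReal (le_trans ?_ h1))
  have hlα : 1 ≤ l ^ (α * p) := Real.one_le_rpow hl (by positivity)
  have hLp : (⌊l ^ α⌋₊ : ℝ) ^ p ≤ l ^ (α * p) := by
    rw [Real.rpow_mul (by linarith)]
    exact Real.rpow_le_rpow (by positivity) (Nat.floor_le (by positivity)) hp.le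
  have hT1 : 1 ≤ Real.exp l ^ 2 := one_le_pow₀ (Real.one_le_exp (by linarith))
  have hDge := Nat.le_ceil (Real.exp l ^ 2)
  have hDlt := Nat.ceil_lt_add_one (a := Real.exp l ^ 2) (by positivity)
  set D := ⌈Real.exp l ^ 2⌉₊
  have hmid : (2 * D + 1 : ℝ) ^ d * ((D : ℝ) ^ p * Real.exp (-(d + p) * l) ^ 2)
      ≤ 5 ^ d * 2 ^ p := by
    have h3 : (2 * D + 1 : ℝ) ≤ 5 * Real.exp l ^ 2 := by linarith
    have h4 : (D : ℝ) ≤ 2 * Real.exp l ^ 2 := by linarith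
    have h5 : (D : ℝ) ^ p ≤ 2 ^ p * Real.exp (2 * p * l) := by
      refine (Real.rpow_le_rpow (by positivity) h4 hp.le).trans (le_of_eq ?_)
      rw [Real.mul_rpow (by positivity) (by positivity), ← Real.exp_nat_mul, ← Real.exp_mul]
      congr 2
      push_cast
      ring
    calc _ ≤ (5 * Real.exp l ^ 2) ^ d * ((2 ^ p * Real.exp (2 * p * l)) *
          Real.exp (-(d + p) * l) ^ 2) := by gcongr
      _ = 5 ^ d * 2 ^ p * (Real.exp (2 * d * l) * Real.exp (2 * p * l) *
          Real.exp (2 * (-(d + p) * l))) := by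
          have h6 : (Real.exp l ^ 2) ^ d = Real.exp (2 * d * l) := by
            rw [← Real.exp_nat_mul, ← Real.exp_nat_mul]
            congr 1
            push_cast
            ring
          have h7 : Real.exp (-(d + p) * l) ^ 2 = Real.exp (2 * (-(d + p) * l)) := by
            rw [← Real.exp_nat_mul]
            norm_num
          rw [mul_pow, h6, h7]
          ring
      _ = 5 ^ d * 2 ^ p := by
          rw [← Real.exp_add, ← Real.exp_add]
          ring_nf
          simp
  have hout : (C * Real.exp (K * Real.exp l)) ^ 2 * Real.exp (-a * D) ≤ C ^ 2 := by
    rw [mul_pow, ← Real.exp_nat_mul, mul_assoc, ← Real.exp_add]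
    refine mul_le_of_le_one_right (sq_nonneg C) (Real.exp_le_one_iff.2 ?_)
    rw [div_le_iff₀ ha] at h2
    push_cast
    have h3 : a * Real.exp l ^ 2 ≤ a * D := by gcongr
    nlinarith [mul_le_mul_of_nonneg_right h2 (Real.exp_pos l).le]
  have h3 : (⌊l ^ α⌋₊ : ℝ) ^ p * ‖φ‖ ^ 2 ≤ l ^ (α * p) * ‖φ‖ ^ 2 := by gcongr
  have h4 := mul_le_mul_of_nonneg_right hout hS0
  have h5 : 0 ≤ (5 ^ d * 2 ^ p + C ^ 2 * S) * (l ^ (α * p) - 1) := by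
    have : 0 ≤ l ^ (α * p) - 1 := by linarith
    positivity
  nlinarith

/-! ### Time averages. -/

theorem lintegral_exp_neg_div {T : ℝ} (hT : 0 < T) :
    ∫⁻ t in Set.Ioi (0 : ℝ), ENNReal.ofReal (Real.exp (-t / T)) = ENNReal.ofReal T := by
  have hT' : -T⁻¹ < 0 := by simpa using hT
  have h : (fun t : ℝ => Real.exp (-t / T)) = fun t => Real.exp (-T⁻¹ * t) := by
    funext t
    congr 1
    field_simp
  rw [← MeasureTheory.ofReal_integral_eq_lintegral_ofReal, h, integral_exp_mul_Ioi hT']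
  · simp
  · rw [h]
    exact integrableOn_exp_mul_Ioi hT' 0
  · exact Filter.Eventually.of_forall fun t => (Real.exp_pos _).le

/-- Time averages inherit polylogarithmic upper bounds. -/
theorem eventually_average_le {T₁ s s' : ℝ} (hT₁ : 1 ≤ T₁) (B : ℝ) (hs : 0 ≤ s) (hss' : s < s') :
    ∀ᶠ T : ℝ in Filter.atTop, ∀ g : ℝ → ℝ≥0∞,
      (∀ t, 0 ≤ t → t ≤ T₁ → g t ≤ ENNReal.ofReal B) →
      (∀ t, T₁ ≤ t → g t ≤ ENNReal.ofReal (Real.log t ^ s)) →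
      ENNReal.ofReal (2 / T) *
        ∫⁻ t in Set.Ioi (0 : ℝ), ENNReal.ofReal (Real.exp (-2 * t / T)) * g t
          ≤ ENNReal.ofReal (Real.log T ^ s') := by
  obtain ⟨T₂, hT₂⟩ := Filter.eventually_atTop.1
    ((isLittleO_log_rpow_rpow_atTop s (half_pos one_pos)).bound one_pos)
  filter_upwards [Filter.eventually_ge_atTop 1, Filter.eventually_ge_atTop T₂,
    Real.tendsto_log_atTop.eventually_ge_atTop 1,
    Real.tendsto_log_atTop.eventually (eventually_mul_rpow_le_rpow
      (2 * (|B| + 2 ^ s + 1)) hss')] with T hT1 hTT₂ hlog hfin g hg₁ hg₂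
  have hT0 : 0 < T := by linarith
  set Q := |B| + (2 * Real.log T) ^ s + 1 with hQ
  have hl2 : 0 ≤ (2 * Real.log T) ^ s := by positivity
  have hQ0 : 1 ≤ Q := by
    have := abs_nonneg B
    linarith
  have hpt : ∀ t, 0 < t → ENNReal.ofReal (Real.exp (-2 * t / T)) * g t
      ≤ ENNReal.ofReal Q * ENNReal.ofReal (Real.exp (-t / T)) := by
    intro t ht
    -- One factor is kept for integration over t, the other absorbs the growth of the moment at
    -- times beyond T².
    have hsplit : Real.exp (-2 * t / T) = Real.exp (-t / T) * Real.exp (-t / T) := by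
      rw [← Real.exp_add]
      congr 1
      ring
    have hle1 : Real.exp (-t / T) ≤ 1 := Real.exp_le_one_iff.2 (by
      rw [neg_div, neg_nonpos]
      positivity)
    have hpos := Real.exp_pos (-t / T)
    suffices h : ∃ r : ℝ, g t ≤ ENNReal.ofReal r ∧ Real.exp (-t / T) * r ≤ Q by
      obtain ⟨r, hr, hrQ⟩ := h
      calc _ ≤ ENNReal.ofReal (Real.exp (-2 * t / T)) * ENNReal.ofReal r := by gcongr
        _ = ENNReal.ofReal (Real.exp (-t / T) * r * Real.exp (-t / T)) := by
            rw [← ENNReal.ofReal_mul (Real.exp_pos _).le, hsplit]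
            congr 1
            ring
        _ ≤ ENNReal.ofReal (Q * Real.exp (-t / T)) := by gcongr
        _ = _ := ENNReal.ofReal_mul (by linarith)
    rcases le_total t T₁ with h1 | h1
    · refine ⟨|B|, (hg₁ t ht.le h1).trans (ENNReal.ofReal_le_ofReal (le_abs_self B)), ?_⟩
      have := mul_le_of_le_one_left (abs_nonneg B) hle1
      linarith
    have hlogt : 0 ≤ Real.log t := Real.log_nonneg (hT₁.trans h1)
    rcases le_total t (T ^ 2) with h2 | h2
    · refine ⟨(2 * Real.log T) ^ s, (hg₂ t h1).trans (ENNReal.ofReal_le_ofReal ?_), ?_⟩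
      · have : Real.log t ≤ 2 * Real.log T := by
          have := Real.log_le_log ht h2
          rwa [Real.log_pow, Nat.cast_ofNat] at this
        gcongr
      · have := mul_le_of_le_one_left hl2 hle1
        have := abs_nonneg B
        linarith
    -- For t ≥ T² one has (log t)^s ≤ √t ≤ t/T, and exp(-t/T) · t/T ≤ 1.
    · refine ⟨t / T, (hg₂ t h1).trans (ENNReal.ofReal_le_ofReal ?_), ?_⟩
      · have h4 := hT₂ t (by nlinarith)
        rw [one_mul, Real.norm_eq_abs, Real.norm_eq_abs] at h4
        refine (le_abs_self _).trans (h4.trans ?_)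
        rw [abs_of_nonneg (by positivity), ← Real.sqrt_eq_rpow, le_div_iff₀ hT0]
        have h5 : T ≤ Real.sqrt t := Real.le_sqrt_of_sq_le h2
        calc Real.sqrt t * T ≤ Real.sqrt t * Real.sqrt t := by gcongr
          _ = t := Real.mul_self_sqrt ht.le
      · have h4 : t / T ≤ Real.exp (t / T) := by linarith [Real.add_one_le_exp (t / T)]
        calc Real.exp (-t / T) * (t / T) ≤ Real.exp (-t / T) * Real.exp (t / T) := by gcongr
          _ = 1 := by
              rw [← Real.exp_add]
              ring_nf
              simp
          _ ≤ Q := hQ0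
  have hint : ∫⁻ t in Set.Ioi (0 : ℝ), ENNReal.ofReal (Real.exp (-2 * t / T)) * g t
      ≤ ENNReal.ofReal Q * ENNReal.ofReal T := by
    rw [← lintegral_exp_neg_div hT0, ← MeasureTheory.lintegral_const_mul']
    · exact MeasureTheory.setLIntegral_mono' measurableSet_Ioi fun t ht => hpt t ht
    · exact ENNReal.ofReal_ne_top
  calc _ ≤ ENNReal.ofReal (2 / T) * (ENNReal.ofReal Q * ENNReal.ofReal T) := by gcongr
    _ = ENNReal.ofReal (2 * Q) := by
        rw [← ENNReal.ofReal_mul (by linarith), ← ENNReal.ofReal_mul (by positivity)]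
        congr 1
        field_simp
    _ ≤ _ := by
        apply ENNReal.ofReal_le_ofReal
        refine le_trans ?_ hfin
        have h1 : 1 ≤ Real.log T ^ s := Real.one_le_rpow hlog hs
        rw [hQ, Real.mul_rpow zero_le_two (by linarith)]
        nlinarith [mul_nonneg (abs_nonneg B) (sub_nonneg.2 h1)]

theorem PolynomiallyAnalytic.abs_potential_le {d b : ℕ} {v : Torus b → ℝ}
    {f : (Fin d → ℤ) → Torus b → Torus b} {M R κ : ℝ} (hv : PolynomiallyAnalytic v f M R κ)
    (x : Torus b) (n : Fin d → ℤ) : |potential v f x n| ≤ M := by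
  obtain ⟨y, -, rfl⟩ := exists_toTorus_eq x
  simpa [potential] using (hv n).2 0 y

end LongRange

/-! ### The theorem. -/

open LongRange in
theorem theorem5p2 (d b : ℕ) (hd : 1 ≤ d) (hb : 1 ≤ b)
    (p K σ₁ σ₂ δ ε₀ c₁ c₂ C₁ C₂ C₃ M R κ ε : ℝ) (N₀ : ℕ)
    (hp : 0 < p) (hσ₁ : 0 < σ₁) (hσ₁' : σ₁ < 1) (hσ₂ : 0 < σ₂) (hδ : 0 < δ) (hε₀ : 0 < ε₀)
    (hc₁ : 0 < c₁) (hc₂ : 0 < c₂) (hC₁ : 0 < C₁) (hC₂ : 0 < C₂) (hC₃ : 0 < C₃)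
    (hM : 0 < M) (hR : 0 < R) (hε : 0 < ε)
    (φ : Hil d) (hφ : {n : Fin d → ℤ | φ n ≠ 0}.Finite) :
    ∃ T₀ : ℝ, 0 < T₀ ∧
      ∀ (A : (Fin d → ℤ) → (Fin d → ℤ) → ℂ) (v : Torus b → ℝ)
        (f : (Fin d → ℤ) → Torus b → Torus b),
        IsKernel A C₁ c₁ →
        AnalyticOnNhd ℝ (fun y : Fin b → ℝ => v (toTorus y)) Set.univ →
        (∀ m n x, f (m + n) x = f m (f n x)) →
        PolynomiallyAnalytic v f M R κ →
        LDT A v f K σ₁ σ₂ c₂ ε₀ N₀ →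
        ∀ x : Torus b,
          spectrum ℂ (longRangeOp A (potential v f x)) ⊆
            Complex.ofReal '' Set.Icc (-K + 1) (K - 1) →
          SublinearBound f x δ C₂ C₃ →
          ∀ T : ℝ, T₀ ≤ T →
            avgMoment (longRangeOp A (potential v f x)) φ p T
                ≤ ENNReal.ofReal (Real.log T ^ (p / δ + ε)) ∧
              moment (longRangeOp A (potential v f x)) φ p T
                ≤ ENNReal.ofReal (Real.log T ^ (p / δ + ε)) := by
  -- Otherwise no admissible x exists: the nonempty spectrum forces K ≥ 1 and the sublinear bound
  -- forces δ ≤ 1.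
  by_cases hKδ : 1 ≤ K ∧ δ ≤ 1
  swap
  · refine ⟨1, one_pos, fun A v f hA _ _ hv _ x hspec hx => ?_⟩
    refine absurd ⟨?_, hx.delta_le_one hb hC₃⟩ hKδ
    have hH := actsBy_longRangeOp hc₁ hA _ M (hv.abs_potential_le x)
    linarith [(norm_nonneg _).trans
      (norm_le_of_spectrum_subset (hH.isSelfAdjoint hA.hermitian) hspec)]
  obtain ⟨hK, hδ'⟩ := hKδ
  obtain ⟨a, C, ha, hC, hdecay⟩ := exists_decay_constants d hC₁ hc₁ K hφ
  set c := min c₁ c₂ with hc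
  have hc0 : 0 < c := lt_min hc₁ hc₂
  -- Large enough for αδ > 1, small enough for αp < p/δ + ε/2; the remaining ε/2 is left for time
  -- averaging.
  set α := 1 / δ + ε / (4 * p) with hα
  have hα0 : 0 < α := by positivity
  have hαδ : 1 < α * δ := by
    have : 0 < ε / (4 * p) * δ := by positivity
    have h1 : α * δ = 1 + ε / (4 * p) * δ := by rw [hα]; field_simp
    linarith
  have hαp : α * p < p / δ + ε / 2 := by
    have h1 : α * p = p / δ + ε / 4 := by rw [hα]; field_simp
    linarith
  have hfloor : Filter.Tendsto (fun T : ℝ => ⌊Real.log T ^ α⌋₊) Filter.atTop Filter.atTop :=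
    tendsto_nat_floor_atTop.comp ((tendsto_rpow_atTop hα0).comp Real.tendsto_log_atTop)
  obtain ⟨T₁, hT₁⟩ := Filter.eventually_atTop.1
    ((hfloor.eventually (eventually_exists_scale d b (K := K) (δ := δ) (ε₀ := ε₀) (c₁ := c₁)
      (C₂ := C₂) (κ := κ) N₀ hσ₁' hσ₂ hc0 hc₂ hC₁ hC₃ hM hR)).and
    ((Real.tendsto_log_atTop.eventually (eventually_norm_evolution_le d (σ₁ := σ₁) hC₁ hc0
      (min_le_left _ _) (min_le_right _ _) hK hC₂ hδ hδ' hαδ ha hC hφ (u := d + p)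
      (by positivity))).and
    ((Real.tendsto_log_atTop.eventually (eventually_moment_le d (K := K) (C := C) hp hα0 hαp ha
      φ)).and
    ((Filter.eventually_ge_atTop (1 / ε₀)).and (Filter.eventually_ge_atTop (Real.exp 1))))))
  set T₂ := max T₁ 1 with hT₂
  obtain ⟨T₃, hT₃⟩ := Filter.eventually_atTop.1
    (eventually_average_le (T₁ := T₂) (s := p / δ + ε / 2) (s' := p / δ + ε) (le_max_right _ _)
      ((C * Real.exp (K * T₂)) ^ 2 * ∑' n : Fin d → ℤ, ‖n‖ ^ p * Real.exp (-a * ‖n‖))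
      (by positivity) (by linarith))
  refine ⟨max T₂ T₃, lt_max_of_lt_left (lt_max_of_lt_right one_pos), ?_⟩
  intro A v f hA _ hf hv hldt x hspec hx T hT
  have hH := actsBy_longRangeOp hc₁ hA _ M (hv.abs_potential_le x)
  set H := longRangeOp A (potential v f x) with hHdef
  have hsa := hH.isSelfAdjoint hA.hermitian
  obtain ⟨hloc, hout⟩ := hdecay A _ H hA hH (norm_le_of_spectrum_subset hsa hspec)
  -- The fixed-time bound, with Im z = 1/t. The threshold 1/ε₀ on t makes this imaginary part
  -- admissible for the LDT.
  have hfixed : ∀ t, T₂ ≤ t →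
      moment H φ p t ≤ ENNReal.ofReal (Real.log t ^ (p / δ + ε / 2)) := by
    intro t ht
    obtain ⟨⟨N, hN, hsum, hscale⟩, hevol, hmom, ht₀, -⟩ := hT₁ t ((le_max_left _ _).trans ht)
    have ht1 : 0 < t := one_pos.trans_le ((le_max_right _ _).trans ht)
    rw [Real.exp_log ht1] at hmom hevol
    refine hmom H hsa hloc (hevol N hN hsum A _ H hA hH hout fun E hE => ?_)
    exact hscale A v f hA hf hv hldt x hx E (1 / t) hE (by positivity)
      ((one_div_le ht1 hε₀).2 ht₀)
  have hTT₂ := (le_max_left _ _).trans hT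
  refine ⟨hT₃ T ((le_max_right _ _).trans hT) _ (fun t ht0 ht => ?_) hfixed,
    (hfixed T hTT₂).trans (ENNReal.ofReal_le_ofReal ?_)⟩
  · refine (moment_le_of_exp_decay hp.le ha (hloc t ht0)).trans (ENNReal.ofReal_le_ofReal ?_)
    have hS : 0 ≤ ∑' n : Fin d → ℤ, ‖n‖ ^ p * Real.exp (-a * ‖n‖) :=
      tsum_nonneg fun n => by positivity
    gcongr
  · have h1 : 1 ≤ Real.log T := by
      have h2 := (hT₁ T ((le_max_left _ _).trans hTT₂)).2.2.2.2
      have := Real.log_le_log (Real.exp_pos 1) h2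
      rwa [Real.log_exp] at this
    exact Real.rpow_le_rpow_of_exponent_le h1 (by linarith)
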